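/- **Theorem (Existence and uniqueness).** Let $(\Omega,\mathcal F,P)$ be a complete probability space carrying a Brownian sheet $B=\{B(t,x):t\ge 0,\ x\in\mathbb R\}$, and let $\mathcal F_{t,x}$ be the $P$-completed $\sigma$-field generated by $B(s,a)$, $0\le s\le t$, $a\le x$. For $z=(t,x)\in\mathbb R_+^2$ put $R_z=[0,t]\times[0,x]$. Let $\mathbb M$ be the Hilbert space completion of the space of random finite signed measures $\mu$ on $\mathbb R$ for which $$\|\mu\|_{\mathbb M}^2=E\Big[\int_{\mathbb R}|\hat\mu(\xi)|^2e^{-\xi^2}\,d\xi\Big],\qquad \hat\mu(\xi)=\int_{\mathbb R}e^{-ix\xi}\mu(dx),$$ is finite (with inner product $E[\int_{\mathbb R}\operatorname{Re}(\overline{\hat\mu}\,\hat\eta)(\xi)e^{-\xi^2}d\xi]$); a probability law on $\mathbb R$ is regarded as a (constant) element of $\mathbb M$. Let $T>0$, $y\in\mathbb R$, and let $\alpha,\beta:[0,T]^2\times\mathbb R\times\mathbb M\to\mathbb R$ be such that (a) $\alpha$ and $\beta$ are Borel measurable and locally bounded; (b) there is a constant $C$ with $$|\alpha(z,u,\mu)-\alpha(z,u',\mu')|+|\beta(z,u,\mu)-\beta(z,u',\mu')|\le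 C\big(|u-u'|+\|\mu-\mu'\|_{\mathbb M}\big)$$ for all $z\in[0,T]^2$, $u,u'\in\mathbb R$, $\mu,\mu'\in\mathbb M$, and $\int_{R_z}\big(|\alpha(\zeta,0,\delta_0)|^2+|\beta(\zeta,0,\delta_0)|^2\big)d\zeta<\infty$ for all $z\in[0,T]^2$. For $z_0\in[0,T]^2$, a strong solution on $R_{z_0}$ of the McKean–Vlasov SPDE $$\frac{\partial^2}{\partial t\,\partial x}Y(z)=\alpha(z,Y(z),\mu_z)+\beta(z,Y(z),\mu_z)\diamond\overset{\bullet}{B}(z),\qquad Y(0,0)=y,$$ is a jointly measurable, $(\mathcal F_z)$-adapted process $Y$ on $R_{z_0}$ such that, with $\mu_z$ the law of $Y(z)$, almost surely $\int_{R_{z_0}}|\alpha(\zeta,Y(\zeta),\mu_\zeta)|\,d\zeta<\infty$, the process $\beta(\zeta,Y(\zeta),\mu_\zeta)$ is square integrable on $R_{z_0}\times\Omega$ and Itô integrable with respect to $B$, and for every $z\in R_{z_0}$, almost surely, $$Y(z)=y+\int_{R_z}\alpha(\zeta,Y(\zeta),\mu_\zeta)\,d\zeta+\int_{R_z}\beta(\zeta,Y(\zeta),\mu_\zeta)\,B(d\zeta).$$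 The two-parameter Itô integral is the $L^2$-extension of the elementary integral of simple predictable processes $\sum_i\xi_i1_{(a_i,b_i]}$, with $\xi_i$ bounded and $\mathcal F_{a_i}$-measurable. Then there is a strong solution $Y$ on all of $[0,T]^2$, and it is unique: for every $z_0\in[0,T]^2$ and every strong solution $Y'$ on $R_{z_0}$ one has $Y'(z)=Y(z)$ almost surely for each $z\in R_{z_0}$. -/

import Mathlib

open MeasureTheory ProbabilityTheory Filter Topology

noncomputable section

namespace MVSheet

/-! ### The space of random measures with the Fourier-weighted norm -/

section RandomMeasures

/-- The weight `e^{-y²} dy` on the real line. -/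
def weight : Measure ℝ :=
  volume.withDensity (fun y => ENNReal.ofReal (Real.exp (-y ^ 2)))

instance : SFinite weight := by unfold weight; infer_instance

/-- The Fourier transform `∫ e^{-ixy} μ(dx)` of a finite signed measure `μ` on the real line. -/
def fourier (μ : SignedMeasure ℝ) (y : ℝ) : ℂ :=
  VectorMeasure.integral μ (fun x : ℝ => Complex.exp (-(Complex.I * x * y)))
    (ContinuousLinearMap.lsmul ℝ ℝ).flip

theorem integrable_exp (μ : SignedMeasure ℝ) (y : ℝ) :
    VectorMeasure.Integrable μ (fun x : ℝ => Complex.exp (-(Complex.I * x * y))) := by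
  have : IsFiniteMeasure μ.variation := by
    rw [← SignedMeasure.totalVariation_eq_variation]
    unfold SignedMeasure.totalVariation
    infer_instance
  refine MeasureTheory.Integrable.of_bound (C := 1) (by fun_prop) (.of_forall fun x => ?_)
  simp [Complex.norm_exp]

theorem fourier_add (μ ν : SignedMeasure ℝ) (y : ℝ) :
    fourier (μ + ν) y = fourier μ y + fourier ν y :=
  VectorMeasure.integral_add_vectorMeasure (integrable_exp μ y) (integrable_exp ν y)

theorem fourier_smul (c : ℝ) (μ : SignedMeasure ℝ) (y : ℝ) :
    fourier (c • μ) y = c • fourier μ y :=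
  VectorMeasure.integral_smul_vectorMeasure _ c

/-- On finite (positive) measures, `fourier` is the usual Fourier transform. -/
theorem fourier_toSignedMeasure (ν : Measure ℝ) [IsFiniteMeasure ν] (y : ℝ) :
    fourier ν.toSignedMeasure y = ∫ x : ℝ, Complex.exp (-(Complex.I * x * y)) ∂ν :=
  VectorMeasure.integral_toSignedMeasure

variable {Ω : Type*} [MeasurableSpace Ω]

/-- The real vector space of random finite signed measures `μ` on the real line with
`E ∫ |μ̂(y)|² e^{-y²} dy < ∞`. -/
def randomMeasures (P : Measure Ω) [IsProbabilityMeasure P] :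
    Submodule ℝ (Ω → SignedMeasure ℝ) where
  carrier := {μ | (∀ A : Set ℝ, MeasurableSet A → Measurable (fun ω => μ ω A)) ∧
    MemLp (fun p : Ω × ℝ => fourier (μ p.1) p.2) 2 (P.prod weight)}
  zero_mem' := by
    refine ⟨fun A _ => by simp, ?_⟩
    have h : (fun p : Ω × ℝ => fourier ((0 : Ω → SignedMeasure ℝ) p.1) p.2) = 0 := by
      funext p
      have := fourier_smul 0 0 p.2
      simpa using this
    rw [h]
    exact MemLp.zero
  add_mem' := by
    rintro μ ν ⟨hμ, hμ'⟩ ⟨hν, hν'⟩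
    refine ⟨fun A hA => (hμ A hA).add (hν A hA), ?_⟩
    have h : (fun p : Ω × ℝ => fourier ((μ + ν) p.1) p.2)
        = (fun p : Ω × ℝ => fourier (μ p.1) p.2) + fun p => fourier (ν p.1) p.2 := by
      funext p
      exact fourier_add _ _ _
    rw [h]
    exact hμ'.add hν'
  smul_mem' := by
    rintro c μ ⟨hμ, hμ'⟩
    refine ⟨fun A hA => (hμ A hA).const_smul c, ?_⟩
    have h : (fun p : Ω × ℝ => fourier ((c • μ) p.1) p.2)
        = c • (fun p : Ω × ℝ => fourier (μ p.1) p.2) := by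
      funext p
      exact fourier_smul _ _ _
    rw [h]
    exact hμ'.const_smul c

variable (P : Measure Ω) [IsProbabilityMeasure P]

/-- The pre-Hilbert space of random measures. -/
def RandomMeasure : Type _ := randomMeasures P

instance : AddCommGroup (RandomMeasure P) :=
  inferInstanceAs (AddCommGroup (randomMeasures P))

instance : Module ℝ (RandomMeasure P) :=
  inferInstanceAs (Module ℝ (randomMeasures P))

variable {P}

/-- The Fourier transform of a random measure, as a function of `ω` and `y`. -/
def RandomMeasure.hat (μ : RandomMeasure P) (ω : Ω) (y : ℝ) : ℂ := fourier (μ.1 ω) y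

/-- `E ∫ Re (conj μ̂(y) η̂(y)) e^{-y²} dy`. -/
def RandomMeasure.innerProd (μ η : RandomMeasure P) : ℝ :=
  ∫ ω, ∫ y, (starRingEnd ℂ (μ.hat ω y) * η.hat ω y).re ∂weight ∂P

theorem RandomMeasure.integrable_inner (μ η : RandomMeasure P) :
    MeasureTheory.Integrable
      (fun p : Ω × ℝ => (starRingEnd ℂ (μ.hat p.1 p.2) * η.hat p.1 p.2).re)
      (P.prod weight) := by
  have h := (MemLp.integrable_mul (p := 2) (q := 2) μ.2.2.star η.2.2)
  exact h.re

theorem RandomMeasure.innerProd_eq (μ η : RandomMeasure P) :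
    μ.innerProd η =
      ∫ p : Ω × ℝ, (starRingEnd ℂ (μ.hat p.1 p.2) * η.hat p.1 p.2).re ∂(P.prod weight) :=
  (integral_prod _ (μ.integrable_inner η)).symm

variable (P) in
/-- The positive semidefinite inner product on random measures. -/
@[reducible] def RandomMeasure.core : PreInnerProductSpace.Core ℝ (RandomMeasure P) where
  inner μ η := μ.innerProd η
  conj_inner_symm μ η := by
    simp only [conj_trivial, RandomMeasure.innerProd]
    congr! 4
    simp only [Complex.mul_re, Complex.conj_re, Complex.conj_im]
    ring
  re_inner_nonneg μ := by
    refine integral_nonneg fun ω => integral_nonneg fun y => ?_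
    simp only [Pi.zero_apply, Complex.mul_re, Complex.conj_re, Complex.conj_im]
    nlinarith [mul_self_nonneg (μ.hat ω y).re, mul_self_nonneg (μ.hat ω y).im]
  add_left μ ν η := by
    simp only [RandomMeasure.innerProd_eq]
    rw [← integral_add (μ.integrable_inner η) (ν.integrable_inner η)]
    congr 1
    funext p
    have : (μ + ν).hat p.1 p.2 = μ.hat p.1 p.2 + ν.hat p.1 p.2 := fourier_add _ _ _
    simp only [this, map_add, add_mul, Complex.add_re]
  smul_left μ η c := by
    simp only [RandomMeasure.innerProd_eq]
    rw [conj_trivial, ← integral_const_mul]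
    congr 1
    funext p
    have : (c • μ).hat p.1 p.2 = c • μ.hat p.1 p.2 := fourier_smul _ _ _
    simp only [this, Complex.real_smul, map_mul, Complex.conj_ofReal, mul_assoc,
      Complex.re_ofReal_mul]

instance : SeminormedAddCommGroup (RandomMeasure P) :=
  InnerProductSpace.Core.toSeminormedAddCommGroup (c := RandomMeasure.core P)

instance : InnerProductSpace ℝ (RandomMeasure P) :=
  InnerProductSpace.ofCore (RandomMeasure.core P)

/-- `‖μ‖² = E ∫ |μ̂(y)|² e^{-y²} dy`. -/
theorem RandomMeasure.norm_sq (μ : RandomMeasure P) :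
    ‖μ‖ ^ 2 = ∫ ω, ∫ y, ‖μ.hat ω y‖ ^ 2 ∂weight ∂P := by
  rw [← real_inner_self_eq_norm_sq μ]
  change μ.innerProd μ = _
  unfold RandomMeasure.innerProd
  congr! 5
  rw [mul_comm, Complex.mul_conj, Complex.ofReal_re, Complex.normSq_eq_norm_sq]

variable (P) in
/-- The Hilbert space obtained by completing the pre-Hilbert space of random measures. -/
abbrev MSpace : Type _ := UniformSpace.Completion (RandomMeasure P)

instance : IsFiniteMeasure weight := by
  refine isFiniteMeasure_withDensity_ofReal ?_
  have := (integrable_exp_neg_mul_sq (b := 1) one_pos).2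
  simpa using this

variable (P) in
/-- A finite deterministic measure, as a (constant) random measure. -/
def constMeasure (ν : Measure ℝ) [IsFiniteMeasure ν] : RandomMeasure P :=
  ⟨fun _ => ν.toSignedMeasure, fun _ _ => measurable_const, by
    have hc : Continuous (fun y : ℝ => fourier ν.toSignedMeasure y) := by
      simp only [fourier_toSignedMeasure]
      refine continuous_of_dominated (bound := fun _ => 1) (fun y => by fun_prop)
        (fun y => .of_forall fun x => by simp [Complex.norm_exp]) (integrable_const _)
        (.of_forall fun x => by fun_prop)
    refine MemLp.of_bound (C := ν.real Set.univ)
      (hc.measurable.comp measurable_snd).aestronglyMeasurable (.of_forall fun p => ?_)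
    rw [fourier_toSignedMeasure]
    refine (norm_integral_le_integral_norm _).trans (le_of_eq ?_)
    simp [Complex.norm_exp]⟩

variable (P) in
/-- A finite deterministic measure, as an element of the completed space. -/
def toMSpace (ν : Measure ℝ) [IsFiniteMeasure ν] : MSpace P :=
  ((constMeasure P ν : RandomMeasure P) : UniformSpace.Completion (RandomMeasure P))

end RandomMeasures

/-! ### The Brownian sheet and its filtration -/

section Sheet

variable {Ω : Type*} [MeasurableSpace Ω]

/-- A standard Brownian sheet `B (t, x)`, `t ≥ 0`, `x ∈ ℝ`: a continuous centred Gaussian process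
whose covariance is `min s t` times the covariance of a two-sided Brownian motion
(so `E[B(s,a) B(t,b)] = min s t * min a b` for `a, b ≥ 0`). Values at `t < 0` are irrelevant. -/
structure IsBrownianSheet (B : ℝ × ℝ → Ω → ℝ) (P : Measure Ω) : Prop where
  measurable : ∀ z : ℝ × ℝ, 0 ≤ z.1 → Measurable (B z)
  gaussian : IsGaussianProcess (fun z : {z : ℝ × ℝ // 0 ≤ z.1} => B z) P
  centred : ∀ z : ℝ × ℝ, 0 ≤ z.1 → ∫ ω, B z ω ∂P = 0
  covariance : ∀ z w : ℝ × ℝ, 0 ≤ z.1 → 0 ≤ w.1 →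
    ∫ ω, B z ω * B w ω ∂P = min z.1 w.1 * ((|z.2| + |w.2| - |z.2 - w.2|) / 2)
  continuous : ∀ᵐ ω ∂P, ContinuousOn (fun z => B z ω) {z | 0 ≤ z.1}

/-- The `σ`-algebra generated by `B (s, a)`, `0 ≤ s ≤ t`, `a ≤ x`, completed by the `P`-null
sets, at `z = (t, x)`. -/
@[reducible] def sheetFiltration (B : ℝ × ℝ → Ω → ℝ) (P : Measure Ω) (z : ℝ × ℝ) : MeasurableSpace Ω :=
  (⨆ w : {w : ℝ × ℝ // 0 ≤ w.1 ∧ w ≤ z}, MeasurableSpace.comap (B w) inferInstance) ⊔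
    MeasurableSpace.generateFrom {N | P N = 0}

/-- The closed rectangle `R_z = [0, t] × [0, x]` for `z = (t, x)`. -/
def rect (z : ℝ × ℝ) : Set (ℝ × ℝ) := Set.Icc 0 z

/-- The half-open rectangle `(a, b] = (a₁, b₁] × (a₂, b₂]`. -/
def hrect (a b : ℝ × ℝ) : Set (ℝ × ℝ) := Set.Ioc a.1 b.1 ×ˢ Set.Ioc a.2 b.2

/-- The rectangular increment `B((a, b])`. -/
def increment (B : ℝ × ℝ → Ω → ℝ) (a b : ℝ × ℝ) (ω : Ω) : ℝ :=
  B b ω - B (a.1, b.2) ω - B (b.1, a.2) ω + B a ω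

/-! ### The two-parameter Itô integral -/

/-- Simple predictable integrands `∑ ξᵢ 1_{(aᵢ, bᵢ]}`, with `ξᵢ` bounded and
`𝓕_{aᵢ}`-measurable. -/
structure SimpleIntegrand (B : ℝ × ℝ → Ω → ℝ) (P : Measure Ω) where
  n : ℕ
  lo : Fin n → ℝ × ℝ
  hi : Fin n → ℝ × ℝ
  coef : Fin n → Ω → ℝ
  lo_nonneg : ∀ i, 0 ≤ lo i
  lo_le_hi : ∀ i, lo i ≤ hi i
  measurable_coef : ∀ i, Measurable[sheetFiltration B P (lo i)] (coef i)
  bounded_coef : ∀ i, ∃ C : ℝ, ∀ ω, |coef i ω| ≤ C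

variable {B : ℝ × ℝ → Ω → ℝ} {P : Measure Ω}

/-- The value `∑ ξᵢ(ω) 1_{(aᵢ, bᵢ]}(ζ)`. -/
def SimpleIntegrand.eval (S : SimpleIntegrand B P) (ζ : ℝ × ℝ) (ω : Ω) : ℝ :=
  ∑ i, (hrect (S.lo i) (S.hi i)).indicator (fun _ => S.coef i ω) ζ

/-- The elementary integral over `R_z`: `∑ ξᵢ B((aᵢ, bᵢ] ∩ R_z)`, where
`(a, b] ∩ R_z = (a ⊓ z, b ⊓ z]` for `0 ≤ a ≤ b` and `0 ≤ z`. -/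
def SimpleIntegrand.integral (S : SimpleIntegrand B P) (z : ℝ × ℝ) (ω : Ω) : ℝ :=
  ∑ i, S.coef i ω * increment B (S.lo i ⊓ z) (S.hi i ⊓ z) ω

variable (B P) in
/-- `I = ∫_{R_z} φ(ζ) B(dζ)`: the extension by `L²`-isometry of the elementary integral. That is,
`φ` is square integrable on `R_z × Ω` and there are simple predictable integrands that converge to
`φ` in `L²(R_z × Ω)` and whose elementary integrals converge to `I` in `L²(Ω)`. -/
def IsItoIntegral (φ : ℝ × ℝ → Ω → ℝ) (z : ℝ × ℝ) (I : Ω → ℝ) : Prop :=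
  MemLp (fun p : (ℝ × ℝ) × Ω => φ p.1 p.2) 2 ((volume.restrict (rect z)).prod P) ∧
  MemLp I 2 P ∧
  ∃ S : ℕ → SimpleIntegrand B P,
    Tendsto (fun n => eLpNorm (fun p : (ℝ × ℝ) × Ω => (S n).eval p.1 p.2 - φ p.1 p.2) 2
      ((volume.restrict (rect z)).prod P)) atTop (𝓝 0) ∧
    Tendsto (fun n => eLpNorm (fun ω => (S n).integral z ω - I ω) 2 P) atTop (𝓝 0)

/-! ### Strong solutions -/

variable [IsProbabilityMeasure P]

variable (P) in
/-- The law of a real random variable, as an element of the space of measures. -/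
def law (X : Ω → ℝ) : MSpace P := toMSpace P (P.map X)

variable (B P) in
/-- `Y` is a strong solution on `R_{z₀}` of
`∂²Y/∂t∂x = α(z, Y(z), law Y(z)) + β(z, Y(z), law Y(z)) ⋄ Ḃ(z)`, with initial value `y`, i.e.
a measurable process, adapted to the completed filtration of the given sheet, with
`Y(z) = y + ∫_{R_z} α(ζ, Y(ζ), law Y(ζ)) dζ + ∫_{R_z} β(ζ, Y(ζ), law Y(ζ)) B(dζ)`
almost surely for every `z ∈ R_{z₀}`. -/
structure IsStrongSolution (α β : ℝ × ℝ → ℝ → MSpace P → ℝ) (y : ℝ) (z₀ : ℝ × ℝ)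
    (Y : ℝ × ℝ → Ω → ℝ) : Prop where
  measurable : Measurable (fun p : rect z₀ × Ω => Y p.1 p.2)
  adapted : ∀ z ∈ rect z₀, Measurable[sheetFiltration B P z] (Y z)
  integrable_drift : ∀ᵐ ω ∂P,
    IntegrableOn (fun ζ => α ζ (Y ζ ω) (law P (Y ζ))) (rect z₀)
  equation : ∀ z ∈ rect z₀, ∃ I : Ω → ℝ,
    IsItoIntegral B P (fun ζ ω => β ζ (Y ζ ω) (law P (Y ζ))) z I ∧
    ∀ᵐ ω ∂P, Y z ω = y + (∫ ζ in rect z, α ζ (Y ζ ω) (law P (Y ζ))) + I ω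

/-- Borel measurability and local boundedness of a coefficient on `[0,T]² × ℝ × 𝕄`. -/
structure IsAdmissible (T : ℝ) (f : ℝ × ℝ → ℝ → MSpace P → ℝ) : Prop where
  measurable : Measurable[borel (rect (T, T) × ℝ × MSpace P)]
    (fun p : rect (T, T) × ℝ × MSpace P => f p.1 p.2.1 p.2.2)
  locally_bounded : ∀ p : rect (T, T) × ℝ × MSpace P, ∃ U ∈ 𝓝 p, ∃ K : ℝ,
    ∀ q ∈ U, |f q.1 q.2.1 q.2.2| ≤ K

end Sheet

end MVSheet

end

/-!
The solution is the fixed point of the Picard map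
`X ↦ y + ∫_{R_z} α(ζ, X(ζ), law X(ζ)) dζ + ∫_{R_z} β(ζ, X(ζ), law X(ζ)) B(dζ)`, which is a
contraction on the adapted curves in `C(R_{(T,T)}, L²(Ω))` for an exponentially weighted norm.

*The Itô integral.* An increment `B((a, b])` of the sheet is independent of the noise that lies
before `a` in time or in space (`indep_increment`). If two rectangles are disjoint and one of them
precedes the other in one of the coordinates, the corresponding elementary integrals are therefore
orthogonal. Two rectangles in general position are handled by additivity: a function of two
intervals that is additive in both, vanishes on successive intervals and is proportional to the
length on the diagonal is proportional to the length of the intersection (`eq_mul_overlap`). This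
gives the elementary isometry (`SimpleIntegrand.eLpNorm_total`), and by density the integral over
all `R_w`, adapted and continuous in `L²(Ω)` (`IsItoIntegrable.exists_integral`). Square integrable
predictable processes are limits of simple ones (`isItoIntegrable_of_predictable`).

*The coefficients.* An adapted curve that is continuous in `L²(Ω)` has a jointly measurable adapted
version that is predictable off the axes (`exists_version`). Its laws form a continuous curve in
`𝕄`, because `|e^{-iay} - e^{-iby}| ≤ |y| |a - b|` and `y²` is integrable against the weight
(`enorm_law_sub_le`). Hence the coefficients along such a process are Itô integrable
(`isItoIntegrable_comp`). The time integral of such an integrand is again adapted, as it is a limit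
of time integrals of simple processes, so that the Picard map preserves adapted curves
(`exists_output`).

*The contraction.* By Cauchy–Schwarz for the drift and the isometry for the stochastic integral, the
squared distance of two outputs at `z` is at most a constant times the integral over `R_z` of the
squared distances of the inputs (`sq_eLpNorm_output_sub_le`). Integration over `R_z` contracts the
weight `e^{l (t + x)}` by `l⁻²`, which gives both the contraction (`exists_isStrongSolution`) and a
Grönwall inequality for bounded functions (`exists_gronwall`).

*Uniqueness.* A strong solution is not assumed to have finite second moments. The stochastic
integrals are square integrable by definition, and the difference of the drifts of two solutions is
continuous in `z` along almost every path, hence bounded on events that exhaust `Ω`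
(`exists_exhaustion`). As any two probability laws have bounded distance in `𝕄`, Grönwall's
inequality on these events bounds the second moment of the difference uniformly, so that the
difference of two solutions is bounded in `L²(Ω)` (`IsStrongSolution.exists_lintegral_sub_le`). Now
the Picard estimate applies, and a second use of Grönwall's inequality shows that the difference
vanishes (`IsStrongSolution.ae_eq`).
-/

open scoped ENNReal

namespace MVSheet

/-! ### The noise and its increments -/

section Noise

variable {Ω : Type*} [MeasurableSpace Ω] {B : ℝ × ℝ → Ω → ℝ} {P : Measure Ω}

/-- The `σ`-algebra generated by the values of the sheet on a set `S` of points with nonnegative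
time, completed by the null sets. -/
@[reducible] def noiseAlg (B : ℝ × ℝ → Ω → ℝ) (P : Measure Ω) (S : Set (ℝ × ℝ)) :
    MeasurableSpace Ω :=
  (⨆ w : S, MeasurableSpace.comap (B w) inferInstance) ⊔
    MeasurableSpace.generateFrom {N | P N = 0}

/-- The points that lie before `a` in time or before `a` in space: the past of the quadrant
`(a, ∞)`. -/
def pastSet (a : ℝ × ℝ) : Set (ℝ × ℝ) := {w | 0 ≤ w.1 ∧ (w.1 ≤ a.1 ∨ w.2 ≤ a.2)}

theorem measurable_noiseAlg {S : Set (ℝ × ℝ)} {w : ℝ × ℝ} (hw : w ∈ S) :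
    Measurable[noiseAlg B P S] (B w) := by
  rw [measurable_iff_comap_le]
  exact (le_iSup (fun w : S => MeasurableSpace.comap (B w) inferInstance) ⟨w, hw⟩).trans
    le_sup_left

theorem noiseAlg_mono {S S' : Set (ℝ × ℝ)} (h : S ⊆ S') : noiseAlg B P S ≤ noiseAlg B P S' := by
  refine sup_le (iSup_le fun w => ?_) le_sup_right
  rw [← measurable_iff_comap_le]
  exact measurable_noiseAlg (h w.2)

theorem sheetFiltration_mono {z w : ℝ × ℝ} (h : z ≤ w) :
    sheetFiltration B P z ≤ sheetFiltration B P w :=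
  noiseAlg_mono (B := B) (P := P) (S := {v | 0 ≤ v.1 ∧ v ≤ z}) (S' := {v | 0 ≤ v.1 ∧ v ≤ w})
    fun _ hv => ⟨hv.1, hv.2.trans h⟩

theorem generateFrom_null_le [P.IsComplete] :
    MeasurableSpace.generateFrom {N | P N = 0} ≤ ‹MeasurableSpace Ω› :=
  MeasurableSpace.generateFrom_le fun _ hN => measurableSet_of_null hN

theorem noiseAlg_le [P.IsComplete] (hB : IsBrownianSheet B P) {S : Set (ℝ × ℝ)}
    (hS : ∀ w ∈ S, 0 ≤ w.1) : noiseAlg B P S ≤ ‹MeasurableSpace Ω› :=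
  sup_le (iSup_le fun w => (hB.measurable w (hS w w.2)).comap_le) generateFrom_null_le

theorem sheetFiltration_le [P.IsComplete] (hB : IsBrownianSheet B P) (z : ℝ × ℝ) :
    sheetFiltration B P z ≤ ‹MeasurableSpace Ω› :=
  noiseAlg_le hB (S := {w | 0 ≤ w.1 ∧ w ≤ z}) fun _ hw => hw.1

theorem IsBrownianSheet.memLp (hB : IsBrownianSheet B P) {z : ℝ × ℝ} (hz : 0 ≤ z.1) :
    MemLp (B z) 2 P :=
  (hB.gaussian.hasGaussianLaw_eval ⟨z, hz⟩).memLp (by simp)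

theorem memLp_increment (hB : IsBrownianSheet B P) {a b : ℝ × ℝ} (ha : 0 ≤ a.1)
    (hb : 0 ≤ b.1) : MemLp (increment B a b) 2 P :=
  (((hB.memLp hb).sub (hB.memLp (z := (a.1, b.2)) ha)).sub
    (hB.memLp (z := (b.1, a.2)) hb)).add (hB.memLp ha)

theorem measurable_increment (hB : IsBrownianSheet B P) {a b : ℝ × ℝ} (ha : 0 ≤ a.1)
    (hb : 0 ≤ b.1) : Measurable (increment B a b) :=
  (((hB.measurable _ hb).sub (hB.measurable (a.1, b.2) ha)).sub
    (hB.measurable (b.1, a.2) hb)).add (hB.measurable _ ha)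

theorem integral_sub_sub_add {f₁ f₂ f₃ f₄ : Ω → ℝ} (h₁ : MeasureTheory.Integrable f₁ P)
    (h₂ : MeasureTheory.Integrable f₂ P) (h₃ : MeasureTheory.Integrable f₃ P)
    (h₄ : MeasureTheory.Integrable f₄ P) :
    ∫ ω, f₁ ω - f₂ ω - f₃ ω + f₄ ω ∂P
      = ∫ ω, f₁ ω ∂P - ∫ ω, f₂ ω ∂P - ∫ ω, f₃ ω ∂P + ∫ ω, f₄ ω ∂P := by
  have e : ∫ ω, (f₁ - f₂ - f₃ + f₄) ω ∂P = _ := integral_add' ((h₁.sub h₂).sub h₃) h₄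
  rw [integral_sub' (h₁.sub h₂) h₃, integral_sub' h₁ h₂] at e
  exact e

theorem integral_increment [IsProbabilityMeasure P] (hB : IsBrownianSheet B P) {a b : ℝ × ℝ}
    (ha : 0 ≤ a.1) (hb : 0 ≤ b.1) : ∫ ω, increment B a b ω ∂P = 0 := by
  have i {z : ℝ × ℝ} (hz : 0 ≤ z.1) : MeasureTheory.Integrable (B z) P :=
    (hB.memLp hz).integrable (by norm_num)
  have i1 := i hb
  have i2 := i (z := (a.1, b.2)) ha
  have i3 := i (z := (b.1, a.2)) hb
  have i4 := i ha
  unfold increment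
  rw [integral_sub_sub_add i1 i2 i3 i4,
    hB.centred _ hb, hB.centred _ ha, hB.centred (a.1, b.2) ha, hB.centred (b.1, a.2) hb]
  simp

/-- The covariance of a two-sided Brownian motion. -/
noncomputable def bmCov (x x' : ℝ) : ℝ := (|x| + |x'| - |x - x'|) / 2

theorem integral_increment_mul [IsProbabilityMeasure P] (hB : IsBrownianSheet B P)
    {a b w : ℝ × ℝ} (ha : 0 ≤ a.1) (hb : 0 ≤ b.1) (hw : 0 ≤ w.1) :
    ∫ ω, increment B a b ω * B w ω ∂P
      = (min b.1 w.1 - min a.1 w.1) * (bmCov b.2 w.2 - bmCov a.2 w.2) := by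
  have i {z : ℝ × ℝ} (hz : 0 ≤ z.1) : MeasureTheory.Integrable (fun ω => B z ω * B w ω) P :=
    (hB.memLp hz).integrable_mul (hB.memLp hw)
  have i1 := i hb
  have i2 := i (z := (a.1, b.2)) ha
  have i3 := i (z := (b.1, a.2)) hb
  have i4 := i ha
  simp only [increment, add_mul, sub_mul]
  rw [integral_sub_sub_add i1 i2 i3 i4,
    hB.covariance _ _ hb hw, hB.covariance _ _ ha hw, hB.covariance (a.1, b.2) _ ha hw,
    hB.covariance (b.1, a.2) _ hb hw]
  unfold bmCov
  ring

theorem bmCov_of_le {x x' : ℝ} (hx : 0 ≤ x) (h : x' ≤ x) : bmCov x x' = (|x'| + x') / 2 := by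
  unfold bmCov
  rw [abs_of_nonneg hx, abs_of_nonneg (sub_nonneg.2 h)]
  ring

theorem bmCov_of_nonneg {x x' : ℝ} (hx : 0 ≤ x) (hx' : 0 ≤ x') : bmCov x x' = min x x' := by
  rcases le_total x x' with h | h
  · rw [bmCov, abs_of_nonneg hx, abs_of_nonneg hx', abs_of_nonpos (sub_nonpos.2 h), min_eq_left h]
    ring
  · rw [bmCov_of_le hx h, abs_of_nonneg hx', min_eq_right h]
    ring

/-- `E[B((a, b])²]` is the area of the rectangle. -/
theorem integral_increment_sq [IsProbabilityMeasure P] (hB : IsBrownianSheet B P)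
    {a b : ℝ × ℝ} (ha : 0 ≤ a) (hab : a ≤ b) :
    ∫ ω, increment B a b ω ^ 2 ∂P = (b.1 - a.1) * (b.2 - a.2) := by
  have hb : 0 ≤ b := ha.trans hab
  have i {z : ℝ × ℝ} (hz : 0 ≤ z.1) :
      MeasureTheory.Integrable (fun ω => increment B a b ω * B z ω) P :=
    (memLp_increment hB ha.1 hb.1).integrable_mul (hB.memLp hz)
  have i1 := i hb.1
  have i2 := i (z := (a.1, b.2)) ha.1
  have i3 := i (z := (b.1, a.2)) hb.1
  have i4 := i ha.1
  have e : (fun ω => increment B a b ω ^ 2) = fun ω => increment B a b ω * B b ω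
      - increment B a b ω * B (a.1, b.2) ω - increment B a b ω * B (b.1, a.2) ω
      + increment B a b ω * B a ω := by
    funext ω
    rw [← mul_sub, ← mul_sub, ← mul_add, sq]
    rfl
  rw [e, integral_sub_sub_add i1 i2 i3 i4,
    integral_increment_mul hB ha.1 hb.1 hb.1, integral_increment_mul hB ha.1 hb.1 ha.1,
    integral_increment_mul hB ha.1 hb.1 (w := (a.1, b.2)) ha.1,
    integral_increment_mul hB ha.1 hb.1 (w := (b.1, a.2)) hb.1]
  simp only [bmCov_of_nonneg ha.2 hb.2, bmCov_of_nonneg hb.2 ha.2, bmCov_of_nonneg ha.2 ha.2,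
    bmCov_of_nonneg hb.2 hb.2, min_self, min_eq_left hab.1, min_eq_right hab.1,
    min_eq_left hab.2, min_eq_right hab.2]
  ring

/-- A `σ`-algebra independent of `m` remains so when `m` is completed by null sets. -/
theorem indep_sup_null [IsProbabilityMeasure P] {m₁ m₂ : MeasurableSpace Ω}
    (h : Indep m₁ m₂ P) :
    Indep m₁ (m₂ ⊔ MeasurableSpace.generateFrom {N | P N = 0}) P := by
  rw [Indep_iff] at h ⊢
  intro s t hs ht
  have hle : m₂ ⊔ MeasurableSpace.generateFrom {N | P N = 0}
      ≤ eventuallyMeasurableSpace m₂ (ae P) := by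
    refine sup_le le_eventuallyMeasurableSpace (MeasurableSpace.generateFrom_le fun N hN => ?_)
    exact ⟨∅, MeasurableSet.empty, ae_eq_empty.2 hN⟩
  obtain ⟨t', ht', htt'⟩ := hle t ht
  rw [measure_congr ((ae_eq_refl s).inter htt'), measure_congr htt']
  exact h s t' hs ht'

/-- The increment over `(a, b]` is independent of the noise that is not in the quadrant
`(a, ∞)`. -/
theorem indep_increment [IsProbabilityMeasure P] (hB : IsBrownianSheet B P)
    {a b : ℝ × ℝ} (ha : 0 ≤ a) (hab : a ≤ b) :
    Indep (MeasurableSpace.comap (increment B a b) inferInstance)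
      (noiseAlg B P (pastSet a)) P := by
  have hb : 0 ≤ b := ha.trans hab
  apply indep_sup_null
  have hG : IsGaussianProcess (Sum.elim (fun _ : Unit => increment B a b)
      (fun w : pastSet a => B w)) P := by
    refine hB.gaussian.of_isGaussianProcess fun s => ?_
    rcases s with _ | w
    · let p : Fin 4 → {z : ℝ × ℝ // 0 ≤ z.1} :=
        ![⟨b, hb.1⟩, ⟨(a.1, b.2), ha.1⟩, ⟨(b.1, a.2), hb.1⟩, ⟨a, ha.1⟩]
      classical
      let I : Finset {z : ℝ × ℝ // 0 ≤ z.1} := Finset.univ.image p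
      have hp (i : Fin 4) : p i ∈ I := Finset.mem_image_of_mem _ (Finset.mem_univ _)
      refine ⟨I, ContinuousLinearMap.proj ⟨p 0, hp 0⟩ - ContinuousLinearMap.proj ⟨p 1, hp 1⟩
        - ContinuousLinearMap.proj ⟨p 2, hp 2⟩ + ContinuousLinearMap.proj ⟨p 3, hp 3⟩,
        fun ω => ?_⟩
      simp [increment, p]
    · refine ⟨{⟨w, w.2.1⟩}, ContinuousLinearMap.proj ⟨⟨w, w.2.1⟩, by simp⟩, fun ω => ?_⟩
      simp
  have hI := hG.indepFun_of_covariance_eq_zero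
    (fun _ => (measurable_increment hB ha.1 hb.1).aemeasurable)
    (fun w => (hB.measurable w w.2.1).aemeasurable) (fun _ w => by
      rw [covariance_eq_sub (memLp_increment hB ha.1 hb.1) (hB.memLp w.2.1),
        integral_increment hB ha.1 hb.1, zero_mul, sub_zero]
      refine (integral_increment_mul hB ha.1 hb.1 w.2.1).trans ?_
      rcases w.2.2 with h | h
      · rw [min_eq_right h, min_eq_right (h.trans hab.1)]
        ring
      · rw [bmCov_of_le ha.2 h, bmCov_of_le hb.2 (h.trans hab.2)]
        ring)
  have hI' : IndepFun (increment B a b) (fun ω (w : pastSet a) => B w ω) P :=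
    hI.comp (φ := fun f : Unit → ℝ => f ()) (measurable_pi_apply ()) measurable_id
  rw [IndepFun_iff_Indep] at hI'
  convert hI' using 1
  rw [MeasurableSpace.pi, MeasurableSpace.comap_iSup]
  simp only [MeasurableSpace.comap_comp]
  rfl

end Noise

/-! ### Orthogonality of increments -/

section Isometry

/-- The length of `(a, b] ∩ (c, d]`. -/
noncomputable def overlap (a b c d : ℝ) : ℝ := max 0 (min b d - max a c)

/-- A function of two intervals that is additive in each of them, vanishes on intervals that
follow one another and equals `κ` times the length on the diagonal is `κ` times the length of
the intersection. -/
theorem eq_mul_overlap {f : ℝ → ℝ → ℝ → ℝ → ℝ} {κ a₀ c₀ : ℝ}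
    (hadd₁ : ∀ a r b c d, a₀ ≤ a → a ≤ r → r ≤ b → c₀ ≤ c → c ≤ d →
      f a b c d = f a r c d + f r b c d)
    (hadd₂ : ∀ a b c r d, a₀ ≤ a → a ≤ b → c₀ ≤ c → c ≤ r → r ≤ d →
      f a b c d = f a b c r + f a b r d)
    (orth : ∀ a b c d, a₀ ≤ a → a ≤ b → c₀ ≤ c → c ≤ d → (b ≤ c ∨ d ≤ a) → f a b c d = 0)
    (diag : ∀ a b, a₀ ≤ a → c₀ ≤ a → a ≤ b → f a b a b = κ * (b - a))
    {a b c d : ℝ} (ha : a₀ ≤ a) (hab : a ≤ b) (hc : c₀ ≤ c) (hcd : c ≤ d) :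
    f a b c d = κ * overlap a b c d := by
  have deg₁ {a c d : ℝ} (ha : a₀ ≤ a) (hc : c₀ ≤ c) (hcd : c ≤ d) : f a a c d = 0 := by
    linarith [hadd₁ a a a c d ha le_rfl le_rfl hc hcd]
  have deg₂ {a b c : ℝ} (ha : a₀ ≤ a) (hab : a ≤ b) (hc : c₀ ≤ c) : f a b c c = 0 := by
    linarith [hadd₂ a b c c c ha hab hc le_rfl le_rfl]
  have cut₁ {a b c d : ℝ} (ha : a₀ ≤ a) (hab : a ≤ b) (hc : c₀ ≤ c) (hcd : c ≤ d) (h : c ≤ b) :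
      f a b c d = f (max a c) b c d := by
    rcases le_total a c with hac | hac
    · rw [max_eq_right hac, hadd₁ a c b c d ha hac h hc hcd,
        orth a c c d ha hac hc hcd (.inl le_rfl), zero_add]
    · rw [max_eq_left hac]
  have cut₂ {a b c d : ℝ} (ha : a₀ ≤ a) (hab : a ≤ b) (hc : c₀ ≤ c) (hcd : c ≤ d) (h : a ≤ d) :
      f a b c d = f a (min b d) c d := by
    rcases le_total b d with hbd | hbd
    · rw [min_eq_left hbd]
    · rw [min_eq_right hbd, hadd₁ a d b c d ha h hbd hc hcd,
        orth d b c d (ha.trans h) hbd hc hcd (.inr le_rfl), add_zero]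
  have cut₃ {a b c d : ℝ} (ha : a₀ ≤ a) (hab : a ≤ b) (hc : c₀ ≤ c) (hca : c ≤ a) (h : a ≤ d) :
      f a b c d = f a b a d := by
    rw [hadd₂ a b c a d ha hab hc hca h, orth a b c a ha hab hc hca (.inr le_rfl), zero_add]
  have cut₄ {a b c d : ℝ} (ha : a₀ ≤ a) (hab : a ≤ b) (hc : c₀ ≤ c) (hbd : b ≤ d) (h : c ≤ b) :
      f a b c d = f a b c b := by
    rw [hadd₂ a b c b d ha hab hc h hbd, orth a b b d ha hab (hc.trans h) hbd (.inl le_rfl),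
      add_zero]
  rcases le_or_gt b c with h | h
  · rw [orth a b c d ha hab hc hcd (.inl h), overlap, max_eq_left, mul_zero]
    exact sub_nonpos.2 ((min_le_left _ _).trans (h.trans (le_max_right _ _)))
  rcases le_or_gt d a with h' | h'
  · rw [orth a b c d ha hab hc hcd (.inr h'), overlap, max_eq_left, mul_zero]
    exact sub_nonpos.2 ((min_le_right _ _).trans (h'.trans (le_max_left _ _)))
  have hm : max a c ≤ min b d :=
    max_le (le_min hab h'.le) (le_min h.le hcd)
  have hm₀ : a₀ ≤ max a c := ha.trans (le_max_left _ _)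
  have hmc : c₀ ≤ max a c := hc.trans (le_max_right _ _)
  rw [cut₁ ha hab hc hcd h.le, cut₂ hm₀ (hm.trans (min_le_left _ _)) hc hcd
    (hm.trans (min_le_right _ _)), cut₃ hm₀ hm hc (le_max_right _ _) (hm.trans (min_le_right _ _)),
    cut₄ hm₀ hm hmc (min_le_right _ _) hm, diag _ _ hm₀ hmc hm, overlap,
    max_eq_right (sub_nonneg.2 hm)]

variable {Ω : Type*} [MeasurableSpace Ω] {B : ℝ × ℝ → Ω → ℝ} {P : Measure Ω}
  [IsProbabilityMeasure P]

omit [IsProbabilityMeasure P] in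
theorem sheetFiltration_le_noiseAlg {z : ℝ × ℝ} {S : Set (ℝ × ℝ)}
    (h : ∀ w : ℝ × ℝ, 0 ≤ w.1 → w ≤ z → w ∈ S) : sheetFiltration B P z ≤ noiseAlg B P S :=
  noiseAlg_mono (B := B) (P := P) (S := {v | 0 ≤ v.1 ∧ v ≤ z}) fun w hw => h w hw.1 hw.2

variable [P.IsComplete]

/-- Products with an increment over a rectangle that follows, in time or in space, everything
else integrate to zero. -/
theorem integral_increment_orth (hB : IsBrownianSheet B P) {a₀ c₀ a b c d : ℝ × ℝ}
    (ha₀ : 0 ≤ a₀) (ha : a₀ ≤ a) (hab : a ≤ b) (hc₀ : 0 ≤ c₀) (hc : c₀ ≤ c) (hcd : c ≤ d)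
    {ξ η : Ω → ℝ} (hξ : Measurable[sheetFiltration B P a₀] ξ)
    (hη : Measurable[sheetFiltration B P c₀] η) (h : b.1 ≤ c.1 ∨ b.2 ≤ c.2) :
    ∫ ω, ξ ω * η ω * (increment B a b ω * increment B c d ω) ∂P = 0 := by
  have hb : a₀ ≤ b := ha.trans hab
  have hc0 := hc₀.trans hc
  have hS : ∀ w ∈ pastSet c, 0 ≤ w.1 := fun w hw => hw.1
  have hξ' : Measurable[noiseAlg B P (pastSet c)] ξ := hξ.mono (sheetFiltration_le_noiseAlg
    fun w hw hwa => ⟨hw, h.imp (fun h => (hwa.trans hb).1.trans h)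
      (fun h => (hwa.trans hb).2.trans h)⟩) le_rfl
  have hη' : Measurable[noiseAlg B P (pastSet c)] η := hη.mono (sheetFiltration_le_noiseAlg
    fun w hw hwc => ⟨hw, .inl (hwc.trans hc).1⟩) le_rfl
  have m (w : ℝ × ℝ) (hw : 0 ≤ w.1) (hwb : w ≤ b) : Measurable[noiseAlg B P (pastSet c)] (B w) :=
    measurable_noiseAlg ⟨hw, h.imp (fun h => hwb.1.trans h) (fun h => hwb.2.trans h)⟩
  have ha1 : 0 ≤ a.1 := ha₀.1.trans ha.1
  have hb1 : 0 ≤ b.1 := ha₀.1.trans hb.1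
  have hΔ : Measurable[noiseAlg B P (pastSet c)] (increment B a b) :=
    Measurable.add (Measurable.sub (Measurable.sub (m _ hb1 le_rfl)
      (m (a.1, b.2) ha1 ⟨hab.1, le_rfl⟩))
      (m (b.1, a.2) hb1 ⟨le_rfl, hab.2⟩)) (m _ ha1 hab)
  have hprod : Measurable[noiseAlg B P (pastSet c)] (fun ω => ξ ω * η ω * increment B a b ω) :=
    Measurable.mul (Measurable.mul hξ' hη') hΔ
  have hind : IndepFun (fun ω => ξ ω * η ω * increment B a b ω) (increment B c d) P := by
    rw [IndepFun_iff_Indep]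
    exact (indep_of_indep_of_le_right (indep_increment hB hc0 hcd)
      hprod.comap_le).symm
  have e := hind.integral_fun_mul_eq_mul_integral
    (hprod.mono (noiseAlg_le hB hS) le_rfl).aestronglyMeasurable
    (measurable_increment hB hc0.1 (hc0.trans hcd).1).aestronglyMeasurable
  rw [integral_increment hB hc0.1 (hc0.trans hcd).1, mul_zero] at e
  rw [← e]
  congr 1
  funext ω
  ring

/-- The increment over a rectangle is independent of coefficients from the past of its lower
corner. -/
theorem integral_increment_diag (hB : IsBrownianSheet B P) {a₀ c₀ a b : ℝ × ℝ}
    (ha₀ : 0 ≤ a₀) (ha : a₀ ≤ a) (hab : a ≤ b) (hc : c₀ ≤ a)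
    {ξ η : Ω → ℝ} (hξ : Measurable[sheetFiltration B P a₀] ξ)
    (hη : Measurable[sheetFiltration B P c₀] η) :
    ∫ ω, ξ ω * η ω * (increment B a b ω * increment B a b ω) ∂P
      = (∫ ω, ξ ω * η ω ∂P) * ((b.1 - a.1) * (b.2 - a.2)) := by
  have ha0 := ha₀.trans ha
  have hS : ∀ w ∈ pastSet a, 0 ≤ w.1 := fun w hw => hw.1
  have hξ' : Measurable[noiseAlg B P (pastSet a)] ξ := hξ.mono (sheetFiltration_le_noiseAlg
    fun w hw hwc => ⟨hw, .inl (hwc.trans ha).1⟩) le_rfl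
  have hη' : Measurable[noiseAlg B P (pastSet a)] η := hη.mono (sheetFiltration_le_noiseAlg
    fun w hw hwc => ⟨hw, .inl (hwc.trans hc).1⟩) le_rfl
  have hprod : Measurable[noiseAlg B P (pastSet a)] (fun ω => ξ ω * η ω) :=
    Measurable.mul hξ' hη'
  have hind : IndepFun (fun ω => ξ ω * η ω) (increment B a b) P := by
    rw [IndepFun_iff_Indep]
    exact (indep_of_indep_of_le_right (indep_increment hB ha0 hab) hprod.comap_le).symm
  have hind2 : IndepFun (fun ω => ξ ω * η ω) (fun ω => increment B a b ω ^ 2) P :=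
    hind.comp (φ := id) (ψ := fun x : ℝ => x ^ 2) measurable_id (by fun_prop)
  rw [← integral_increment_sq hB ha0 hab, ← hind2.integral_fun_mul_eq_mul_integral
    (hprod.mono (noiseAlg_le hB hS) le_rfl).aestronglyMeasurable
    ((measurable_increment hB ha0.1 (ha0.trans hab).1).pow_const 2).aestronglyMeasurable]
  simp only [sq]

omit [IsProbabilityMeasure P] [P.IsComplete] in
theorem integrable_mul_increment (hB : IsBrownianSheet B P) {a b c d : ℝ × ℝ}
    (ha : 0 ≤ a.1) (hb : 0 ≤ b.1) (hc : 0 ≤ c.1) (hd : 0 ≤ d.1) {ξ : Ω → ℝ}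
    (hξ : Measurable ξ) {K : ℝ} (hK : ∀ ω, |ξ ω| ≤ K) :
    MeasureTheory.Integrable (fun ω => ξ ω * (increment B a b ω * increment B c d ω)) P :=
  ((memLp_increment hB ha hb).integrable_mul (memLp_increment hB hc hd)).bdd_mul
    hξ.aestronglyMeasurable (.of_forall hK)

/-- The covariance of elementary integrals: `E[ξ B(R) η B(R')] = E[ξ η] |R ∩ R'|`. -/
theorem integral_mul_increment_mul_increment (hB : IsBrownianSheet B P) {a b c d : ℝ × ℝ}
    (ha : 0 ≤ a) (hab : a ≤ b) (hc : 0 ≤ c) (hcd : c ≤ d) {ξ η : Ω → ℝ}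
    (hξ : Measurable[sheetFiltration B P a] ξ) (hη : Measurable[sheetFiltration B P c] η)
    {K L : ℝ} (hK : ∀ ω, |ξ ω| ≤ K) (hL : ∀ ω, |η ω| ≤ L) :
    ∫ ω, ξ ω * η ω * (increment B a b ω * increment B c d ω) ∂P
      = (∫ ω, ξ ω * η ω ∂P) * (overlap a.1 b.1 c.1 d.1 * overlap a.2 b.2 c.2 d.2) := by
  have hm : Measurable (fun ω => ξ ω * η ω) :=
    (hξ.mono (sheetFiltration_le hB a) le_rfl).mul (hη.mono (sheetFiltration_le hB c) le_rfl)
  have hbd (ω : Ω) : |ξ ω * η ω| ≤ K * L := by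
    rw [abs_mul]
    exact mul_le_mul (hK ω) (hL ω) (abs_nonneg _) ((abs_nonneg _).trans (hK ω))
  have i {s s' t t' : ℝ} (p q u v : ℝ) (hs : 0 ≤ s) (hs' : 0 ≤ s') (ht : 0 ≤ t) (ht' : 0 ≤ t') :=
    integrable_mul_increment hB (a := (s, p)) (b := (s', q)) (c := (t, u)) (d := (t', v))
      hs hs' ht ht' hm hbd
  -- Splitting first in time, for arbitrary space intervals, and then in space.
  have key {x x' u u' : ℝ} (hx : a.2 ≤ x) (hxx' : x ≤ x') (hu : c.2 ≤ u) (huu' : u ≤ u') :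
      ∫ ω, ξ ω * η ω * (increment B (a.1, x) (b.1, x') ω * increment B (c.1, u) (d.1, u') ω) ∂P
        = ((∫ ω, ξ ω * η ω ∂P) * overlap a.1 b.1 c.1 d.1) * overlap x x' u u' := by
    refine eq_mul_overlap (a₀ := a.2) (c₀ := c.2) (f := fun x x' u u' => ∫ ω, ξ ω * η ω *
      (increment B (a.1, x) (b.1, x') ω * increment B (c.1, u) (d.1, u') ω) ∂P)
      ?_ ?_ ?_ ?_ hx hxx' hu huu'
    · intro p r q u v _ _ _ _ _
      rw [← integral_add (i p r u v ha.1 (ha.1.trans hab.1) hc.1 (hc.1.trans hcd.1))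
        (i r q u v ha.1 (ha.1.trans hab.1) hc.1 (hc.1.trans hcd.1))]
      congr 1
      funext ω
      simp only [increment]
      ring
    · intro p q u r v _ _ _ _ _
      rw [← integral_add (i p q u r ha.1 (ha.1.trans hab.1) hc.1 (hc.1.trans hcd.1))
        (i p q r v ha.1 (ha.1.trans hab.1) hc.1 (hc.1.trans hcd.1))]
      congr 1
      funext ω
      simp only [increment]
      ring
    · intro p q u v hp hpq hu huv h
      rcases h with h | h
      · exact integral_increment_orth hB ha (a := (a.1, p)) (b := (b.1, q)) (c := (c.1, u))
          (d := (d.1, v)) ⟨le_rfl, hp⟩ ⟨hab.1, hpq⟩ hc ⟨le_rfl, hu⟩ ⟨hcd.1, huv⟩ hξ hη (.inr h)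
      · rw [← integral_increment_orth hB hc (a := (c.1, u)) (b := (d.1, v)) (c := (a.1, p))
          (d := (b.1, q)) ⟨le_rfl, hu⟩ ⟨hcd.1, huv⟩ ha ⟨le_rfl, hp⟩ ⟨hab.1, hpq⟩ hη hξ (.inr h)]
        congr 1
        funext ω
        ring
    · intro p q hp hp' hpq
      refine (eq_mul_overlap (a₀ := a.1) (c₀ := c.1) (κ := (∫ ω, ξ ω * η ω ∂P) * (q - p))
        (f := fun s s' t t' => ∫ ω, ξ ω * η ω *
        (increment B (s, p) (s', q) ω * increment B (t, p) (t', q) ω) ∂P)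
        ?_ ?_ ?_ ?_ le_rfl hab.1 le_rfl hcd.1).trans (by ring)
      · intro s r s' t t' hs hsr hrs ht htt
        have hs0 := ha.1.trans hs
        have hr0 := hs0.trans hsr
        have ht0 := hc.1.trans ht
        rw [← integral_add (i p q p q hs0 hr0 ht0 (ht0.trans htt))
          (i p q p q hr0 (hr0.trans hrs) ht0 (ht0.trans htt))]
        congr 1
        funext ω
        simp only [increment]
        ring
      · intro s s' t r t' hs hss ht htr hrt
        have hs0 := ha.1.trans hs
        have ht0 := hc.1.trans ht
        have hr0 := ht0.trans htr
        rw [← integral_add (i p q p q hs0 (hs0.trans hss) ht0 hr0)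
          (i p q p q hs0 (hs0.trans hss) hr0 (hr0.trans hrt))]
        congr 1
        funext ω
        simp only [increment]
        ring
      · intro s s' t t' hs hss ht htt h
        rcases h with h | h
        · exact integral_increment_orth hB ha (a := (s, p)) (b := (s', q)) (c := (t, p))
            (d := (t', q)) ⟨hs, hp⟩ ⟨hss, hpq⟩ hc ⟨ht, hp'⟩ ⟨htt, hpq⟩ hξ hη (.inl h)
        · rw [← integral_increment_orth hB hc (a := (t, p)) (b := (t', q)) (c := (s, p))
            (d := (s', q)) ⟨ht, hp'⟩ ⟨htt, hpq⟩ ha ⟨hs, hp⟩ ⟨hss, hpq⟩ hη hξ (.inl h)]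
          congr 1
          funext ω
          ring
      · intro s s' hs ht hss
        refine (integral_increment_diag hB ha (a := (s, p)) (b := (s', q)) ⟨hs, hp⟩ ⟨hss, hpq⟩
          ⟨ht, hp'⟩ hξ hη).trans ?_
        ring
  have := key le_rfl hab.2 le_rfl hcd.2
  rw [mul_assoc] at this
  exact this

end Isometry

/-! ### Simple integrands and the elementary isometry -/

section LTwo

variable {α β : Type*} [MeasurableSpace α] [MeasurableSpace β] {μ : Measure α} {ν : Measure β}

theorem eLpNorm_two_sq {E : Type*} [NormedAddCommGroup E] (f : α → E) :
    eLpNorm f 2 μ ^ 2 = ∫⁻ x, ‖f x‖ₑ ^ 2 ∂μ := by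
  have := eLpNorm_nnreal_pow_eq_lintegral (μ := μ) (f := f) (p := 2) (by norm_num)
  simpa using this

theorem eLpNorm_two_eq_of_integral_sq_eq {f : α → ℝ} {g : β → ℝ} (hf : MemLp f 2 μ)
    (hg : MemLp g 2 ν) (h : ∫ x, f x ^ 2 ∂μ = ∫ x, g x ^ 2 ∂ν) :
    eLpNorm f 2 μ = eLpNorm g 2 ν := by
  rw [hf.eLpNorm_eq_integral_rpow_norm (by norm_num) (by norm_num),
    hg.eLpNorm_eq_integral_rpow_norm (by norm_num) (by norm_num)]
  simp [h]

end LTwo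

section Simple

theorem measurableSet_hrect (a b : ℝ × ℝ) : MeasurableSet (hrect a b) :=
  measurableSet_Ioc.prod measurableSet_Ioc

theorem measurableSet_rect (z : ℝ × ℝ) : MeasurableSet (rect z) := measurableSet_Icc

theorem hrect_inter_hrect (a b c d : ℝ × ℝ) :
    hrect a b ∩ hrect c d = hrect (a ⊔ c) (b ⊓ d) := by
  simp only [hrect, Set.prod_inter_prod, Set.Ioc_inter_Ioc]
  rfl

theorem volume_hrect_lt_top (a b : ℝ × ℝ) : volume (hrect a b) < ∞ := by
  rw [hrect, Measure.volume_eq_prod, Measure.prod_prod]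
  exact ENNReal.mul_lt_top (by simp) (by simp)

theorem volume_real_hrect_inter_hrect (a b c d : ℝ × ℝ) :
    volume.real (hrect a b ∩ hrect c d)
      = overlap a.1 b.1 c.1 d.1 * overlap a.2 b.2 c.2 d.2 := by
  rw [hrect_inter_hrect, hrect, Measure.volume_eq_prod, measureReal_prod_prod,
    Real.volume_real_Ioc, Real.volume_real_Ioc]
  simp only [overlap, max_comm]
  rfl

variable {Ω : Type*} [MeasurableSpace Ω] {B : ℝ × ℝ → Ω → ℝ} {P : Measure Ω}

namespace SimpleIntegrand

/-- The elementary integral `∑ ξᵢ B((aᵢ, bᵢ])` over the whole quadrant. -/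
noncomputable def total (S : SimpleIntegrand B P) (ω : Ω) : ℝ :=
  ∑ i, S.coef i ω * increment B (S.lo i) (S.hi i) ω

/-- The sum of two simple integrands. -/
def add (S S' : SimpleIntegrand B P) : SimpleIntegrand B P where
  n := S.n + S'.n
  lo := Fin.append S.lo S'.lo
  hi := Fin.append S.hi S'.hi
  coef := Fin.append S.coef S'.coef
  lo_nonneg i := by
    refine Fin.addCases (fun i => ?_) (fun i => ?_) i
    · simpa using S.lo_nonneg i
    · simpa using S'.lo_nonneg i
  lo_le_hi i := by
    refine Fin.addCases (fun i => ?_) (fun i => ?_) i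
    · simpa using S.lo_le_hi i
    · simpa using S'.lo_le_hi i
  measurable_coef i := by
    refine Fin.addCases (fun i => ?_) (fun i => ?_) i
    · rw [Fin.append_left, Fin.append_left]
      exact S.measurable_coef i
    · rw [Fin.append_right, Fin.append_right]
      exact S'.measurable_coef i
  bounded_coef i := by
    refine Fin.addCases (fun i => ?_) (fun i => ?_) i
    · simpa using S.bounded_coef i
    · simpa using S'.bounded_coef i

/-- The multiple of a simple integrand by a constant. -/
noncomputable def smul (c : ℝ) (S : SimpleIntegrand B P) : SimpleIntegrand B P where
  n := S.n
  lo := S.lo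
  hi := S.hi
  coef i ω := c * S.coef i ω
  lo_nonneg := S.lo_nonneg
  lo_le_hi := S.lo_le_hi
  measurable_coef i := Measurable.const_mul (S.measurable_coef i) c
  bounded_coef i := by
    obtain ⟨K, hK⟩ := S.bounded_coef i
    exact ⟨|c| * K, fun ω => by
      rw [abs_mul]
      exact mul_le_mul_of_nonneg_left (hK ω) (abs_nonneg c)⟩

/-- The simple integrand `ξ 1_{(a, b]}`. -/
def single {a b : ℝ × ℝ} (ha : 0 ≤ a) (hab : a ≤ b) {ξ : Ω → ℝ}
    (hξ : Measurable[sheetFiltration B P a] ξ) {K : ℝ} (hK : ∀ ω, |ξ ω| ≤ K) :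
    SimpleIntegrand B P where
  n := 1
  lo _ := a
  hi _ := b
  coef _ := ξ
  lo_nonneg _ := ha
  lo_le_hi _ := hab
  measurable_coef _ := hξ
  bounded_coef _ := ⟨K, hK⟩

open Classical in
/-- The restriction of a simple integrand to `R_z`. A rectangle whose lower corner is not below `z`
does not meet `R_z`; its coefficient is set to `0`, as it need not be measurable at the truncated
corner. -/
noncomputable def restrict (S : SimpleIntegrand B P) {z : ℝ × ℝ} (hz : 0 ≤ z) :
    SimpleIntegrand B P where
  n := S.n
  lo i := S.lo i ⊓ z
  hi i := S.hi i ⊓ z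
  coef i := if S.lo i ≤ z then S.coef i else 0
  lo_nonneg i := le_inf (S.lo_nonneg i) hz
  lo_le_hi i := inf_le_inf_right _ (S.lo_le_hi i)
  measurable_coef i := by
    split_ifs with h
    · rw [inf_eq_left.2 h]
      exact S.measurable_coef i
    · exact measurable_const
  bounded_coef i := by
    split_ifs with h
    · exact S.bounded_coef i
    · exact ⟨0, fun ω => by simp⟩

theorem eval_add (S S' : SimpleIntegrand B P) (ζ : ℝ × ℝ) (ω : Ω) :
    (S.add S').eval ζ ω = S.eval ζ ω + S'.eval ζ ω := by
  change ∑ i : Fin (S.n + S'.n), (hrect (Fin.append S.lo S'.lo i)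
    (Fin.append S.hi S'.hi i)).indicator (fun _ => Fin.append S.coef S'.coef i ω) ζ = _
  rw [Fin.sum_univ_add]
  simp [eval]

theorem total_add (S S' : SimpleIntegrand B P) (ω : Ω) :
    (S.add S').total ω = S.total ω + S'.total ω := by
  change ∑ i : Fin (S.n + S'.n), Fin.append S.coef S'.coef i ω *
    increment B (Fin.append S.lo S'.lo i) (Fin.append S.hi S'.hi i) ω = _
  rw [Fin.sum_univ_add]
  simp [total]

theorem integral_add (S S' : SimpleIntegrand B P) (z : ℝ × ℝ) (ω : Ω) :
    (S.add S').integral z ω = S.integral z ω + S'.integral z ω := by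
  change ∑ i : Fin (S.n + S'.n), Fin.append S.coef S'.coef i ω *
    increment B (Fin.append S.lo S'.lo i ⊓ z) (Fin.append S.hi S'.hi i ⊓ z) ω = _
  rw [Fin.sum_univ_add]
  simp [integral]

theorem eval_smul (c : ℝ) (S : SimpleIntegrand B P) (ζ : ℝ × ℝ) (ω : Ω) :
    (S.smul c).eval ζ ω = c * S.eval ζ ω := by
  simp only [eval, smul, Finset.mul_sum]
  refine Finset.sum_congr rfl fun i _ => ?_
  by_cases h : ζ ∈ hrect (S.lo i) (S.hi i) <;> simp [h]

theorem total_smul (c : ℝ) (S : SimpleIntegrand B P) (ω : Ω) :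
    (S.smul c).total ω = c * S.total ω := by
  simp only [total, smul, Finset.mul_sum]
  exact Finset.sum_congr rfl fun i _ => mul_assoc _ _ _

theorem integral_smul (c : ℝ) (S : SimpleIntegrand B P) (z : ℝ × ℝ) (ω : Ω) :
    (S.smul c).integral z ω = c * S.integral z ω := by
  simp only [integral, smul, Finset.mul_sum]
  exact Finset.sum_congr rfl fun i _ => mul_assoc _ _ _

theorem eval_single {a b : ℝ × ℝ} (ha : 0 ≤ a) (hab : a ≤ b) {ξ : Ω → ℝ}
    (hξ : Measurable[sheetFiltration B P a] ξ) {K : ℝ} (hK : ∀ ω, |ξ ω| ≤ K) (ζ : ℝ × ℝ)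
    (ω : Ω) : (single ha hab hξ hK).eval ζ ω = (hrect a b).indicator (fun _ => ξ ω) ζ := by
  exact Fin.sum_univ_one _

omit [MeasurableSpace Ω] in
theorem increment_eq_zero {a b : ℝ × ℝ} (h : a.1 = b.1 ∨ a.2 = b.2) (ω : Ω) :
    increment B a b ω = 0 := by
  obtain ⟨a1, a2⟩ := a
  obtain ⟨b1, b2⟩ := b
  rcases h with h | h <;> simp only at h <;> subst h <;> simp [increment]

theorem total_restrict (S : SimpleIntegrand B P) {z : ℝ × ℝ} (hz : 0 ≤ z) (ω : Ω) :
    (S.restrict hz).total ω = S.integral z ω := by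
  simp only [total, restrict, integral]
  refine Finset.sum_congr rfl fun i _ => ?_
  split_ifs with h
  · rfl
  · have h' : z.1 ≤ (S.lo i).1 ∨ z.2 ≤ (S.lo i).2 := by
      rw [Prod.le_def, not_and_or, not_le, not_le] at h
      exact h.imp le_of_lt le_of_lt
    rw [increment_eq_zero]
    · simp
    · refine h'.imp (fun h => ?_) (fun h => ?_)
      · simp [h, h.trans (S.lo_le_hi i).1]
      · simp [h, h.trans (S.lo_le_hi i).2]

theorem mem_hrect_inf {a b z ζ : ℝ × ℝ} (h : a ≤ z) :
    ζ ∈ hrect (a ⊓ z) (b ⊓ z) ↔ ζ ∈ hrect a b ∧ ζ ≤ z := by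
  rw [inf_eq_left.2 h]
  simp only [hrect, Set.mem_prod, Set.mem_Ioc, Prod.fst_inf, Prod.snd_inf, le_inf_iff,
    Prod.le_def]
  tauto

theorem eval_restrict (S : SimpleIntegrand B P) {z : ℝ × ℝ} (hz : 0 ≤ z) (ζ : ℝ × ℝ) (ω : Ω) :
    (S.restrict hz).eval ζ ω = (rect z).indicator (fun ζ => S.eval ζ ω) ζ := by
  by_cases hζ : ζ ∈ rect z
  · rw [Set.indicator_of_mem hζ]
    simp only [eval, restrict]
    refine Finset.sum_congr rfl fun i _ => ?_
    split_ifs with h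
    · by_cases h' : ζ ∈ hrect (S.lo i) (S.hi i)
      · rw [Set.indicator_of_mem h', Set.indicator_of_mem ((mem_hrect_inf h).2 ⟨h', hζ.2⟩)]
      · rw [Set.indicator_of_notMem h',
          Set.indicator_of_notMem fun h'' => h' ((mem_hrect_inf h).1 h'').1]
    · rw [Set.indicator_of_notMem (s := hrect (S.lo i) (S.hi i))]
      · simp
      · exact fun h' => h ⟨h'.1.1.le.trans hζ.2.1, h'.2.1.le.trans hζ.2.2⟩
  · rw [Set.indicator_of_notMem hζ]
    simp only [eval, restrict]
    refine Finset.sum_eq_zero fun i _ => ?_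
    refine Set.indicator_of_notMem (fun h' => hζ ?_) _
    have h0 := le_inf (S.lo_nonneg i) hz
    exact ⟨⟨h0.1.trans h'.1.1.le, h0.2.trans h'.2.1.le⟩,
      ⟨h'.1.2.trans inf_le_right, h'.2.2.trans inf_le_right⟩⟩

variable [IsProbabilityMeasure P] [P.IsComplete]

omit [IsProbabilityMeasure P] in
theorem measurable_coef' (hB : IsBrownianSheet B P) (S : SimpleIntegrand B P) (i : Fin S.n) :
    Measurable (S.coef i) := (S.measurable_coef i).mono (sheetFiltration_le hB _) le_rfl

theorem memLp_eval (hB : IsBrownianSheet B P) (S : SimpleIntegrand B P) :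
    MemLp (fun p : (ℝ × ℝ) × Ω => S.eval p.1 p.2) 2 (volume.prod P) := by
  refine memLp_finsetSum _ fun i _ => ?_
  obtain ⟨K, hK⟩ := S.bounded_coef i
  have hs : MeasurableSet ((Prod.fst : (ℝ × ℝ) × Ω → ℝ × ℝ) ⁻¹' hrect (S.lo i) (S.hi i)) :=
    measurable_fst (measurableSet_hrect _ _)
  have hfin : IsFiniteMeasure (((volume : Measure (ℝ × ℝ)).prod P).restrict
      ((Prod.fst : (ℝ × ℝ) × Ω → ℝ × ℝ) ⁻¹' hrect (S.lo i) (S.hi i))) := by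
    refine ⟨?_⟩
    rw [Measure.restrict_apply_univ, ← Set.prod_univ, Measure.prod_prod]
    simpa using volume_hrect_lt_top _ _
  exact (memLp_indicator_iff_restrict hs).2 (MemLp.of_bound
    ((S.measurable_coef' hB i).comp measurable_snd).aestronglyMeasurable K
    (.of_forall fun p => hK p.2))

omit [IsProbabilityMeasure P] in
theorem memLp_total (hB : IsBrownianSheet B P) (S : SimpleIntegrand B P) :
    MemLp S.total 2 P := by
  refine memLp_finsetSum _ fun i _ => ?_
  obtain ⟨K, hK⟩ := S.bounded_coef i
  have h0 := S.lo_nonneg i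
  have h1 := h0.trans (S.lo_le_hi i)
  refine (memLp_increment hB h0.1 h1.1).of_le_mul (c := K) ((S.measurable_coef' hB i).mul
    (measurable_increment hB h0.1 h1.1)).aestronglyMeasurable (.of_forall fun ω => ?_)
  rw [norm_mul]
  exact mul_le_mul_of_nonneg_right (hK ω) (norm_nonneg _)

/-- The Itô isometry for elementary integrals. -/
theorem eLpNorm_total (hB : IsBrownianSheet B P) (S : SimpleIntegrand B P) :
    eLpNorm S.total 2 P = eLpNorm (fun p : (ℝ × ℝ) × Ω => S.eval p.1 p.2) 2 (volume.prod P) := by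
  refine eLpNorm_two_eq_of_integral_sq_eq (S.memLp_total hB) (S.memLp_eval hB) ?_
  choose K hK using S.bounded_coef
  have hm (i : Fin S.n) := S.measurable_coef' hB i
  have h0 (i : Fin S.n) := S.lo_nonneg i
  have h1 (i : Fin S.n) := (S.lo_nonneg i).trans (S.lo_le_hi i)
  have hmij (i j : Fin S.n) : Measurable (fun ω => S.coef i ω * S.coef j ω) := (hm i).mul (hm j)
  have hKij (i j : Fin S.n) (ω : Ω) : |S.coef i ω * S.coef j ω| ≤ K i * K j := by
    rw [abs_mul]
    exact mul_le_mul (hK i ω) (hK j ω) (abs_nonneg _) ((abs_nonneg _).trans (hK i ω))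
  have e1 : ∀ ω, S.total ω ^ 2 = ∑ i, ∑ j, S.coef i ω * S.coef j ω *
      (increment B (S.lo i) (S.hi i) ω * increment B (S.lo j) (S.hi j) ω) := fun ω => by
    rw [sq, total, Finset.sum_mul_sum]
    refine Finset.sum_congr rfl fun i _ => Finset.sum_congr rfl fun j _ => by ring
  have e2 : ∀ p : (ℝ × ℝ) × Ω, S.eval p.1 p.2 ^ 2 = ∑ i, ∑ j,
      (hrect (S.lo i) (S.hi i) ∩ hrect (S.lo j) (S.hi j)).indicator (fun _ => (1 : ℝ)) p.1 *
        (S.coef i p.2 * S.coef j p.2) := fun p => by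
    rw [sq, eval, Finset.sum_mul_sum]
    refine Finset.sum_congr rfl fun i _ => Finset.sum_congr rfl fun j _ => ?_
    by_cases hi : p.1 ∈ hrect (S.lo i) (S.hi i) <;> by_cases hj : p.1 ∈ hrect (S.lo j) (S.hi j) <;>
      simp [hi, hj]
  have hvol (i j : Fin S.n) : MeasureTheory.Integrable ((hrect (S.lo i) (S.hi i) ∩
      hrect (S.lo j) (S.hi j)).indicator (fun _ => (1 : ℝ))) volume :=
    (integrable_indicator_iff ((measurableSet_hrect _ _).inter (measurableSet_hrect _ _))).2
      (integrableOn_const ((measure_mono Set.inter_subset_left).trans_lt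
        (volume_hrect_lt_top _ _)).ne)
  have hcc (i j : Fin S.n) : MeasureTheory.Integrable (fun ω => S.coef i ω * S.coef j ω) P :=
    MeasureTheory.Integrable.of_bound (hmij i j).aestronglyMeasurable _ (.of_forall (hKij i j))
  simp only [e1, e2]
  rw [integral_finsetSum _ fun i _ => integrable_finsetSum _ fun j _ =>
      integrable_mul_increment hB (h0 i).1 (h1 i).1 (h0 j).1 (h1 j).1 (hmij i j) (hKij i j),
    integral_finsetSum _ fun i _ => integrable_finsetSum _ fun j _ => (hvol i j).mul_prod (hcc i j)]
  refine Finset.sum_congr rfl fun i _ => ?_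
  rw [integral_finsetSum _ fun j _ =>
      integrable_mul_increment hB (h0 i).1 (h1 i).1 (h0 j).1 (h1 j).1 (hmij i j) (hKij i j),
    integral_finsetSum _ fun j _ => (hvol i j).mul_prod (hcc i j)]
  refine Finset.sum_congr rfl fun j _ => ?_
  rw [integral_mul_increment_mul_increment hB (h0 i) (S.lo_le_hi i) (h0 j) (S.lo_le_hi j)
    (S.measurable_coef i) (S.measurable_coef j) (hK i) (hK j),
    integral_prod_mul (μ := volume) (ν := P) ((hrect (S.lo i) (S.hi i) ∩
      hrect (S.lo j) (S.hi j)).indicator (fun _ => (1 : ℝ))) (fun ω => S.coef i ω * S.coef j ω),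
    integral_indicator_const _ ((measurableSet_hrect _ _).inter (measurableSet_hrect _ _)),
    volume_real_hrect_inter_hrect, smul_eq_mul, mul_one, mul_comm]

omit [P.IsComplete] in
theorem eLpNorm_indicator_rect (f : (ℝ × ℝ) × Ω → ℝ) {s : Set (ℝ × ℝ)} (hs : MeasurableSet s) :
    eLpNorm (fun p => s.indicator (fun ζ => f (ζ, p.2)) p.1) 2 (volume.prod P)
      = eLpNorm f 2 ((volume.restrict s).prod P) := by
  have hm : MeasurableSet ((Prod.fst : (ℝ × ℝ) × Ω → ℝ × ℝ) ⁻¹' s) := measurable_fst hs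
  have e : (volume.restrict s).prod P = ((volume : Measure (ℝ × ℝ)).prod P).restrict
      ((Prod.fst : (ℝ × ℝ) × Ω → ℝ × ℝ) ⁻¹' s) := by
    rw [← Set.prod_univ, ← Measure.prod_restrict, Measure.restrict_univ]
  rw [e, ← eLpNorm_indicator_eq_eLpNorm_restrict hm]
  rfl

/-- The Itô isometry for elementary integrals over `R_z`. -/
theorem eLpNorm_integral (hB : IsBrownianSheet B P) (S : SimpleIntegrand B P) {z : ℝ × ℝ}
    (hz : 0 ≤ z) : eLpNorm (S.integral z) 2 P
      = eLpNorm (fun p : (ℝ × ℝ) × Ω => S.eval p.1 p.2) 2 ((volume.restrict (rect z)).prod P) := by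
  rw [← eLpNorm_indicator_rect _ (measurableSet_rect z)]
  have := (S.restrict hz).eLpNorm_total hB
  simp only [eval_restrict] at this
  rw [← this]
  congr 1
  funext ω
  exact (S.total_restrict hz ω).symm

omit [IsProbabilityMeasure P] in
theorem memLp_integral (hB : IsBrownianSheet B P) (S : SimpleIntegrand B P) {z : ℝ × ℝ}
    (hz : 0 ≤ z) : MemLp (S.integral z) 2 P := by
  have := (S.restrict hz).memLp_total hB
  rwa [show (S.restrict hz).total = S.integral z from funext (S.total_restrict hz)] at this

/-- The isometry for the difference of the integrals over two rectangles. -/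
theorem eLpNorm_integral_sub (hB : IsBrownianSheet B P) (S : SimpleIntegrand B P) {z w : ℝ × ℝ}
    (hz : 0 ≤ z) (hw : 0 ≤ w) : eLpNorm (fun ω => S.integral z ω - S.integral w ω) 2 P
      = eLpNorm (fun p : (ℝ × ℝ) × Ω => S.eval p.1 p.2) 2
        ((volume.restrict (symmDiff (rect z) (rect w))).prod P) := by
  have := ((S.restrict hz).add ((S.restrict hw).smul (-1))).eLpNorm_total hB
  rw [← eLpNorm_indicator_rect _ ((measurableSet_rect z).symmDiff (measurableSet_rect w))]
  simp only [eval_restrict, eval_add, eval_smul] at this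
  have e : ((S.restrict hz).add ((S.restrict hw).smul (-1))).total
      = fun ω => S.integral z ω - S.integral w ω := by
    funext ω
    rw [total_add, total_smul, total_restrict, total_restrict]
    ring
  rw [← e, this]
  refine eLpNorm_congr_norm_ae (.of_forall fun p => ?_)
  by_cases h : p.1 ∈ rect z <;> by_cases h' : p.1 ∈ rect w <;>
    simp [Set.indicator, h, h', Set.mem_symmDiff]

omit [IsProbabilityMeasure P] [P.IsComplete] in
theorem integral_measurable (S : SimpleIntegrand B P) {z : ℝ × ℝ} (hz : 0 ≤ z) :
    Measurable[sheetFiltration B P z] (S.integral z) := by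
  have m (w : ℝ × ℝ) (hw : 0 ≤ w) : Measurable[sheetFiltration B P z] (B (w ⊓ z)) :=
    measurable_noiseAlg (S := {v | 0 ≤ v.1 ∧ v ≤ z}) ⟨(le_inf hw hz).1, inf_le_right⟩
  rw [show S.integral z = (S.restrict hz).total from funext fun ω => (S.total_restrict hz ω).symm]
  refine Finset.measurable_fun_sum _ fun i _ => ?_
  have h0 := S.lo_nonneg i
  have h1 := h0.trans (S.lo_le_hi i)
  have hc : Measurable[sheetFiltration B P z] ((S.restrict hz).coef i) :=
    ((S.restrict hz).measurable_coef i).mono (sheetFiltration_mono inf_le_right) le_rfl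
  refine Measurable.mul hc ?_
  exact Measurable.add (Measurable.sub (Measurable.sub (m _ h1)
    (m ((S.lo i).1, (S.hi i).2) ⟨h0.1, h1.2⟩)) (m ((S.hi i).1, (S.lo i).2) ⟨h1.1, h0.2⟩)) (m _ h0)

end SimpleIntegrand

end Simple

/-! ### The Itô integral -/

section Analysis

theorem sq_lintegral_le {α : Type*} [MeasurableSpace α] {μ : Measure α} {f : α → ℝ≥0∞}
    (hf : AEMeasurable f μ) : (∫⁻ x, f x ∂μ) ^ 2 ≤ μ Set.univ * ∫⁻ x, f x ^ 2 ∂μ := by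
  have h := ENNReal.lintegral_mul_le_Lp_mul_Lq μ Real.HolderConjugate.two_two
    (f := fun _ => 1) aemeasurable_const hf
  simp only [Pi.mul_apply, one_mul, ENNReal.rpow_ofNat, one_pow, lintegral_one] at h
  refine (pow_le_pow_left' h 2).trans (le_of_eq ?_)
  rw [mul_pow, ← ENNReal.rpow_natCast, ← ENNReal.rpow_natCast, ← ENNReal.rpow_mul,
    ← ENNReal.rpow_mul]
  norm_num

theorem rect_subset {z w : ℝ × ℝ} (h : w ∈ rect z) : rect w ⊆ rect z :=
  Set.Icc_subset_Icc le_rfl h.2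

theorem volume_rect_lt_top (z : ℝ × ℝ) : volume (rect z) < ∞ := isCompact_Icc.measure_lt_top

instance (z : ℝ × ℝ) : IsFiniteMeasure ((volume : Measure (ℝ × ℝ)).restrict (rect z)) :=
  ⟨by simpa using volume_rect_lt_top z⟩

theorem symmDiff_rect_subset {z w v : ℝ × ℝ} (hw : w ∈ rect z) (hv : v ∈ rect z) :
    symmDiff (rect w) (rect v) ⊆ rect z :=
  Set.union_subset (Set.sdiff_subset.trans (rect_subset hw))
    (Set.sdiff_subset.trans (rect_subset hv))

theorem tendsto_volume_symmDiff_rect {z v : ℝ × ℝ} (hv : v ∈ rect z) :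
    Tendsto (fun w => volume (symmDiff (rect w) (rect v))) (𝓝[rect z] v) (𝓝 0) := by
  have hb : ∀ w ∈ rect z, volume (symmDiff (rect w) (rect v))
      ≤ ENNReal.ofReal |v.1 - w.1| * ENNReal.ofReal z.2
        + ENNReal.ofReal z.1 * ENNReal.ofReal |v.2 - w.2| := by
    intro w hw
    have hsub : symmDiff (rect w) (rect v)
        ⊆ (Set.uIcc w.1 v.1 ×ˢ Set.Icc 0 z.2) ∪ (Set.Icc 0 z.1 ×ˢ Set.uIcc w.2 v.2) := by
      rintro p hp
      have hpz := symmDiff_rect_subset hw hv hp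
      have key : ∀ {u u' : ℝ × ℝ}, p ∈ rect u \ rect u' →
          (u'.1 ≤ p.1 ∧ p.1 ≤ u.1) ∨ (u'.2 ≤ p.2 ∧ p.2 ≤ u.2) := by
        rintro u u' ⟨h1, h2⟩
        by_contra! hc
        refine h2 ⟨h1.1, ?_, ?_⟩
        · by_contra! h
          exact absurd (hc.1 h.le) (not_lt.2 h1.2.1)
        · by_contra! h
          exact absurd (hc.2 h.le) (not_lt.2 h1.2.2)
      rcases hp with hp | hp
      · rcases key hp with h | h
        · exact .inl ⟨Set.mem_uIcc.2 (.inr h), hpz.1.2, hpz.2.2⟩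
        · exact .inr ⟨⟨hpz.1.1, hpz.2.1⟩, Set.mem_uIcc.2 (.inr h)⟩
      · rcases key hp with h | h
        · exact .inl ⟨Set.mem_uIcc.2 (.inl h), hpz.1.2, hpz.2.2⟩
        · exact .inr ⟨⟨hpz.1.1, hpz.2.1⟩, Set.mem_uIcc.2 (.inl h)⟩
    refine (measure_mono hsub).trans ((measure_union_le _ _).trans (le_of_eq ?_))
    rw [Measure.volume_eq_prod, Measure.prod_prod, Measure.prod_prod, Real.volume_interval,
      Real.volume_interval, Real.volume_Icc, Real.volume_Icc, sub_zero, sub_zero]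
  have hlim : Tendsto (fun w : ℝ × ℝ => ENNReal.ofReal |v.1 - w.1| * ENNReal.ofReal z.2
        + ENNReal.ofReal z.1 * ENNReal.ofReal |v.2 - w.2|) (𝓝[rect z] v) (𝓝 0) := by
    have c1 : Tendsto (fun w : ℝ × ℝ => ENNReal.ofReal |v.1 - w.1|) (𝓝[rect z] v) (𝓝 0) := by
      have : Continuous fun w : ℝ × ℝ => ENNReal.ofReal |v.1 - w.1| :=
        ENNReal.continuous_ofReal.comp (by fun_prop)
      simpa using (this.tendsto v).mono_left nhdsWithin_le_nhds
    have c2 : Tendsto (fun w : ℝ × ℝ => ENNReal.ofReal |v.2 - w.2|) (𝓝[rect z] v) (𝓝 0) := by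
      have : Continuous fun w : ℝ × ℝ => ENNReal.ofReal |v.2 - w.2| :=
        ENNReal.continuous_ofReal.comp (by fun_prop)
      simpa using (this.tendsto v).mono_left nhdsWithin_le_nhds
    simpa using (ENNReal.Tendsto.mul_const c1 (.inr ENNReal.ofReal_ne_top)).add
      (ENNReal.Tendsto.const_mul c2 (.inr ENNReal.ofReal_ne_top))
  refine tendsto_of_tendsto_of_tendsto_of_le_of_le' tendsto_const_nhds hlim
    (.of_forall fun _ => zero_le) ?_
  filter_upwards [self_mem_nhdsWithin] with w hw using hb w hw

theorem tendsto_lintegral_symmDiff_rect {z v : ℝ × ℝ} (hv : v ∈ rect z) {g : ℝ × ℝ → ℝ≥0∞}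
    (hg : ∫⁻ ζ in rect z, g ζ ≠ ∞) :
    Tendsto (fun w => ∫⁻ ζ in symmDiff (rect w) (rect v), g ζ) (𝓝[rect z] v) (𝓝 0) := by
  have h0 := tendsto_volume_symmDiff_rect hv
  have hle : Tendsto (fun w => volume.restrict (rect z) (symmDiff (rect w) (rect v)))
      (𝓝[rect z] v) (𝓝 0) :=
    tendsto_of_tendsto_of_tendsto_of_le_of_le tendsto_const_nhds h0 (fun _ => zero_le)
      fun w => Measure.restrict_apply_le _ _
  refine (tendsto_setLIntegral_zero hg hle).congr' ?_
  filter_upwards [self_mem_nhdsWithin] with w hw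
  rw [Measure.restrict_restrict ((measurableSet_rect _).symmDiff (measurableSet_rect _)),
    Set.inter_eq_left.2 (symmDiff_rect_subset hw hv)]

theorem enorm_integral_rect_sub_le {f : ℝ × ℝ → ℝ} {z v w : ℝ × ℝ}
    (hf : IntegrableOn f (rect z)) (hw : w ∈ rect z) (hv : v ∈ rect z) :
    ‖(∫ ζ in rect w, f ζ) - ∫ ζ in rect v, f ζ‖ₑ
      ≤ ∫⁻ ζ in symmDiff (rect w) (rect v), ‖f ζ‖ₑ := by
  have iw := (integrable_indicator_iff (measurableSet_rect w)).2 (hf.mono_set (rect_subset hw))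
  have iv := (integrable_indicator_iff (measurableSet_rect v)).2 (hf.mono_set (rect_subset hv))
  rw [← integral_indicator (measurableSet_rect w), ← integral_indicator (measurableSet_rect v),
    ← integral_sub iw iv, ← lintegral_indicator
      ((measurableSet_rect w).symmDiff (measurableSet_rect v))]
  refine (enorm_integral_le_lintegral_enorm _).trans (lintegral_mono fun ζ => le_of_eq ?_)
  by_cases h : ζ ∈ rect w <;> by_cases h' : ζ ∈ rect v <;>
    simp [Set.indicator, h, h', Set.mem_symmDiff]

theorem continuousOn_integral_rect {f : ℝ × ℝ → ℝ} {z : ℝ × ℝ} (hf : IntegrableOn f (rect z)) :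
    ContinuousOn (fun w => ∫ ζ in rect w, f ζ) (rect z) := by
  intro v hv
  rw [ContinuousWithinAt, tendsto_iff_edist_tendsto_0]
  refine tendsto_of_tendsto_of_tendsto_of_le_of_le' tendsto_const_nhds
    (tendsto_lintegral_symmDiff_rect hv hf.2.ne) (.of_forall fun _ => zero_le) ?_
  filter_upwards [self_mem_nhdsWithin] with w hw
  rw [edist_eq_enorm_sub]
  exact enorm_integral_rect_sub_le hf hw hv

end Analysis

section Ito

/-- Cauchy–Schwarz for the integral of a process over a set of parameters. -/
theorem lintegral_sq_lintegral_le {Ω : Type*} [MeasurableSpace Ω] {P : Measure Ω} [SFinite P]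
    {f : (ℝ × ℝ) × Ω → ℝ≥0∞} {s : Set (ℝ × ℝ)}
    (hf : AEMeasurable f ((volume.restrict s).prod P)) :
    ∫⁻ ω, (∫⁻ ζ in s, f (ζ, ω)) ^ 2 ∂P ≤ volume s * ∫⁻ ζ in s, (∫⁻ ω, f (ζ, ω) ^ 2 ∂P) := by
  have h1 : ∀ᵐ ω ∂P, AEMeasurable (fun ζ => f (ζ, ω)) (volume.restrict s) := by
    have := hf.prod_swap
    have h2 := this.aestronglyMeasurable.prodMk_left
    filter_upwards [h2] with ω hω
    exact hω.aemeasurable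
  calc ∫⁻ ω, (∫⁻ ζ in s, f (ζ, ω)) ^ 2 ∂P
      ≤ ∫⁻ ω, (volume s * ∫⁻ ζ in s, f (ζ, ω) ^ 2) ∂P := by
        refine lintegral_mono_ae ?_
        filter_upwards [h1] with ω hω
        simpa using sq_lintegral_le hω
    _ = volume s * ∫⁻ ω, (∫⁻ ζ in s, f (ζ, ω) ^ 2) ∂P := by
        refine lintegral_const_mul'' _ ?_
        exact (hf.pow_const 2).prod_swap.lintegral_prod_right'
    _ = volume s * ∫⁻ ζ in s, (∫⁻ ω, f (ζ, ω) ^ 2 ∂P) := by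
        rw [lintegral_lintegral_swap]
        exact (hf.pow_const 2).prod_swap

variable {Ω : Type*} [MeasurableSpace Ω] {B : ℝ × ℝ → Ω → ℝ} {P : Measure Ω}
  [IsProbabilityMeasure P]

theorem sq_eLpNorm_prod {φ : (ℝ × ℝ) × Ω → ℝ} {s : Set (ℝ × ℝ)}
    (hφ : AEStronglyMeasurable φ ((volume.restrict s).prod P)) :
    eLpNorm φ 2 ((volume.restrict s).prod P) ^ 2
      = ∫⁻ ζ in s, eLpNorm (fun ω => φ (ζ, ω)) 2 P ^ 2 := by
  rw [eLpNorm_two_sq, lintegral_prod _ (hφ.enorm.pow_const 2)]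
  simp only [eLpNorm_two_sq]

omit [MeasurableSpace Ω] in
/-- A limit in `L^p` of functions measurable with respect to a sub-`σ`-algebra is a.e. equal to
such a function. -/
theorem aestronglyMeasurable_of_tendsto_eLpNorm {m m0 : MeasurableSpace Ω} {μ : Measure Ω}
    (hm : m ≤ m0) {p : ℝ≥0∞} [Fact (1 ≤ p)] {f : ℕ → Ω → ℝ} {g : Ω → ℝ}
    (hf : ∀ n, MemLp (f n) p μ) (hfm : ∀ n, AEStronglyMeasurable[m] (f n) μ) (hg : MemLp g p μ)
    (h : Tendsto (fun n => eLpNorm (fun ω => f n ω - g ω) p μ) atTop (𝓝 0)) :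
    AEStronglyMeasurable[m] g μ := by
  have hlim : Tendsto (fun n => (hf n).toLp) atTop (𝓝 hg.toLp) := by
    rw [tendsto_iff_edist_tendsto_0]
    simp only [Lp.edist_toLp_toLp]
    exact h
  have := (isClosed_aestronglyMeasurable (F := ℝ) (p := p) (μ := μ) hm).mem_of_tendsto hlim
    (.of_forall fun n => (hfm n).congr (hf n).coeFn_toLp.symm)
  exact AEStronglyMeasurable.congr this hg.coeFn_toLp

variable (B P) in
/-- `φ` lies in the closure of the simple predictable integrands in `L²(R_z × Ω)`, so that its
Itô integrals over rectangles in `R_z` exist. -/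
def IsItoIntegrable (φ : ℝ × ℝ → Ω → ℝ) (z : ℝ × ℝ) : Prop :=
  MemLp (fun p : (ℝ × ℝ) × Ω => φ p.1 p.2) 2 ((volume.restrict (rect z)).prod P) ∧
  ∃ S : ℕ → SimpleIntegrand B P,
    Tendsto (fun n => eLpNorm (fun p : (ℝ × ℝ) × Ω => (S n).eval p.1 p.2 - φ p.1 p.2) 2
      ((volume.restrict (rect z)).prod P)) atTop (𝓝 0)

theorem prod_restrict_mono {s t : Set (ℝ × ℝ)} (h : s ⊆ t) :
    (volume.restrict s).prod P ≤ (volume.restrict t).prod P :=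
  Measure.prod_mono (Measure.restrict_mono h le_rfl) le_rfl

variable [P.IsComplete]

theorem SimpleIntegrand.memLp_eval_restrict (hB : IsBrownianSheet B P) (S : SimpleIntegrand B P)
    (s : Set (ℝ × ℝ)) :
    MemLp (fun p : (ℝ × ℝ) × Ω => S.eval p.1 p.2) 2 ((volume.restrict s).prod P) :=
  (S.memLp_eval hB).mono_measure (Measure.prod_mono Measure.restrict_le_self le_rfl)

theorem eLpNorm_integral_sub_integral (hB : IsBrownianSheet B P) (S S' : SimpleIntegrand B P)
    {z : ℝ × ℝ} (hz : 0 ≤ z) :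
    eLpNorm (fun ω => S.integral z ω - S'.integral z ω) 2 P
      = eLpNorm (fun p : (ℝ × ℝ) × Ω => S.eval p.1 p.2 - S'.eval p.1 p.2) 2
        ((volume.restrict (rect z)).prod P) := by
  have := (S.add (S'.smul (-1))).eLpNorm_integral hB hz
  have e1 : (S.add (S'.smul (-1))).integral z = fun ω => S.integral z ω - S'.integral z ω := by
    funext ω
    rw [SimpleIntegrand.integral_add, SimpleIntegrand.integral_smul]
    ring
  have e2 (p : (ℝ × ℝ) × Ω) : (S.add (S'.smul (-1))).eval p.1 p.2
      = S.eval p.1 p.2 - S'.eval p.1 p.2 := by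
    rw [SimpleIntegrand.eval_add, SimpleIntegrand.eval_smul]
    ring
  rwa [e1, funext e2] at this

theorem eLpNorm_sub_comm' {α : Type*} [MeasurableSpace α] {μ : Measure α} {p : ℝ≥0∞}
    (f g : α → ℝ) : eLpNorm (fun x => f x - g x) p μ = eLpNorm (fun x => g x - f x) p μ :=
  eLpNorm_sub_comm f g p μ

/-- The Itô integral is a contraction, in particular unique up to null sets. -/
theorem IsItoIntegral.eLpNorm_sub_le (hB : IsBrownianSheet B P) {φ φ' : ℝ × ℝ → Ω → ℝ}
    {z : ℝ × ℝ} (hz : 0 ≤ z) {I I' : Ω → ℝ} (h : IsItoIntegral B P φ z I)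
    (h' : IsItoIntegral B P φ' z I') :
    eLpNorm (fun ω => I ω - I' ω) 2 P ≤ eLpNorm
      (fun p : (ℝ × ℝ) × Ω => φ p.1 p.2 - φ' p.1 p.2) 2 ((volume.restrict (rect z)).prod P) := by
  obtain ⟨hφ, hI, S, hS, hSI⟩ := h
  obtain ⟨hφ', hI', S', hS', hSI'⟩ := h'
  have tri {α : Type _} [MeasurableSpace α] {μ : Measure α} {f g f' g' : α → ℝ}
      (hf : AEStronglyMeasurable f μ) (hg : AEStronglyMeasurable g μ)
      (hf' : AEStronglyMeasurable f' μ) (hg' : AEStronglyMeasurable g' μ) :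
      eLpNorm (fun x => f x - f' x) 2 μ ≤ eLpNorm (fun x => g x - f x) 2 μ
        + eLpNorm (fun x => g x - g' x) 2 μ + eLpNorm (fun x => g' x - f' x) 2 μ := by
    have e : (fun x => f x - f' x) = ((f - g) + (g - g')) + (g' - f') := by
      funext x
      simp
    rw [e]
    refine (eLpNorm_add_le ((hf.sub hg).add (hg.sub hg')) (hg'.sub hf') (by norm_num)).trans ?_
    gcongr
    · refine (eLpNorm_add_le (hf.sub hg) (hg.sub hg') (by norm_num)).trans ?_
      rw [eLpNorm_sub_comm]
      rfl
    · rfl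
  have hle (n : ℕ) : eLpNorm (fun ω => I ω - I' ω) 2 P ≤
      eLpNorm (fun ω => (S n).integral z ω - I ω) 2 P
      + (eLpNorm (fun p : (ℝ × ℝ) × Ω => (S n).eval p.1 p.2 - φ p.1 p.2) 2
          ((volume.restrict (rect z)).prod P)
        + eLpNorm (fun p : (ℝ × ℝ) × Ω => φ p.1 p.2 - φ' p.1 p.2) 2
          ((volume.restrict (rect z)).prod P)
        + eLpNorm (fun p : (ℝ × ℝ) × Ω => (S' n).eval p.1 p.2 - φ' p.1 p.2) 2
          ((volume.restrict (rect z)).prod P))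
      + eLpNorm (fun ω => (S' n).integral z ω - I' ω) 2 P := by
    refine (tri hI.1 ((S n).memLp_integral hB hz).1 hI'.1 ((S' n).memLp_integral hB hz).1).trans ?_
    gcongr
    rw [eLpNorm_integral_sub_integral hB _ _ hz]
    have := tri (f := fun p : (ℝ × ℝ) × Ω => (S n).eval p.1 p.2)
      (f' := fun p : (ℝ × ℝ) × Ω => (S' n).eval p.1 p.2)
      ((S n).memLp_eval_restrict hB (rect z)).1 hφ.1
      ((S' n).memLp_eval_restrict hB (rect z)).1 hφ'.1
    refine this.trans (le_of_eq ?_)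
    rw [eLpNorm_sub_comm' (fun p : (ℝ × ℝ) × Ω => φ p.1 p.2),
      eLpNorm_sub_comm' (fun p : (ℝ × ℝ) × Ω => φ' p.1 p.2)]
  have hlim := (hSI.add ((hS.add (tendsto_const_nhds (x := eLpNorm
    (fun p : (ℝ × ℝ) × Ω => φ p.1 p.2 - φ' p.1 p.2) 2
      ((volume.restrict (rect z)).prod P)))).add hS')).add hSI'
  simp only [zero_add, add_zero] at hlim
  exact ge_of_tendsto' hlim hle

/-- Existence of the Itô integrals over all rectangles `R_w ⊆ R_z`, adapted and with the
isometric modulus of continuity. -/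
theorem IsItoIntegrable.exists_integral (hB : IsBrownianSheet B P) {φ : ℝ × ℝ → Ω → ℝ}
    {z : ℝ × ℝ} (h : IsItoIntegrable B P φ z) :
    ∃ I : ℝ × ℝ → Ω → ℝ,
      (∀ w ∈ rect z, IsItoIntegral B P φ w (I w) ∧
        AEStronglyMeasurable[sheetFiltration B P w] (I w) P) ∧
      ∀ w ∈ rect z, ∀ v ∈ rect z, eLpNorm (fun ω => I w ω - I v ω) 2 P ≤
        eLpNorm (fun p : (ℝ × ℝ) × Ω => φ p.1 p.2) 2
          ((volume.restrict (symmDiff (rect w) (rect v))).prod P) := by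
  obtain ⟨hφ, S, hS⟩ := h
  have hSs {s : Set (ℝ × ℝ)} (hs : s ⊆ rect z) :
      Tendsto (fun n => eLpNorm (fun p : (ℝ × ℝ) × Ω => (S n).eval p.1 p.2 - φ p.1 p.2) 2
        ((volume.restrict s).prod P)) atTop (𝓝 0) :=
    tendsto_of_tendsto_of_tendsto_of_le_of_le tendsto_const_nhds hS (fun _ => zero_le)
      fun n => eLpNorm_mono_measure _ (prod_restrict_mono hs)
  have hex : ∀ w ∈ rect z, ∃ J : Ω → ℝ, MemLp J 2 P ∧
      Tendsto (fun n => eLpNorm (fun ω => (S n).integral w ω - J ω) 2 P) atTop (𝓝 0) := by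
    intro w hw
    have hSw := hSs (rect_subset hw)
    have hm (n : ℕ) := (S n).memLp_integral hB hw.1
    have hc : CauchySeq (fun n => (hm n).toLp) := by
      rw [EMetric.cauchySeq_iff]
      intro ε hε
      have hε2 : 0 < ε / 2 := ENNReal.half_pos hε.ne'
      obtain ⟨N, hN⟩ := eventually_atTop.1 (hSw.eventually_lt_const hε2)
      refine ⟨N, fun m hm' n hn => ?_⟩
      rw [Lp.edist_toLp_toLp]
      have hφ' := (hφ.mono_measure (prod_restrict_mono (P := P) (rect_subset hw))).1
      have hs' (n : ℕ) := ((S n).memLp_eval_restrict hB (rect w)).1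
      calc eLpNorm (fun ω => (S m).integral w ω - (S n).integral w ω) 2 P
          = eLpNorm (fun p : (ℝ × ℝ) × Ω => (S m).eval p.1 p.2 - (S n).eval p.1 p.2) 2
              ((volume.restrict (rect w)).prod P) := eLpNorm_integral_sub_integral hB _ _ hw.1
        _ ≤ eLpNorm (fun p : (ℝ × ℝ) × Ω => (S m).eval p.1 p.2 - φ p.1 p.2) 2
              ((volume.restrict (rect w)).prod P)
            + eLpNorm (fun p : (ℝ × ℝ) × Ω => φ p.1 p.2 - (S n).eval p.1 p.2) 2
              ((volume.restrict (rect w)).prod P) := by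
            refine le_of_eq_of_le ?_ (eLpNorm_add_le ((hs' m).sub hφ') (hφ'.sub (hs' n))
              (by norm_num))
            congr 1
            funext p
            simp
        _ < ε / 2 + ε / 2 := by
            rw [eLpNorm_sub_comm' (fun p : (ℝ × ℝ) × Ω => φ p.1 p.2)]
            exact ENNReal.add_lt_add (hN m hm') (hN n hn)
        _ = ε := ENNReal.add_halves ε
    obtain ⟨J, hJ⟩ := cauchySeq_tendsto_of_complete hc
    refine ⟨J, Lp.memLp J, ?_⟩
    rw [tendsto_iff_edist_tendsto_0] at hJ
    refine hJ.congr fun n => ?_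
    rw [Lp.edist_def]
    refine eLpNorm_congr_ae ?_
    filter_upwards [(hm n).coeFn_toLp] with ω hω
    simp [hω]
  classical
  choose! J hJm hJ using hex
  refine ⟨J, fun w hw => ⟨⟨hφ.mono_measure (prod_restrict_mono (rect_subset hw)), hJm w hw, S,
    hSs (rect_subset hw), hJ w hw⟩, ?_⟩, fun w hw v hv => ?_⟩
  · exact aestronglyMeasurable_of_tendsto_eLpNorm (sheetFiltration_le hB w) (p := 2)
      (fun n => (S n).memLp_integral hB hw.1)
      (fun n => ((S n).integral_measurable hw.1).stronglyMeasurable.aestronglyMeasurable)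
      (hJm w hw) (hJ w hw)
  · have hle (n : ℕ) : eLpNorm (fun ω => J w ω - J v ω) 2 P ≤
        eLpNorm (fun ω => (S n).integral w ω - J w ω) 2 P
        + (eLpNorm (fun p : (ℝ × ℝ) × Ω => (S n).eval p.1 p.2 - φ p.1 p.2) 2
            ((volume.restrict (symmDiff (rect w) (rect v))).prod P)
          + eLpNorm (fun p : (ℝ × ℝ) × Ω => φ p.1 p.2) 2
            ((volume.restrict (symmDiff (rect w) (rect v))).prod P))
        + eLpNorm (fun ω => (S n).integral v ω - J v ω) 2 P := by
      have mw := (hJm w hw).1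
      have mv := (hJm v hv).1
      have sw := ((S n).memLp_integral hB hw.1).1
      have sv := ((S n).memLp_integral hB hv.1).1
      have e : (fun ω => J w ω - J v ω) = ((J w - (S n).integral w)
          + ((S n).integral w - (S n).integral v)) + ((S n).integral v - J v) := by
        funext x
        simp
      rw [e]
      refine (eLpNorm_add_le ((mw.sub sw).add (sw.sub sv)) (sv.sub mv) (by norm_num)).trans ?_
      gcongr
      · refine (eLpNorm_add_le (mw.sub sw) (sw.sub sv) (by norm_num)).trans ?_
        rw [eLpNorm_sub_comm]
        gcongr
        · rfl
        · refine ((S n).eLpNorm_integral_sub hB hw.1 hv.1).le.trans ?_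
          have hφ' := (hφ.mono_measure (prod_restrict_mono (P := P)
            (symmDiff_rect_subset hw hv))).1
          have hs' := ((S n).memLp_eval_restrict hB (symmDiff (rect w) (rect v))).1
          refine le_of_eq_of_le ?_ (eLpNorm_add_le (hs'.sub hφ') hφ' (by norm_num))
          congr 1
          funext p
          simp
      · rfl
    have hlim := ((hJ w hw).add ((hSs (symmDiff_rect_subset hw hv)).add
      (tendsto_const_nhds (x := eLpNorm (fun p : (ℝ × ℝ) × Ω => φ p.1 p.2) 2
        ((volume.restrict (symmDiff (rect w) (rect v))).prod P))))).add (hJ v hv)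
    simp only [zero_add, add_zero] at hlim
    exact ge_of_tendsto' hlim hle

end Ito

/-! ### Predictable integrands -/

section Drift

variable {Ω : Type*} [MeasurableSpace Ω] {B : ℝ × ℝ → Ω → ℝ} {P : Measure Ω}
  [IsProbabilityMeasure P]

theorem le_rpow_half_mul_of_sq_le {x v e : ℝ≥0∞} (h : x ^ 2 ≤ v * e ^ 2) :
    x ≤ v ^ (1 / 2 : ℝ) * e := by
  rw [← ENNReal.pow_le_pow_left_iff two_ne_zero, mul_pow, ← ENNReal.rpow_natCast (v ^ _),
    ← ENNReal.rpow_mul]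
  simpa using h

/-- Cauchy–Schwarz for a random variable dominated by the integral of a process. -/
theorem eLpNorm_lintegral_le {f : (ℝ × ℝ) × Ω → ℝ} {s : Set (ℝ × ℝ)} {g : Ω → ℝ}
    (hf : AEStronglyMeasurable f ((volume.restrict s).prod P))
    (hg : ∀ᵐ ω ∂P, ‖g ω‖ₑ ≤ ∫⁻ ζ in s, ‖f (ζ, ω)‖ₑ) :
    eLpNorm g 2 P ≤ volume s ^ (1 / 2 : ℝ) * eLpNorm f 2 ((volume.restrict s).prod P) := by
  refine le_rpow_half_mul_of_sq_le ?_
  rw [sq_eLpNorm_prod hf, eLpNorm_two_sq]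
  simp only [eLpNorm_two_sq]
  refine le_trans (lintegral_mono_ae ?_) (lintegral_sq_lintegral_le hf.enorm)
  filter_upwards [hg] with ω hω
  exact pow_le_pow_left' hω 2

theorem memLp_setIntegral {f : (ℝ × ℝ) × Ω → ℝ} {z : ℝ × ℝ}
    (hf : MemLp f 2 ((volume.restrict (rect z)).prod P)) :
    MemLp (fun ω => ∫ ζ in rect z, f (ζ, ω)) 2 P := by
  refine ⟨hf.1.prod_swap.integral_prod_right', ?_⟩
  refine (eLpNorm_lintegral_le hf.1 (.of_forall fun ω =>
    enorm_integral_le_lintegral_enorm _)).trans_lt ?_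
  exact ENNReal.mul_lt_top (ENNReal.rpow_lt_top_of_nonneg (by norm_num)
    (volume_rect_lt_top z).ne) hf.2

theorem ae_integrableOn_rect {f : (ℝ × ℝ) × Ω → ℝ} {z : ℝ × ℝ}
    (hf : MemLp f 2 ((volume.restrict (rect z)).prod P)) :
    ∀ᵐ ω ∂P, IntegrableOn (fun ζ => f (ζ, ω)) (rect z) :=
  (hf.integrable (by norm_num)).prod_left_ae

variable [P.IsComplete]

omit [IsProbabilityMeasure P] [P.IsComplete] in
theorem SimpleIntegrand.measurable_setIntegral_eval (S : SimpleIntegrand B P)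
    {z : ℝ × ℝ} (hz : 0 ≤ z) :
    Measurable[sheetFiltration B P z] (fun ω => ∫ ζ in rect z, S.eval ζ ω) := by
  have e : (fun ω => ∫ ζ in rect z, S.eval ζ ω) = fun ω => ∑ i,
      volume.real (hrect ((S.restrict hz).lo i) ((S.restrict hz).hi i))
        * (S.restrict hz).coef i ω := by
    funext ω
    rw [← MeasureTheory.integral_indicator (measurableSet_rect z)]
    simp only [← S.eval_restrict hz]
    simp only [eval]
    rw [integral_finsetSum]
    · refine Finset.sum_congr rfl fun i _ => ?_
      rw [integral_indicator_const _ (measurableSet_hrect _ _), smul_eq_mul]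
    · intro i _
      exact (integrable_indicator_iff (measurableSet_hrect _ _)).2
        (integrableOn_const (volume_hrect_lt_top _ _).ne)
  rw [e]
  refine Finset.measurable_fun_sum _ fun i _ => ?_
  exact Measurable.const_mul (((S.restrict hz).measurable_coef i).mono
    (sheetFiltration_mono inf_le_right) le_rfl) _

/-- Time integrals of processes in the closure of the simple integrands are adapted. -/
theorem IsItoIntegrable.aestronglyMeasurable_setIntegral (hB : IsBrownianSheet B P)
    {φ : ℝ × ℝ → Ω → ℝ} {z w : ℝ × ℝ} (h : IsItoIntegrable B P φ z) (hw : w ∈ rect z) :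
    AEStronglyMeasurable[sheetFiltration B P w] (fun ω => ∫ ζ in rect w, φ ζ ω) P := by
  obtain ⟨hφ, S, hS⟩ := h
  have hφw := hφ.mono_measure (prod_restrict_mono (P := P) (rect_subset hw))
  have hSm (n : ℕ) := (S n).memLp_eval_restrict hB (rect w)
  refine aestronglyMeasurable_of_tendsto_eLpNorm (sheetFiltration_le hB w) (p := 2)
    (f := fun n ω => ∫ ζ in rect w, (S n).eval ζ ω)
    (fun n => memLp_setIntegral (hSm n))
    (fun n => ((S n).measurable_setIntegral_eval hw.1).stronglyMeasurable.aestronglyMeasurable)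
    (memLp_setIntegral hφw) ?_
  have hlim := ENNReal.Tendsto.const_mul (a := volume (rect w) ^ (1 / 2 : ℝ)) hS
    (.inr (ENNReal.rpow_lt_top_of_nonneg (by norm_num) (volume_rect_lt_top w).ne).ne)
  rw [mul_zero] at hlim
  refine tendsto_of_tendsto_of_tendsto_of_le_of_le tendsto_const_nhds hlim
    (fun _ => zero_le) fun n => ?_
  refine (eLpNorm_lintegral_le ((hSm n).sub hφw).1 ?_).trans
    (mul_le_mul_right (eLpNorm_mono_measure _ (prod_restrict_mono (rect_subset hw))) _)
  filter_upwards [ae_integrableOn_rect (hSm n), ae_integrableOn_rect hφw] with ω h1 h2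
  rw [← integral_sub h1 h2]
  exact enorm_integral_le_lintegral_enorm _

end Drift

section Predictable

variable {Ω : Type*} [MeasurableSpace Ω] {B : ℝ × ℝ → Ω → ℝ} {P : Measure Ω}

variable (B P) in
/-- The predictable rectangles `(a, b] × F`, `F ∈ 𝓕_a`. -/
def predictableRects : Set (Set ((ℝ × ℝ) × Ω)) :=
  {A | ∃ (a b : ℝ × ℝ) (F : Set Ω), 0 ≤ a ∧ MeasurableSet[sheetFiltration B P a] F ∧
    A = hrect a b ×ˢ F}

variable (B P) in
/-- The predictable `σ`-algebra. Its generators lie in the open quadrant, so that a predictable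
function does not depend on the point of the axes at which it is evaluated. -/
@[reducible] def predictable : MeasurableSpace ((ℝ × ℝ) × Ω) :=
  MeasurableSpace.generateFrom (predictableRects B P)

theorem isPiSystem_predictableRects : IsPiSystem (predictableRects B P) := by
  rintro _ ⟨a, b, F, ha, hF, rfl⟩ _ ⟨c, d, G, hc, hG, rfl⟩ _
  refine ⟨a ⊔ c, b ⊓ d, F ∩ G, ha.trans le_sup_left, ?_, ?_⟩
  · exact MeasurableSet.inter (sheetFiltration_mono le_sup_left F hF)
      (sheetFiltration_mono le_sup_right G hG)
  · rw [Set.prod_inter_prod, hrect_inter_hrect]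

theorem hrect_eq_empty {a b : ℝ × ℝ} (h : ¬a ≤ b) : hrect a b = ∅ := by
  rw [Prod.le_def, not_and_or] at h
  rcases h with h | h
  · rw [hrect, Set.Ioc_eq_empty (fun h' => h h'.le), Set.empty_prod]
  · rw [hrect, Set.Ioc_eq_empty (fun h' => h h'.le), Set.prod_empty]

variable [P.IsComplete]

theorem predictable_le (hB : IsBrownianSheet B P) :
    predictable B P ≤ (inferInstance : MeasurableSpace ((ℝ × ℝ) × Ω)) := by
  refine MeasurableSpace.generateFrom_le ?_
  rintro _ ⟨a, b, F, -, hF, rfl⟩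
  exact (measurableSet_hrect a b).prod (sheetFiltration_le hB a F hF)

variable [IsProbabilityMeasure P]

variable (B P) in
/-- `f` can be approximated by simple integrands in `L²(R_z × Ω)`. -/
def IsApprox (z : ℝ × ℝ) (f : (ℝ × ℝ) × Ω → ℝ) : Prop :=
  ∀ ε : ℝ≥0∞, 0 < ε → ∃ S : SimpleIntegrand B P,
    eLpNorm (fun p : (ℝ × ℝ) × Ω => S.eval p.1 p.2 - f p) 2
      ((volume.restrict (rect z)).prod P) ≤ ε

omit [P.IsComplete] [IsProbabilityMeasure P] in
theorem IsApprox.isItoIntegrable {z : ℝ × ℝ} {φ : ℝ × ℝ → Ω → ℝ}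
    (hφ : MemLp (fun p : (ℝ × ℝ) × Ω => φ p.1 p.2) 2 ((volume.restrict (rect z)).prod P))
    (h : IsApprox B P z (fun p => φ p.1 p.2)) : IsItoIntegrable B P φ z := by
  refine ⟨hφ, ?_⟩
  choose S hS using fun n : ℕ => h (n + 1 : ℝ≥0∞)⁻¹ (ENNReal.inv_pos.2 (by finiteness))
  refine ⟨S, tendsto_of_tendsto_of_tendsto_of_le_of_le tendsto_const_nhds ?_
    (fun _ => zero_le) hS⟩
  have := (tendsto_add_atTop_iff_nat 1).2 ENNReal.tendsto_inv_nat_nhds_zero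
  simpa using this

omit [P.IsComplete] [IsProbabilityMeasure P] in
theorem IsApprox.congr {z : ℝ × ℝ} {f g : (ℝ × ℝ) × Ω → ℝ} (hf : IsApprox B P z f)
    (h : f =ᵐ[(volume.restrict (rect z)).prod P] g) : IsApprox B P z g := by
  intro ε hε
  obtain ⟨S, hS⟩ := hf ε hε
  refine ⟨S, le_of_eq_of_le (eLpNorm_congr_ae ?_) hS⟩
  filter_upwards [h] with p hp
  rw [hp]

theorem IsApprox.add (hB : IsBrownianSheet B P) {z : ℝ × ℝ} {f g : (ℝ × ℝ) × Ω → ℝ}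
    (hf : IsApprox B P z f) (hg : IsApprox B P z g)
    (hfm : AEStronglyMeasurable f ((volume.restrict (rect z)).prod P))
    (hgm : AEStronglyMeasurable g ((volume.restrict (rect z)).prod P)) :
    IsApprox B P z (f + g) := by
  intro ε hε
  obtain ⟨S, hS⟩ := hf (ε / 2) (ENNReal.half_pos hε.ne')
  obtain ⟨S', hS'⟩ := hg (ε / 2) (ENNReal.half_pos hε.ne')
  refine ⟨S.add S', ?_⟩
  rw [← ENNReal.add_halves ε]
  refine le_trans (le_of_eq_of_le ?_ (eLpNorm_add_le ((S.memLp_eval_restrict hB _).1.sub hfm)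
    ((S'.memLp_eval_restrict hB _).1.sub hgm) (by norm_num))) (add_le_add hS hS')
  congr 1
  funext p
  simp only [SimpleIntegrand.eval_add, Pi.add_apply, Pi.sub_apply]
  ring

omit [P.IsComplete] [IsProbabilityMeasure P] in
theorem IsApprox.const_mul {z : ℝ × ℝ} {f : (ℝ × ℝ) × Ω → ℝ}
    (hf : IsApprox B P z f) (c : ℝ) : IsApprox B P z (fun p => c * f p) := by
  intro ε hε
  obtain ⟨S, hS⟩ := hf (ε / (‖c‖ₑ + 1)) (ENNReal.div_pos hε.ne' (by finiteness))
  refine ⟨S.smul c, ?_⟩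
  have e : (fun p : (ℝ × ℝ) × Ω => (S.smul c).eval p.1 p.2 - c * f p)
      = c • fun p : (ℝ × ℝ) × Ω => S.eval p.1 p.2 - f p := by
    funext p
    simp only [SimpleIntegrand.eval_smul, Pi.smul_apply, smul_eq_mul]
    ring
  rw [e, eLpNorm_const_smul]
  calc ‖c‖ₑ * _ ≤ (‖c‖ₑ + 1) * (ε / (‖c‖ₑ + 1)) := mul_le_mul' le_self_add hS
    _ ≤ ε := ENNReal.mul_div_le

theorem IsApprox.of_approx (hB : IsBrownianSheet B P) {z : ℝ × ℝ} {f : (ℝ × ℝ) × Ω → ℝ}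
    (hfm : AEStronglyMeasurable f ((volume.restrict (rect z)).prod P))
    (h : ∀ ε : ℝ≥0∞, 0 < ε → ∃ g, IsApprox B P z g ∧
      AEStronglyMeasurable g ((volume.restrict (rect z)).prod P) ∧
      eLpNorm (fun p => g p - f p) 2 ((volume.restrict (rect z)).prod P) ≤ ε) :
    IsApprox B P z f := by
  intro ε hε
  obtain ⟨g, hg, hgm, hgf⟩ := h (ε / 2) (ENNReal.half_pos hε.ne')
  obtain ⟨S, hS⟩ := hg (ε / 2) (ENNReal.half_pos hε.ne')
  refine ⟨S, ?_⟩
  rw [← ENNReal.add_halves ε]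
  refine le_trans (le_of_eq_of_le ?_ (eLpNorm_add_le ((S.memLp_eval_restrict hB _).1.sub hgm)
    (hgm.sub hfm) (by norm_num))) (add_le_add hS hgf)
  congr 1
  funext p
  simp

omit [P.IsComplete] [IsProbabilityMeasure P] in
/-- The axes are negligible. -/
theorem ae_mem_hrect (z : ℝ × ℝ) :
    ∀ᵐ p ∂(volume.restrict (rect z)).prod P, p.1 ∈ hrect 0 z := by
  have h : ∀ᵐ ζ ∂(volume.restrict (rect z)), ζ ∈ hrect 0 z := by
    have e : hrect 0 z =ᵐ[volume] rect z := by
      have e : rect z = Set.Icc 0 z.1 ×ˢ Set.Icc 0 z.2 := Set.Icc_prod_eq 0 z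
      rw [e]
      exact Measure.set_prod_ae_eq Ioc_ae_eq_Icc Ioc_ae_eq_Icc
    rw [← Measure.restrict_congr_set e]
    exact ae_restrict_mem (measurableSet_hrect 0 z)
  exact Measure.quasiMeasurePreserving_fst.ae h

omit [P.IsComplete] [IsProbabilityMeasure P] in
theorem isApprox_zero (z : ℝ × ℝ) : IsApprox B P z 0 := by
  intro ε _
  refine ⟨SimpleIntegrand.single (a := 0) (b := 0) le_rfl le_rfl (ξ := 0) measurable_const
    (K := 0) (by simp), ?_⟩
  simp [SimpleIntegrand.eval_single]

theorem IsApprox.sum (hB : IsBrownianSheet B P) {z : ℝ × ℝ} {f : ℕ → (ℝ × ℝ) × Ω → ℝ}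
    (hf : ∀ n, IsApprox B P z (f n))
    (hfm : ∀ n, AEStronglyMeasurable (f n) ((volume.restrict (rect z)).prod P)) (n : ℕ) :
    IsApprox B P z (∑ i ∈ Finset.range n, f i) := by
  induction n with
  | zero => simpa using isApprox_zero z
  | succ n ih =>
    rw [Finset.sum_range_succ]
    exact ih.add hB (hf n) (Finset.aestronglyMeasurable_sum _ fun i _ => hfm i) (hfm n)

omit [P.IsComplete] [IsProbabilityMeasure P] in
theorem isApprox_hrect_prod {z a b : ℝ × ℝ} (ha : 0 ≤ a) {F : Set Ω}
    (hF : MeasurableSet[sheetFiltration B P a] F) :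
    IsApprox B P z ((hrect a b ×ˢ F).indicator 1) := by
  by_cases hab : a ≤ b
  · intro ε _
    have hm : Measurable[sheetFiltration B P a] (F.indicator (1 : Ω → ℝ)) :=
      Measurable.indicator measurable_const hF
    have hb (ω : Ω) : |F.indicator (1 : Ω → ℝ) ω| ≤ 1 := by
      by_cases h : ω ∈ F <;> simp [h]
    refine ⟨SimpleIntegrand.single ha hab hm hb, ?_⟩
    have e : (fun p : (ℝ × ℝ) × Ω => (SimpleIntegrand.single ha hab hm hb).eval p.1 p.2
        - (hrect a b ×ˢ F).indicator (1 : (ℝ × ℝ) × Ω → ℝ) p) = 0 := by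
      funext p
      rw [SimpleIntegrand.eval_single]
      by_cases h : p.1 ∈ hrect a b <;> by_cases h' : p.2 ∈ F <;> simp [Set.indicator, h, h']
    rw [e]
    simp
  · rw [hrect_eq_empty hab, Set.empty_prod, Set.indicator_empty]
    exact isApprox_zero z

/-- Indicators of predictable sets are approximable, by induction from the generating rectangles;
complements are taken inside `(0, z]`, which has full measure in `R_z`. -/
theorem isApprox_indicator (hB : IsBrownianSheet B P) (z : ℝ × ℝ) {A : Set ((ℝ × ℝ) × Ω)}
    (hA : MeasurableSet[predictable B P] A) : IsApprox B P z (A.indicator 1) := by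
  have mI {A : Set ((ℝ × ℝ) × Ω)} (hA : MeasurableSet A) :
      AEStronglyMeasurable (A.indicator (1 : (ℝ × ℝ) × Ω → ℝ))
        ((volume.restrict (rect z)).prod P) :=
    (measurable_one.indicator hA).aestronglyMeasurable
  refine MeasurableSpace.induction_on_inter (m := predictable B P)
    (C := fun A _ => IsApprox B P z (A.indicator 1)) rfl isPiSystem_predictableRects
    ?_ ?_ ?_ ?_ A hA
  · rw [Set.indicator_empty]
    exact isApprox_zero z
  · rintro _ ⟨a, b, F, ha, hF, rfl⟩
    exact isApprox_hrect_prod ha hF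
  · intro A hA ih
    have h1 : IsApprox B P z ((hrect 0 z ×ˢ (Set.univ : Set Ω)).indicator 1) :=
      isApprox_hrect_prod le_rfl MeasurableSet.univ
    have hAm := mI (predictable_le hB A hA)
    refine ((h1.add hB (ih.const_mul (-1)) (mI ((measurableSet_hrect 0 z).prod .univ))
      (hAm.const_mul _))).congr ?_
    filter_upwards [ae_mem_hrect (P := P) z] with p hp
    by_cases h : p ∈ A <;> simp [Set.indicator, h, hp]
  · intro f hd hf ih
    have hfm (i : ℕ) := predictable_le hB _ (hf i)
    have hU : MeasurableSet (⋃ i, f i) := .iUnion hfm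
    refine IsApprox.of_approx hB (mI hU) fun ε hε => ?_
    let V : ℕ → Set ((ℝ × ℝ) × Ω) := fun n => ⋃ i ∈ Finset.range n, f i
    have hV (n : ℕ) : MeasurableSet (V n) := Finset.measurableSet_biUnion _ fun i _ => hfm i
    have hlim := tendsto_measure_iInter_atTop (μ := (volume.restrict (rect z)).prod P)
      (s := fun n => (⋃ i, f i) \ V n) (fun n => (hU.diff (hV n)).nullMeasurableSet)
      (fun m n hmn => Set.sdiff_subset_sdiff_right
        (Set.biUnion_subset_biUnion_left (by simpa using hmn)))
      ⟨0, measure_ne_top _ _⟩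
    have hempty : ⋂ n, (⋃ i, f i) \ V n = ∅ := by
      rw [Set.eq_empty_iff_forall_notMem]
      intro p hp
      rw [Set.mem_iInter] at hp
      obtain ⟨i, hi⟩ := Set.mem_iUnion.1 (hp 0).1
      exact (hp (i + 1)).2 (Set.mem_biUnion (Finset.mem_coe.2 (Finset.self_mem_range_succ i)) hi)
    rw [hempty, measure_empty] at hlim
    have hlim2 := (ENNReal.continuous_rpow_const (y := 1 / 2)).tendsto 0 |>.comp hlim
    rw [ENNReal.zero_rpow_of_pos (by norm_num)] at hlim2
    obtain ⟨n, hn⟩ := ((ENNReal.tendsto_nhds_zero.1 hlim2) ε hε).exists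
    refine ⟨(V n).indicator 1, ?_, mI (hV n), ?_⟩
    · have e : (V n).indicator (1 : (ℝ × ℝ) × Ω → ℝ)
          = ∑ i ∈ Finset.range n, (f i).indicator 1 := by
        funext p
        rw [Finset.sum_apply]
        exact Finset.indicator_biUnion_apply _ _ (fun i _ j _ hij => hd hij) p
      rw [e]
      exact IsApprox.sum hB ih (fun i => mI (hfm i)) n
    · refine le_trans (le_of_eq ?_) hn
      rw [Function.comp_apply, Function.comp_apply]
      have := eLpNorm_indicator_const (μ := (volume.restrict (rect z)).prod P) (c := (1 : ℝ))
        (p := 2) (hU.diff (hV n)) (by norm_num) (by norm_num)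
      simp only [enorm_one, one_mul, ENNReal.toReal_ofNat] at this
      rw [← this]
      refine eLpNorm_congr_norm_ae (.of_forall fun p => ?_)
      have hsub : V n ⊆ ⋃ i, f i := Set.iUnion₂_subset fun i _ => Set.subset_iUnion f i
      by_cases h : p ∈ V n
      · have h' := hsub h
        rw [Set.indicator_of_mem h, Set.indicator_of_mem h',
          Set.indicator_of_notMem (fun hh => hh.2 h)]
        simp
      · by_cases h' : p ∈ ⋃ i, f i
        · rw [Set.indicator_of_notMem h, Set.indicator_of_mem h',
            Set.indicator_of_mem (s := (⋃ i, f i) \ V n) ⟨h', h⟩]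
          simp
        · rw [Set.indicator_of_notMem h, Set.indicator_of_notMem h',
            Set.indicator_of_notMem (fun hh => h' hh.1)]
          simp

/-- Square integrable predictable processes are Itô integrable. -/
theorem isItoIntegrable_of_predictable (hB : IsBrownianSheet B P) {z : ℝ × ℝ}
    {φ : ℝ × ℝ → Ω → ℝ}
    (hφ : MemLp (fun p : (ℝ × ℝ) × Ω => φ p.1 p.2) 2 ((volume.restrict (rect z)).prod P))
    (hφm : AEStronglyMeasurable[predictable B P] (fun p : (ℝ × ℝ) × Ω => φ p.1 p.2)
      ((volume.restrict (rect z)).prod P)) : IsItoIntegrable B P φ z := by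
  refine IsApprox.isItoIntegrable hφ ?_
  refine MemLp.induction_stronglyMeasurable (predictable_le hB) (by norm_num)
    (fun f => IsApprox B P z f) ?_ ?_ ?_ ?_ hφ hφm
  · intro c s hs _
    have := (isApprox_indicator hB z hs).const_mul c
    convert this using 1
    funext p
    by_cases h : p ∈ s <;> simp [h]
  · intro f g _ hf hg _ _ h1 h2
    exact h1.add hB h2 hf.1 hg.1
  · refine isClosed_of_closure_subset fun f hf => ?_
    refine IsApprox.of_approx hB (Lp.aestronglyMeasurable _) fun ε hε => ?_
    obtain ⟨g, hg, hfg⟩ := EMetric.mem_closure_iff.1 hf ε hε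
    refine ⟨g, hg, Lp.aestronglyMeasurable _, ?_⟩
    rw [edist_comm, Subtype.edist_eq, Lp.edist_def] at hfg
    exact hfg.le
  · intro f g hfg _ h
    exact h.congr hfg

end Predictable

/-! ### Predictable versions of adapted processes -/

section Version

/-- The open quadrant. -/
def openQuadrant : Set (ℝ × ℝ) := {ζ | 0 < ζ.1 ∧ 0 < ζ.2}

/-- The index of the cell `(h k, h (k + 1)]` of the grid of mesh `h` that contains a point in the
positive quadrant; a zero coordinate gets the index `0`. -/
noncomputable def cell (h : ℝ) (ζ : ℝ × ℝ) : ℕ × ℕ := (⌈ζ.1 / h⌉₊ - 1, ⌈ζ.2 / h⌉₊ - 1)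

/-- The lower corner of a cell. -/
def corner (h : ℝ) (k : ℕ × ℕ) : ℝ × ℝ := (h * k.1, h * k.2)

theorem corner_nonneg {h : ℝ} (hh : 0 < h) (k : ℕ × ℕ) : 0 ≤ corner h k :=
  ⟨mul_nonneg hh.le (Nat.cast_nonneg _), mul_nonneg hh.le (Nat.cast_nonneg _)⟩

theorem measurable_cell (h : ℝ) : Measurable (cell h) := by
  have m1 : Measurable fun ζ : ℝ × ℝ => ⌈ζ.1 / h⌉₊ - 1 :=
    (measurable_from_top (f := fun n : ℕ => n - 1)).comp
      (Nat.measurable_ceil.comp (measurable_fst.div_const h))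
  have m2 : Measurable fun ζ : ℝ × ℝ => ⌈ζ.2 / h⌉₊ - 1 :=
    (measurable_from_top (f := fun n : ℕ => n - 1)).comp
      (Nat.measurable_ceil.comp (measurable_snd.div_const h))
  exact m1.prodMk m2

theorem mul_ceil_sub_one_le {h t : ℝ} (hh : 0 < h) (ht : 0 ≤ t) :
    h * ((⌈t / h⌉₊ - 1 : ℕ) : ℝ) ≤ t ∧ t ≤ h * ((⌈t / h⌉₊ - 1 : ℕ) : ℝ) + h := by
  have h1 : (⌈t / h⌉₊ : ℝ) < t / h + 1 := Nat.ceil_lt_add_one (div_nonneg ht hh.le)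
  have h2 : t / h ≤ ⌈t / h⌉₊ := Nat.le_ceil _
  have h3 : h * (t / h) = t := mul_div_cancel₀ t hh.ne'
  rcases Nat.eq_zero_or_pos ⌈t / h⌉₊ with h0 | h0
  · rw [h0] at h2 ⊢
    simp only [Nat.cast_zero, zero_tsub, mul_zero, zero_add] at h2 ⊢
    have : t ≤ 0 := by nlinarith
    exact ⟨ht, this.trans hh.le⟩
  · rw [Nat.cast_sub h0, Nat.cast_one]
    constructor <;> nlinarith

theorem corner_cell_le {h : ℝ} (hh : 0 < h) {ζ : ℝ × ℝ} (hζ : 0 ≤ ζ) : corner h (cell h ζ) ≤ ζ :=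
  ⟨(mul_ceil_sub_one_le hh hζ.1).1, (mul_ceil_sub_one_le hh hζ.2).1⟩

theorem dist_corner_cell_le {h : ℝ} (hh : 0 < h) {ζ : ℝ × ℝ} (hζ : 0 ≤ ζ) :
    dist (corner h (cell h ζ)) ζ ≤ h := by
  have h1 := mul_ceil_sub_one_le hh hζ.1
  have h2 := mul_ceil_sub_one_le hh hζ.2
  rw [Prod.dist_eq, max_le_iff, Real.dist_eq, Real.dist_eq, abs_le, abs_le]
  simp only [corner, cell]
  refine ⟨⟨?_, ?_⟩, ?_, ?_⟩ <;> linarith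

theorem ceil_sub_one_eq_iff {h t : ℝ} (hh : 0 < h) (ht : 0 < t) (k : ℕ) :
    ⌈t / h⌉₊ - 1 = k ↔ t ∈ Set.Ioc (h * k) (h * ((k + 1 : ℕ) : ℝ)) := by
  have hpos : 0 < ⌈t / h⌉₊ := Nat.ceil_pos.2 (div_pos ht hh)
  have e : ⌈t / h⌉₊ - 1 = k ↔ ⌈t / h⌉₊ = k + 1 := by omega
  rw [e, Nat.ceil_eq_iff (Nat.succ_ne_zero k), Set.mem_Ioc, Nat.succ_eq_add_one, Nat.add_sub_cancel,
    lt_div_iff₀ hh,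
    div_le_iff₀ hh, mul_comm (k : ℝ), mul_comm ((k + 1 : ℕ) : ℝ)]

theorem mem_openQuadrant_and_cell_eq_iff {h : ℝ} (hh : 0 < h) (ζ : ℝ × ℝ) (k : ℕ × ℕ) :
    (ζ ∈ openQuadrant ∧ cell h ζ = k)
      ↔ ζ ∈ hrect (corner h k) (corner h (k.1 + 1, k.2 + 1)) := by
  constructor
  · rintro ⟨hζ, rfl⟩
    exact ⟨(ceil_sub_one_eq_iff hh hζ.1 _).1 rfl, (ceil_sub_one_eq_iff hh hζ.2 _).1 rfl⟩
  · rintro ⟨h1, h2⟩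
    have hk := corner_nonneg hh k
    have p1 : 0 < ζ.1 := hk.1.trans_lt h1.1
    have p2 : 0 < ζ.2 := hk.2.trans_lt h2.1
    exact ⟨⟨p1, p2⟩, Prod.ext ((ceil_sub_one_eq_iff hh p1 _).2 h1)
      ((ceil_sub_one_eq_iff hh p2 _).2 h2)⟩

theorem measurable_limUnder {α : Type*} {m : MeasurableSpace α} {f : ℕ → α → ℝ}
    (hf : ∀ n, Measurable (f n)) : Measurable (fun x => limUnder atTop (fun n => f n x)) :=
  (StronglyMeasurable.limUnder fun n => (hf n).stronglyMeasurable).measurable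

variable {Ω : Type*} [MeasurableSpace Ω] {B : ℝ × ℝ → Ω → ℝ} {P : Measure Ω}

theorem measurable_step {E : Type*} [MeasurableSpace E] {h : ℝ} {R : ℕ × ℕ → Ω → E}
    (hR : ∀ k, Measurable (R k)) :
    Measurable (fun p : (ℝ × ℝ) × Ω => R (cell h p.1) p.2) := by
  have : Measurable (fun q : (ℕ × ℕ) × Ω => R q.1 q.2) := measurable_from_prod_countable_right hR
  exact this.comp (((measurable_cell h).comp measurable_fst).prodMk measurable_snd)

open Classical in
/-- Step processes are predictable on the open quadrant. -/
theorem measurable_predictable_step {E : Type*} [MeasurableSpace E] [Zero E] {h : ℝ} (hh : 0 < h)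
    {R : ℕ × ℕ → Ω → E} (hR : ∀ k, Measurable[sheetFiltration B P (corner h k)] (R k)) :
    Measurable[predictable B P]
      (fun p : (ℝ × ℝ) × Ω => if p.1 ∈ openQuadrant then R (cell h p.1) p.2 else 0) := by
  have hc (k : ℕ × ℕ) (F : Set Ω) (hF : MeasurableSet[sheetFiltration B P (corner h k)] F) :
      MeasurableSet[predictable B P]
        (hrect (corner h k) (corner h (k.1 + 1, k.2 + 1)) ×ˢ F) :=
    MeasurableSpace.measurableSet_generateFrom ⟨_, _, F, corner_nonneg hh k, hF, rfl⟩
  have hQ : MeasurableSet[predictable B P]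
      {p : (ℝ × ℝ) × Ω | p.1 ∈ openQuadrant} := by
    have e : {p : (ℝ × ℝ) × Ω | p.1 ∈ openQuadrant} = ⋃ k : ℕ × ℕ,
        hrect (corner h k) (corner h (k.1 + 1, k.2 + 1)) ×ˢ (Set.univ : Set Ω) := by
      ext p
      simp only [Set.mem_ofPred_eq, Set.mem_iUnion, Set.mem_prod, Set.mem_univ, and_true,
        ← mem_openQuadrant_and_cell_eq_iff hh]
      simp
    rw [e]
    exact MeasurableSet.iUnion fun k => hc k _ MeasurableSet.univ
  intro A hA
  have e : (fun p : (ℝ × ℝ) × Ω => if p.1 ∈ openQuadrant then R (cell h p.1) p.2 else 0) ⁻¹' A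
      = (⋃ k : ℕ × ℕ, hrect (corner h k) (corner h (k.1 + 1, k.2 + 1)) ×ˢ (R k ⁻¹' A))
        ∪ ({p : (ℝ × ℝ) × Ω | p.1 ∈ openQuadrant}ᶜ ∩ {_p | (0 : E) ∈ A}) := by
    ext p
    simp only [Set.mem_preimage, Set.mem_union, Set.mem_iUnion, Set.mem_prod, Set.mem_inter_iff,
      Set.mem_compl_iff, Set.mem_ofPred_eq, ← mem_openQuadrant_and_cell_eq_iff hh]
    by_cases hp : p.1 ∈ openQuadrant <;> simp [hp]
  rw [e]
  exact MeasurableSet.union (MeasurableSet.iUnion fun k => hc k _ (hR k hA))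
    (MeasurableSet.inter hQ.compl (MeasurableSet.const _))

open Classical in
/-- The coordinate of the parameter is predictable on the open quadrant. -/
theorem measurable_predictable_fst : Measurable[predictable B P]
    (fun p : (ℝ × ℝ) × Ω => if p.1 ∈ openQuadrant then p.1 else 0) := by
  have hh (n : ℕ) : (0 : ℝ) < 1 / ((n : ℝ) + 1) := by positivity
  refine @measurable_of_tendsto_metrizable _ _ (predictable B P) _ _ _ _
    (fun n p => if p.1 ∈ openQuadrant then corner (1 / ((n : ℝ) + 1))
      (cell (1 / ((n : ℝ) + 1)) p.1) else 0) _
    (fun n => measurable_predictable_step (hh n)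
      (R := fun k _ => corner (1 / ((n : ℝ) + 1)) k) fun k => measurable_const) ?_
  rw [tendsto_pi_nhds]
  intro p
  split_ifs with hp
  · rw [tendsto_iff_dist_tendsto_zero]
    exact squeeze_zero (fun _ => dist_nonneg)
      (fun n => dist_corner_cell_le (hh n) ⟨hp.1.le, hp.2.le⟩)
      tendsto_one_div_add_atTop_nhds_zero_nat
  · exact tendsto_const_nhds

variable [P.IsComplete] [IsProbabilityMeasure P]

open Classical in
/-- An adapted process that is continuous in `L²(Ω)` has an adapted, jointly measurable version
which is predictable on the open quadrant: the limit of fast step approximations, whose value on a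
cell is the value of the process at the lower corner. -/
theorem exists_version (hB : IsBrownianSheet B P) {z : ℝ × ℝ} {Y : ℝ × ℝ → Ω → ℝ}
    (hYm : ∀ w ∈ rect z, AEStronglyMeasurable[sheetFiltration B P w] (Y w) P)
    (hYc : ∀ ε : ℝ≥0∞, 0 < ε → ∃ δ > (0 : ℝ), ∀ w ∈ rect z, ∀ v ∈ rect z, dist w v < δ →
      eLpNorm (fun ω => Y w ω - Y v ω) 2 P ≤ ε) :
    ∃ X : ℝ × ℝ → Ω → ℝ, Measurable (fun p : (ℝ × ℝ) × Ω => X p.1 p.2) ∧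
      (∀ w ∈ rect z, Measurable[sheetFiltration B P w] (X w)) ∧
      (∀ w ∈ rect z, X w =ᵐ[P] Y w) ∧
      Measurable[predictable B P]
        (fun p : (ℝ × ℝ) × Ω => if p.1 ∈ openQuadrant then X p.1 p.2 else 0) := by
  -- Grids on which the step approximations are within `2⁻ⁿ` in `L²`, so that they converge almost
  -- surely at every point.
  choose δ hδ hYδ using fun n : ℕ => hYc ((1 / 2) ^ n)
    (ENNReal.pow_pos (by simp) n)
  let h : ℕ → ℝ := fun n => δ n / 2
  have hh (n : ℕ) : 0 < h n := half_pos (hδ n)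
  have hrep (w : ℝ × ℝ) : ∃ r : Ω → ℝ, Measurable[sheetFiltration B P w] r ∧
      (w ∈ rect z → r =ᵐ[P] Y w) := by
    by_cases hw : w ∈ rect z
    · exact ⟨(hYm w hw).mk _, (hYm w hw).stronglyMeasurable_mk.measurable,
        fun _ => (hYm w hw).ae_eq_mk.symm⟩
    · exact ⟨0, measurable_const, fun h => absurd h hw⟩
  choose r hrm hrY using hrep
  let X' : ℕ → ℝ × ℝ → Ω → ℝ := fun n ζ ω => r (corner (h n) (cell (h n) ζ)) ω
  have hX'm (n : ℕ) : Measurable (fun p : (ℝ × ℝ) × Ω => X' n p.1 p.2) :=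
    measurable_step (R := fun k => r (corner (h n) k))
      fun k => (hrm _).mono (sheetFiltration_le hB _) le_rfl
  have hmem (n : ℕ) {w : ℝ × ℝ} (hw : w ∈ rect z) : corner (h n) (cell (h n) w) ∈ rect z :=
    ⟨corner_nonneg (hh n) _, (corner_cell_le (hh n) hw.1).trans hw.2⟩
  have hX'Y (n : ℕ) {w : ℝ × ℝ} (hw : w ∈ rect z) :
      eLpNorm (fun ω => X' n w ω - Y w ω) 2 P ≤ (1 / 2) ^ n := by
    refine le_of_eq_of_le (eLpNorm_congr_ae ?_) (hYδ n _ (hmem n hw) w hw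
      ((dist_corner_cell_le (hh n) hw.1).trans_lt (half_lt_self (hδ n))))
    filter_upwards [hrY _ (hmem n hw)] with ω hω
    simp only [X', hω]
  have hconv {w : ℝ × ℝ} (hw : w ∈ rect z) :
      ∀ᵐ ω ∂P, Tendsto (fun n => X' n w ω) atTop (𝓝 (Y w ω)) := by
    have hYw : AEStronglyMeasurable (Y w) P := (hYm w hw).mono (sheetFiltration_le hB w)
    have hXw (n : ℕ) : AEStronglyMeasurable (X' n w) P :=
      ((hX'm n).comp (measurable_const.prodMk measurable_id)).aestronglyMeasurable
    have hsum : ∫⁻ ω, ∑' n, ‖X' n w ω - Y w ω‖ₑ ∂P ≠ ∞ := by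
      rw [lintegral_tsum (f := fun n ω => ‖X' n w ω - Y w ω‖ₑ) fun n => ((hXw n).sub hYw).enorm]
      have hle (n : ℕ) : ∫⁻ ω, ‖X' n w ω - Y w ω‖ₑ ∂P ≤ (1 / 2) ^ n := by
        rw [← eLpNorm_one_eq_lintegral_enorm]
        exact (eLpNorm_le_eLpNorm_of_exponent_le (by norm_num) ((hXw n).sub hYw)).trans
          (hX'Y n hw)
      refine ((ENNReal.tsum_le_tsum hle).trans_lt ?_).ne
      rw [ENNReal.tsum_geometric]
      simp
    filter_upwards [ae_lt_top' (AEMeasurable.tsum fun n => ((hXw n).sub hYw).enorm) hsum]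
      with ω hω
    rw [tendsto_iff_edist_tendsto_0]
    simp only [edist_eq_enorm_sub]
    exact ENNReal.tendsto_atTop_zero_of_tsum_ne_top hω.ne
  refine ⟨fun ζ ω => limUnder atTop (fun n => X' n ζ ω), ?_, ?_, ?_, ?_⟩
  · exact measurable_limUnder hX'm
  · intro w hw
    have hm (n : ℕ) : Measurable[sheetFiltration B P w] (X' n w) :=
      (hrm _).mono (sheetFiltration_mono (corner_cell_le (hh n) hw.1)) le_rfl
    exact measurable_limUnder hm
  · intro w hw
    filter_upwards [hconv hw] with ω hω
    exact hω.limUnder_eq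
  · have hm (n : ℕ) := measurable_predictable_step (B := B) (P := P) (hh n)
      (R := fun k => r (corner (h n) k)) fun k => hrm _
    convert measurable_limUnder hm using 1
    funext p
    by_cases hp : p.1 ∈ openQuadrant
    · simp [hp, X']
    · simp only [hp, if_false]
      exact tendsto_const_nhds.limUnder_eq.symm

end Version

/-! ### Laws in the space of measures -/

section Law

theorem fourier_sub (μ ν : SignedMeasure ℝ) (y : ℝ) :
    fourier (μ - ν) y = fourier μ y - fourier ν y := by
  have h : μ - ν = μ + (-1 : ℝ) • ν := by
    ext A _
    simp [sub_eq_add_neg]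
  rw [h, fourier_add, fourier_smul, neg_one_smul, sub_eq_add_neg]

theorem norm_exp_I_sub_le (a b : ℝ) :
    ‖Complex.exp (-(Complex.I * a)) - Complex.exp (-(Complex.I * b))‖ ≤ |a - b| := by
  have e : Complex.exp (-(Complex.I * a)) - Complex.exp (-(Complex.I * b))
      = Complex.exp (-(Complex.I * b)) * (Complex.exp (Complex.I * ((b - a : ℝ) : ℂ)) - 1) := by
    rw [mul_sub, ← Complex.exp_add, mul_one]
    congr 2
    push_cast
    ring
  have h1 : ‖Complex.exp (-(Complex.I * b))‖ = 1 := by simp [Complex.norm_exp]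
  rw [e, norm_mul, h1, one_mul, abs_sub_comm]
  exact Real.norm_exp_I_mul_ofReal_sub_one_le

theorem lintegral_sq_weight_lt_top : ∫⁻ y : ℝ, ‖y‖ₑ ^ 2 ∂weight < ∞ := by
  rw [weight, lintegral_withDensity_eq_lintegral_mul _ (by fun_prop) (by fun_prop)]
  have h := integrable_rpow_mul_exp_neg_mul_sq (b := 1) one_pos (s := 2) (by norm_num)
  refine lt_of_eq_of_lt (lintegral_congr fun y => ?_) h.2
  simp only [Pi.mul_apply, enorm_mul]
  rw [Real.rpow_ofNat, enorm_pow, mul_comm, Real.enorm_eq_ofReal (Real.exp_pos _).le]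
  simp

/-- The Lipschitz constant of the law as a function of the random variable in `L²`. -/
noncomputable def lawConst : ℝ≥0∞ := (∫⁻ y : ℝ, ‖y‖ₑ ^ 2 ∂weight) ^ (1 / 2 : ℝ)

theorem lawConst_ne_top : lawConst ≠ ∞ :=
  (ENNReal.rpow_lt_top_of_nonneg (by norm_num) lintegral_sq_weight_lt_top.ne).ne

variable {Ω : Type*} [MeasurableSpace Ω] {P : Measure Ω} [IsProbabilityMeasure P]

theorem norm_toMSpace_sub_sq (μ ν : Measure ℝ) [IsFiniteMeasure μ] [IsFiniteMeasure ν] :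
    ‖toMSpace P μ - toMSpace P ν‖ ^ 2
      = ∫ y, ‖fourier μ.toSignedMeasure y - fourier ν.toSignedMeasure y‖ ^ 2 ∂weight := by
  rw [toMSpace, toMSpace, ← UniformSpace.Completion.coe_sub, UniformSpace.Completion.norm_coe,
    RandomMeasure.norm_sq]
  have e (ω : Ω) (y : ℝ) : (constMeasure P μ - constMeasure P ν).hat ω y
      = fourier μ.toSignedMeasure y - fourier ν.toSignedMeasure y := fourier_sub _ _ _
  simp [e]

theorem enorm_toMSpace_sub_sq_le (μ ν : Measure ℝ) [IsFiniteMeasure μ] [IsFiniteMeasure ν] :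
    ‖toMSpace P μ - toMSpace P ν‖ₑ ^ 2
      ≤ ∫⁻ y, ‖fourier μ.toSignedMeasure y - fourier ν.toSignedMeasure y‖ₑ ^ 2 ∂weight := by
  have h : ‖toMSpace P μ - toMSpace P ν‖ₑ ^ 2 = ‖(‖toMSpace P μ - toMSpace P ν‖ ^ 2 : ℝ)‖ₑ := by
    rw [enorm_pow, enorm_norm]
  rw [h, norm_toMSpace_sub_sq]
  refine (enorm_integral_le_lintegral_enorm _).trans (le_of_eq ?_)
  simp only [enorm_pow, enorm_norm]

/-- The law of a random variable depends on it in a Lipschitz way, from `L²` to `𝕄`. -/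
theorem enorm_law_sub_le {X X' : Ω → ℝ} (hX : AEMeasurable X P) (hX' : AEMeasurable X' P) :
    ‖law P X - law P X'‖ₑ ≤ lawConst * eLpNorm (fun ω => X ω - X' ω) 2 P := by
  refine le_rpow_half_mul_of_sq_le ((enorm_toMSpace_sub_sq_le _ _).trans ?_)
  have hbd (X : Ω → ℝ) (hX : AEMeasurable X P) (y : ℝ) : MeasureTheory.Integrable
      (fun ω => Complex.exp (-(Complex.I * X ω * y))) P := by
    refine MeasureTheory.Integrable.of_bound (C := 1) ?_ (.of_forall fun ω => by
      simp [Complex.norm_exp])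
    have hc : Continuous fun x : ℝ => Complex.exp (-(Complex.I * x * y)) := by fun_prop
    exact (hc.measurable.comp_aemeasurable hX).aestronglyMeasurable
  have hF (X : Ω → ℝ) (hX : AEMeasurable X P) (y : ℝ) : fourier (P.map X).toSignedMeasure y
      = ∫ ω, Complex.exp (-(Complex.I * X ω * y)) ∂P := by
    rw [fourier_toSignedMeasure, integral_map hX]
    have hc : Continuous fun x : ℝ => Complex.exp (-(Complex.I * x * y)) := by fun_prop
    exact hc.aestronglyMeasurable
  have key (y : ℝ) : ‖fourier (P.map X).toSignedMeasure y
      - fourier (P.map X').toSignedMeasure y‖ₑ ≤ ‖y‖ₑ * eLpNorm (fun ω => X ω - X' ω) 2 P := by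
    rw [hF X hX, hF X' hX', ← integral_sub (hbd X hX y) (hbd X' hX' y)]
    calc _ ≤ ∫⁻ ω, ‖Complex.exp (-(Complex.I * X ω * y))
          - Complex.exp (-(Complex.I * X' ω * y))‖ₑ ∂P := enorm_integral_le_lintegral_enorm _
      _ ≤ ∫⁻ ω, ‖y‖ₑ * ‖X ω - X' ω‖ₑ ∂P := by
          refine lintegral_mono fun ω => ?_
          rw [← enorm_mul, enorm_le_iff_norm_le]
          have := norm_exp_I_sub_le (X ω * y) (X' ω * y)
          push_cast at this
          rw [← mul_assoc, ← mul_assoc] at this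
          refine this.trans (le_of_eq ?_)
          rw [Real.norm_eq_abs]
          congr 1
          ring
      _ = ‖y‖ₑ * eLpNorm (fun ω => X ω - X' ω) 1 P := by
          rw [lintegral_const_mul' _ _ (by simp), eLpNorm_one_eq_lintegral_enorm]
      _ ≤ _ := mul_le_mul_right (eLpNorm_le_eLpNorm_of_exponent_le (by norm_num)
          (hX.sub hX').aestronglyMeasurable) _
  calc _ ≤ ∫⁻ y : ℝ, ‖y‖ₑ ^ 2 * eLpNorm (fun ω => X ω - X' ω) 2 P ^ 2 ∂weight := by
        refine lintegral_mono fun y => ?_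
        rw [← mul_pow]
        exact pow_le_pow_left' (key y) 2
    _ = _ := by
        rw [lintegral_mul_const _ (by fun_prop)]

/-- Any two probability laws have bounded distance. -/
theorem exists_enorm_toMSpace_sub_le : ∃ N : ℝ≥0∞, N ≠ ∞ ∧ ∀ (μ ν : Measure ℝ)
    [IsProbabilityMeasure μ] [IsProbabilityMeasure ν],
    ‖toMSpace P μ - toMSpace P ν‖ₑ ≤ N := by
  refine ⟨weight Set.univ ^ (1 / 2 : ℝ) * 2, ENNReal.mul_ne_top
    (ENNReal.rpow_lt_top_of_nonneg (by norm_num) (measure_ne_top _ _)).ne (by norm_num), ?_⟩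
  intro μ ν _ _
  refine le_rpow_half_mul_of_sq_le ((enorm_toMSpace_sub_sq_le _ _).trans ?_)
  have h1 (μ : Measure ℝ) [IsProbabilityMeasure μ] (y : ℝ) :
      ‖fourier μ.toSignedMeasure y‖ ≤ 1 := by
    rw [fourier_toSignedMeasure]
    refine (norm_integral_le_integral_norm _).trans (le_of_eq ?_)
    simp [Complex.norm_exp]
  calc _ ≤ ∫⁻ _y : ℝ, 2 ^ 2 ∂weight := by
        refine lintegral_mono fun y => pow_le_pow_left' ?_ 2
        rw [← ofReal_norm, ← ENNReal.ofReal_ofNat 2]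
        refine ENNReal.ofReal_le_ofReal ((norm_sub_le _ _).trans ?_)
        linarith [h1 μ y, h1 ν y]
    _ = _ := by
        rw [lintegral_const, mul_comm]

end Law

/-! ### Coefficients along regular processes -/

section Coefficient

variable {Ω : Type*} [MeasurableSpace Ω] {B : ℝ × ℝ → Ω → ℝ} {P : Measure Ω}
  [IsProbabilityMeasure P]

variable (P) in
/-- The Lipschitz condition for one coefficient. -/
def IsLip (T C : ℝ) (f : ℝ × ℝ → ℝ → MSpace P → ℝ) : Prop :=
  ∀ z ∈ rect (T, T), ∀ (u u' : ℝ) (μ μ' : MSpace P),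
    |f z u μ - f z u' μ'| ≤ C * (|u - u'| + ‖μ - μ'‖)

theorem IsLip.enorm_sub_le {T C : ℝ} {f : ℝ × ℝ → ℝ → MSpace P → ℝ} (hf : IsLip P T C f)
    {z : ℝ × ℝ} (hz : z ∈ rect (T, T)) (u u' : ℝ) (μ μ' : MSpace P) :
    ‖f z u μ - f z u' μ'‖ₑ ≤ ENNReal.ofReal C * (‖u - u'‖ₑ + ‖μ - μ'‖ₑ) := by
  have h := hf z hz u u' μ μ'
  rw [← ofReal_norm, ← ofReal_norm, ← ofReal_norm, ← ENNReal.ofReal_add (norm_nonneg _)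
    (norm_nonneg _), ← ENNReal.ofReal_mul' (add_nonneg (norm_nonneg _) (norm_nonneg _))]
  exact ENNReal.ofReal_le_ofReal h

/-- A coefficient frozen along a continuous flow of measures. Continuity matters: `𝕄` need not be
separable, so that the Borel `σ`-algebra of the product may exceed the product `σ`-algebra. -/
theorem IsAdmissible.measurable_comp {T : ℝ} {f : ℝ × ℝ → ℝ → MSpace P → ℝ}
    (hf : IsAdmissible T f) {m : ℝ × ℝ → MSpace P} (hm : ContinuousOn m (rect (T, T))) :
    Measurable (fun q : rect (T, T) × ℝ => f q.1 q.2 (m q.1)) := by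
  have hc : Continuous (fun q : rect (T, T) × ℝ => (q.1, q.2, m q.1)) :=
    continuous_fst.prodMk (continuous_snd.prodMk
      ((continuousOn_iff_continuous_domRestrict.1 hm).comp continuous_fst))
  let _ : MeasurableSpace (rect (T, T) × ℝ × MSpace P) := borel _
  have : BorelSpace (rect (T, T) × ℝ × MSpace P) := ⟨rfl⟩
  exact hf.measurable.comp hc.measurable

open Classical in
/-- A coefficient frozen along a continuous flow of measures, extended by zero. -/
theorem IsAdmissible.measurable_extend {T : ℝ} {f : ℝ × ℝ → ℝ → MSpace P → ℝ}
    (hf : IsAdmissible T f) {m : ℝ × ℝ → MSpace P} (hm : ContinuousOn m (rect (T, T))) :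
    Measurable (fun q : (ℝ × ℝ) × ℝ => if q.1 ∈ rect (T, T) then f q.1 q.2 (m q.1) else 0) := by
  have hs : MeasurableSet {q : (ℝ × ℝ) × ℝ | q.1 ∈ rect (T, T)} :=
    measurable_fst (measurableSet_rect _)
  refine measurable_of_restrict_of_restrict_compl hs ?_ ?_
  · have h1 : Measurable (fun q : {q : (ℝ × ℝ) × ℝ | q.1 ∈ rect (T, T)} =>
        ((⟨q.1.1, q.2⟩, q.1.2) : rect (T, T) × ℝ)) :=
      (Measurable.subtype_mk (measurable_fst.comp measurable_subtype_coe)).prodMk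
        (measurable_snd.comp measurable_subtype_coe)
    convert (hf.measurable_comp hm).comp h1 using 1
    funext q
    have hq : q.1.1 ∈ rect (T, T) := q.2
    simp [hq]
  · convert measurable_const (a := (0 : ℝ)) using 1
    funext q
    have hq : q.1.1 ∉ rect (T, T) := q.2
    simp [hq]

variable (B P) in
open Classical in
/-- Processes that are adapted, measurable, predictable on the open quadrant, and continuous and
bounded in `L²(Ω)` on `R_z`. -/
structure IsRegular (z : ℝ × ℝ) (X : ℝ × ℝ → Ω → ℝ) : Prop where
  measurable : Measurable (fun p : (ℝ × ℝ) × Ω => X p.1 p.2)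
  adapted : ∀ w ∈ rect z, Measurable[sheetFiltration B P w] (X w)
  predictable : Measurable[predictable B P]
    (fun p : (ℝ × ℝ) × Ω => if p.1 ∈ openQuadrant then X p.1 p.2 else 0)
  bounded : ∃ M : ℝ≥0∞, M ≠ ∞ ∧ ∀ w ∈ rect z, eLpNorm (X w) 2 P ≤ M
  tendsto : ∀ v ∈ rect z,
    Tendsto (fun w => eLpNorm (fun ω => X w ω - X v ω) 2 P) (𝓝[rect z] v) (𝓝 0)

omit [IsProbabilityMeasure P] in
theorem IsRegular.measurable_apply {z : ℝ × ℝ} {X : ℝ × ℝ → Ω → ℝ} (hX : IsRegular B P z X)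
    (w : ℝ × ℝ) : Measurable (X w) :=
  hX.measurable.comp (measurable_const.prodMk measurable_id)

theorem IsRegular.continuousOn_law {z : ℝ × ℝ} {X : ℝ × ℝ → Ω → ℝ} (hX : IsRegular B P z X) :
    ContinuousOn (fun w => law P (X w)) (rect z) := by
  intro v hv
  rw [ContinuousWithinAt, tendsto_iff_edist_tendsto_0]
  have hlim := ENNReal.Tendsto.const_mul (a := lawConst) (hX.tendsto v hv)
    (.inr lawConst_ne_top)
  rw [mul_zero] at hlim
  refine tendsto_of_tendsto_of_tendsto_of_le_of_le tendsto_const_nhds hlim (fun _ => zero_le)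
    fun w => ?_
  simp only [edist_eq_enorm_sub]
  exact enorm_law_sub_le (hX.measurable_apply w).aemeasurable (hX.measurable_apply v).aemeasurable

theorem IsRegular.memLp {z : ℝ × ℝ} {X : ℝ × ℝ → Ω → ℝ} (hX : IsRegular B P z X) :
    MemLp (fun p : (ℝ × ℝ) × Ω => X p.1 p.2) 2 ((volume.restrict (rect z)).prod P) := by
  refine ⟨hX.measurable.aestronglyMeasurable, ?_⟩
  obtain ⟨M, hM, hXM⟩ := hX.bounded
  have h : eLpNorm (fun p : (ℝ × ℝ) × Ω => X p.1 p.2) 2 ((volume.restrict (rect z)).prod P) ^ 2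
      < ∞ := by
    rw [sq_eLpNorm_prod hX.measurable.aestronglyMeasurable]
    refine (setLIntegral_mono' (measurableSet_rect z)
      fun ζ hζ => pow_le_pow_left' (hXM ζ hζ) 2).trans_lt ?_
    rw [setLIntegral_const]
    exact ENNReal.mul_lt_top (ENNReal.pow_lt_top hM.lt_top) (volume_rect_lt_top z)
  exact (ENNReal.pow_lt_top_iff.1 h).resolve_right (by norm_num)

omit [IsProbabilityMeasure P] in
theorem ae_mem_rect (z : ℝ × ℝ) :
    ∀ᵐ p ∂(volume.restrict (rect z)).prod P, p.1 ∈ rect z :=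
  Measure.quasiMeasurePreserving_fst.ae (ae_restrict_mem (measurableSet_rect z))

theorem IsAdmissible.aestronglyMeasurable_comp {T : ℝ} {f : ℝ × ℝ → ℝ → MSpace P → ℝ}
    (hf : IsAdmissible T f) {m : ℝ × ℝ → MSpace P} (hm : ContinuousOn m (rect (T, T)))
    {X : ℝ × ℝ → Ω → ℝ} (hX : Measurable (fun p : (ℝ × ℝ) × Ω => X p.1 p.2)) :
    AEStronglyMeasurable (fun p : (ℝ × ℝ) × Ω => f p.1 (X p.1 p.2) (m p.1))
      ((volume.restrict (rect (T, T))).prod P) := by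
  classical
  have h := (hf.measurable_extend hm).comp (measurable_fst.prodMk hX)
  refine h.aestronglyMeasurable.congr ?_
  filter_upwards [ae_mem_rect (P := P) (T, T)] with p hp
  simp [hp]

theorem IsAdmissible.aestronglyMeasurable_section {T : ℝ} {f : ℝ × ℝ → ℝ → MSpace P → ℝ}
    (hf : IsAdmissible T f) (u : ℝ) (μ : MSpace P) :
    AEStronglyMeasurable (fun ζ : ℝ × ℝ => f ζ u μ) (volume.restrict (rect (T, T))) := by
  classical
  have h := (hf.measurable_extend (m := fun _ => μ)
    continuousOn_const).comp (measurable_id.prodMk (measurable_const (a := u)))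
  refine h.aestronglyMeasurable.congr ?_
  filter_upwards [ae_restrict_mem (measurableSet_rect (T, T))] with ζ hζ
  simp [hζ]

theorem IsAdmissible.integrableOn_sq {T : ℝ} {f : ℝ × ℝ → ℝ → MSpace P → ℝ}
    (hf : IsAdmissible T f) {u : ℝ} {μ : MSpace P} {g : ℝ × ℝ → ℝ}
    (hg : IntegrableOn g (rect (T, T))) (hfg : ∀ ζ, f ζ u μ ^ 2 ≤ g ζ) :
    IntegrableOn (fun ζ => f ζ u μ ^ 2) (rect (T, T)) := by
  refine Integrable.mono' hg ((hf.aestronglyMeasurable_section u μ).pow 2)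
    (.of_forall fun ζ => ?_)
  rw [Real.norm_of_nonneg (sq_nonneg _)]
  exact hfg ζ

/-- Square integrability of a coefficient along a square integrable process. -/
theorem memLp_comp {T C : ℝ} {f : ℝ × ℝ → ℝ → MSpace P → ℝ}
    (hf : IsAdmissible T f) (hL : IsLip P T C f)
    (h0 : IntegrableOn (fun ζ => f ζ 0 (toMSpace P (Measure.dirac 0)) ^ 2) (rect (T, T)))
    {X : ℝ × ℝ → Ω → ℝ} (hX : IsRegular B P (T, T) X) :
    MemLp (fun p : (ℝ × ℝ) × Ω => f p.1 (X p.1 p.2) (law P (X p.1))) 2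
      ((volume.restrict (rect (T, T))).prod P) := by
  obtain ⟨N, hN, hlaw⟩ := exists_enorm_toMSpace_sub_le (P := P)
  have m0 : AEStronglyMeasurable (fun p : (ℝ × ℝ) × Ω => f p.1 0 (toMSpace P (Measure.dirac 0)))
      ((volume.restrict (rect (T, T))).prod P) :=
    hf.aestronglyMeasurable_comp continuousOn_const (X := fun _ _ => 0) measurable_const
  have m0' : AEStronglyMeasurable (fun ζ : ℝ × ℝ => f ζ 0 (toMSpace P (Measure.dirac 0)))
      (volume.restrict (rect (T, T))) := hf.aestronglyMeasurable_section 0 _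
  have l0 : MemLp (fun p : (ℝ × ℝ) × Ω => f p.1 0 (toMSpace P (Measure.dirac 0))) 2
      ((volume.restrict (rect (T, T))).prod P) :=
    ((memLp_two_iff_integrable_sq m0').2 h0).comp_fst P
  have m1 := (hf.aestronglyMeasurable_comp hX.continuousOn_law hX.measurable).sub m0
  have l1 : MemLp ((fun p : (ℝ × ℝ) × Ω => f p.1 (X p.1 p.2) (law P (X p.1)))
      - fun p => f p.1 0 (toMSpace P (Measure.dirac 0))) 2
      ((volume.restrict (rect (T, T))).prod P) := by
    have hg : MemLp (fun p : (ℝ × ℝ) × Ω => ‖X p.1 p.2‖ + N.toReal) 2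
        ((volume.restrict (rect (T, T))).prod P) := hX.memLp.norm.add (memLp_const _)
    refine hg.of_le_mul (c := |C|) m1 ?_
    filter_upwards [ae_mem_rect (P := P) (T, T)] with p hp
    have hprob : IsProbabilityMeasure (P.map (X p.1)) :=
      Measure.isProbabilityMeasure_map (hX.measurable_apply p.1).aemeasurable
    have hN' : ‖law P (X p.1) - toMSpace P (Measure.dirac 0)‖ ≤ N.toReal := by
      have := hlaw (P.map (X p.1)) (Measure.dirac 0)
      rw [← toReal_enorm]
      exact ENNReal.toReal_mono hN this
    have hnn : (0 : ℝ) ≤ N.toReal := ENNReal.toReal_nonneg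
    rw [Pi.sub_apply, Real.norm_of_nonneg (add_nonneg (norm_nonneg _) hnn)]
    refine (hL p.1 hp _ _ _ _).trans ?_
    rw [sub_zero]
    exact mul_le_mul (le_abs_self C) (add_le_add le_rfl hN') (by positivity) (abs_nonneg _)
  have := l1.add l0
  rwa [sub_add_cancel] at this

variable [P.IsComplete]

/-- A coefficient along a regular process is predictable up to a null set, as the flow of laws is
continuous in `𝕄`. -/
theorem isItoIntegrable_comp (hB : IsBrownianSheet B P) {T C : ℝ}
    {f : ℝ × ℝ → ℝ → MSpace P → ℝ} (hf : IsAdmissible T f) (hL : IsLip P T C f)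
    (h0 : IntegrableOn (fun ζ => f ζ 0 (toMSpace P (Measure.dirac 0)) ^ 2) (rect (T, T)))
    {X : ℝ × ℝ → Ω → ℝ} (hX : IsRegular B P (T, T) X) :
    IsItoIntegrable B P (fun ζ ω => f ζ (X ζ ω) (law P (X ζ))) (T, T) := by
  classical
  refine isItoIntegrable_of_predictable hB (memLp_comp hf hL h0 hX) ?_
  have hpair : Measurable[predictable B P] (fun p : (ℝ × ℝ) × Ω =>
      ((if p.1 ∈ openQuadrant then p.1 else 0), if p.1 ∈ openQuadrant then X p.1 p.2 else 0)) :=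
    Measurable.prodMk measurable_predictable_fst hX.predictable
  have h : Measurable[predictable B P] _ := (hf.measurable_extend hX.continuousOn_law).comp hpair
  refine ⟨_, h.stronglyMeasurable, ?_⟩
  filter_upwards [ae_mem_rect (P := P) (T, T), ae_mem_hrect (P := P) (T, T)] with p hp hp'
  have hQ : p.1 ∈ openQuadrant := ⟨hp'.1.1, hp'.2.1⟩
  simp [hp, hQ]

end Coefficient

/-! ### The two-parameter Grönwall inequality and the Picard estimate -/

section Gronwall

/-- The exponential weight `e^{l (t + x)}`. -/
noncomputable def expWeight (l : ℝ) (ζ : ℝ × ℝ) : ℝ≥0∞ :=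
  ENNReal.ofReal (Real.exp (l * ζ.1)) * ENNReal.ofReal (Real.exp (l * ζ.2))

theorem expWeight_ne_top (l : ℝ) (ζ : ℝ × ℝ) : expWeight l ζ ≠ ∞ :=
  ENNReal.mul_ne_top ENNReal.ofReal_ne_top ENNReal.ofReal_ne_top

theorem expWeight_ne_zero (l : ℝ) (ζ : ℝ × ℝ) : expWeight l ζ ≠ 0 :=
  mul_ne_zero (ENNReal.ofReal_pos.2 (Real.exp_pos _)).ne'
    (ENNReal.ofReal_pos.2 (Real.exp_pos _)).ne'

theorem expWeight_mono {l : ℝ} (hl : 0 ≤ l) {ζ w : ℝ × ℝ} (h : ζ ≤ w) :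
    expWeight l ζ ≤ expWeight l w :=
  mul_le_mul' (ENNReal.ofReal_le_ofReal (Real.exp_le_exp.2 (mul_le_mul_of_nonneg_left h.1 hl)))
    (ENNReal.ofReal_le_ofReal (Real.exp_le_exp.2 (mul_le_mul_of_nonneg_left h.2 hl)))

theorem one_le_expWeight {l : ℝ} (hl : 0 ≤ l) {ζ : ℝ × ℝ} (h : 0 ≤ ζ) : 1 ≤ expWeight l ζ := by
  have := expWeight_mono hl h
  simpa [expWeight] using this

theorem measurable_expWeight (l : ℝ) : Measurable (expWeight l) := by
  unfold expWeight
  fun_prop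

/-- The weight is contracted by integration over `R_w`. -/
theorem lintegral_expWeight_le {l : ℝ} (hl : 0 < l) (w : ℝ × ℝ) :
    ∫⁻ ζ in rect w, expWeight l ζ ≤ expWeight l w / ENNReal.ofReal l ^ 2 := by
  have h1 (a : ℝ) : ∫⁻ t in Set.Icc 0 a, ENNReal.ofReal (Real.exp (l * t))
      ≤ ENNReal.ofReal (Real.exp (l * a)) / ENNReal.ofReal l := by
    calc _ ≤ ∫⁻ t in Set.Iic a, ENNReal.ofReal (Real.exp (l * t)) :=
          lintegral_mono_set Set.Icc_subset_Iic_self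
      _ = ENNReal.ofReal (∫ t in Set.Iic a, Real.exp (l * t)) :=
          (ofReal_integral_eq_lintegral_ofReal (integrableOn_exp_mul_Iic hl a)
            (.of_forall fun t => (Real.exp_pos _).le)).symm
      _ = _ := by rw [integral_exp_mul_Iic hl, ENNReal.ofReal_div_of_pos hl]
  have e : rect w = Set.Icc 0 w.1 ×ˢ Set.Icc 0 w.2 := Set.Icc_prod_eq 0 w
  rw [e, Measure.volume_eq_prod, ← Measure.prod_restrict]
  unfold expWeight
  rw [lintegral_prod_mul (f := fun t => ENNReal.ofReal (Real.exp (l * t)))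
    (g := fun t => ENNReal.ofReal (Real.exp (l * t))) (by fun_prop) (by fun_prop)]
  refine (mul_le_mul' (h1 _) (h1 _)).trans (le_of_eq ?_)
  rw [sq, div_eq_mul_inv, div_eq_mul_inv, div_eq_mul_inv, ENNReal.mul_inv (by simp [hl]) (by simp)]
  ring

/-- A rate for which the weighted integral operator has norm at most `1 / (4 L)`. -/
theorem exists_rate {L : ℝ≥0∞} (hL : L ≠ ∞) : ∃ l : ℝ, 0 < l ∧
    4 * L ≤ ENNReal.ofReal l ^ 2 := by
  refine ⟨4 * L.toReal + 1, by positivity, ?_⟩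
  rw [← ENNReal.ofReal_pow (by positivity)]
  calc 4 * L = ENNReal.ofReal (4 * L.toReal) := by
        rw [ENNReal.ofReal_mul (by norm_num), ENNReal.ofReal_toReal hL]
        simp
    _ ≤ _ := ENNReal.ofReal_le_ofReal (by nlinarith [ENNReal.toReal_nonneg (a := L)])

theorem mul_div_rate_le {L m W : ℝ≥0∞} {l : ℝ} (hl : 0 < l) (h : 4 * L ≤ ENNReal.ofReal l ^ 2) :
    L * (m * (W / ENNReal.ofReal l ^ 2)) ≤ m / 4 * W := by
  have h1 : L / ENNReal.ofReal l ^ 2 ≤ 1 / 4 := by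
    rw [ENNReal.div_le_iff (by simp [hl]) (by finiteness)]
    calc L = 1 / 4 * (4 * L) := by
          rw [← mul_assoc, one_div, ENNReal.inv_mul_cancel (by norm_num) (by norm_num), one_mul]
      _ ≤ _ := mul_le_mul_right h _
  calc L * (m * (W / ENNReal.ofReal l ^ 2)) = (L / ENNReal.ofReal l ^ 2) * (m * W) := by
        simp only [div_eq_mul_inv]
        ring
    _ ≤ 1 / 4 * (m * W) := mul_le_mul_left h1 _
    _ = m / 4 * W := by
        simp only [div_eq_mul_inv]
        ring

/-- Grönwall's inequality in two parameters, for bounded functions. -/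
theorem exists_gronwall {L : ℝ≥0∞} (hL : L ≠ ∞) (z : ℝ × ℝ) : ∃ Γ : ℝ≥0∞, Γ ≠ ∞ ∧
    ∀ (u : ℝ × ℝ → ℝ≥0∞) (M c : ℝ≥0∞), M ≠ ∞ → (∀ w ∈ rect z, u w ≤ M) →
      (∀ w ∈ rect z, u w ≤ c + L * ∫⁻ ζ in rect w, u ζ) → ∀ w ∈ rect z, u w ≤ Γ * c := by
  obtain ⟨l, hl, hlL⟩ := exists_rate hL
  refine ⟨2 * expWeight l z, ENNReal.mul_ne_top (by norm_num) (expWeight_ne_top _ _), ?_⟩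
  intro u M c hM huM hu w hw
  -- The supremum of `u` relative to the weight; it is finite because `u` is bounded, and satisfies
  -- `m ≤ c + m / 4`.
  let m : ℝ≥0∞ := ⨆ w ∈ rect z, u w / expWeight l w
  have hm_top : m ≠ ∞ := by
    refine (lt_of_le_of_lt (iSup₂_le fun w hw => ?_) hM.lt_top).ne
    exact ENNReal.div_le_of_le_mul ((huM w hw).trans
      (le_mul_of_one_le_right' (one_le_expWeight hl.le hw.1)))
  have hum : ∀ w ∈ rect z, u w ≤ m * expWeight l w := fun w hw =>
    (ENNReal.div_le_iff (expWeight_ne_zero _ _) (expWeight_ne_top _ _)).1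
      (le_iSup₂ (f := fun w (_ : w ∈ rect z) => u w / expWeight l w) w hw)
  have hstep : ∀ w ∈ rect z, u w ≤ (c + m / 4) * expWeight l w := by
    intro w hw
    calc u w ≤ c + L * ∫⁻ ζ in rect w, u ζ := hu w hw
      _ ≤ c + L * ∫⁻ ζ in rect w, m * expWeight l ζ := by
          refine add_le_add le_rfl (mul_le_mul' le_rfl ?_)
          exact setLIntegral_mono' (measurableSet_rect w) fun ζ hζ => hum ζ (rect_subset hw hζ)
      _ ≤ c + L * (m * (expWeight l w / ENNReal.ofReal l ^ 2)) := by
          rw [lintegral_const_mul _ (measurable_expWeight l)]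
          gcongr
          exact lintegral_expWeight_le hl w
      _ ≤ c * expWeight l w + m / 4 * expWeight l w :=
          add_le_add (le_mul_of_one_le_right' (one_le_expWeight hl.le hw.1))
            (mul_div_rate_le hl hlL)
      _ = _ := by ring
  have hmc : m ≤ c + m / 4 := iSup₂_le fun w hw => ENNReal.div_le_of_le_mul (hstep w hw)
  have hm2 : m ≤ 2 * c := by
    rcases eq_or_ne c ∞ with rfl | hc
    · simp
    · lift m to NNReal using hm_top with m'
      lift c to NNReal using hc
      have e : ((m' : ℝ≥0∞) / 4) = ((m' / 4 : NNReal) : ℝ≥0∞) := by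
        rw [ENNReal.coe_div (by norm_num)]
        rfl
      rw [e] at hmc
      have h1 : m' ≤ c + m' / 4 := by exact_mod_cast hmc
      have h2 : m' ≤ 2 * c := by
        rw [← NNReal.coe_le_coe] at h1 ⊢
        push_cast at h1 ⊢
        have := m'.2
        have hc0 := c.2
        linarith [NNReal.coe_nonneg m', NNReal.coe_nonneg c]
      exact_mod_cast h2
  calc u w ≤ m * expWeight l w := hum w hw
    _ ≤ 2 * c * expWeight l z := mul_le_mul' hm2 (expWeight_mono hl.le hw.2)
    _ = _ := by ring

end Gronwall

section Estimate

theorem add_sq_le_four (a b : ℝ≥0∞) : (a + b) ^ 2 ≤ 4 * (a ^ 2 + b ^ 2) := by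
  calc (a + b) ^ 2 ≤ (2 * max a b) ^ 2 := by
        refine pow_le_pow_left' ?_ 2
        rw [two_mul]
        exact add_le_add (le_max_left _ _) (le_max_right _ _)
    _ = 4 * (max a b) ^ 2 := by ring
    _ ≤ 4 * (a ^ 2 + b ^ 2) := by
        gcongr
        rcases max_choice a b with h | h <;> rw [h]
        · exact le_self_add
        · exact le_add_self

variable {Ω : Type*} [MeasurableSpace Ω] {B : ℝ × ℝ → Ω → ℝ} {P : Measure Ω}
  [IsProbabilityMeasure P]

theorem lintegral_add_sq_le {Q : Measure Ω} (hQ : Q Set.univ ≤ 1) (C : ℝ≥0∞) (D : Ω → ℝ)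
    (hD : AEMeasurable D Q) (k : ℝ≥0∞) :
    ∫⁻ ω, (C * (‖D ω‖ₑ + k)) ^ 2 ∂Q ≤ 4 * C ^ 2 * (∫⁻ ω, ‖D ω‖ₑ ^ 2 ∂Q + k ^ 2) := by
  calc _ ≤ ∫⁻ ω, 4 * C ^ 2 * (‖D ω‖ₑ ^ 2 + k ^ 2) ∂Q := by
        refine lintegral_mono fun ω => ?_
        rw [mul_pow, mul_comm 4, mul_assoc]
        exact mul_le_mul_right (add_sq_le_four _ _) _
    _ = 4 * C ^ 2 * (∫⁻ ω, ‖D ω‖ₑ ^ 2 ∂Q + k ^ 2 * Q Set.univ) := by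
        rw [lintegral_const_mul'' (f := fun ω => ‖D ω‖ₑ ^ 2 + k ^ 2) _
            ((hD.enorm.pow_const 2).add aemeasurable_const),
          lintegral_add_right _ measurable_const, lintegral_const]
    _ ≤ _ := by
        gcongr
        exact mul_le_of_le_one_right' hQ

/-- The difference of two drifts, integrated against a part `Q` of the probability measure; `ℓ`
bounds the distance of the laws. -/
theorem lintegral_drift_sub_le {T C : ℝ} {α : ℝ × ℝ → ℝ → MSpace P → ℝ} (hL : IsLip P T C α)
    {Q : Measure Ω} [IsFiniteMeasure Q] (hQ : Q Set.univ ≤ 1) {z : ℝ × ℝ}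
    (hz : z ∈ rect (T, T)) {X X' : ℝ × ℝ → Ω → ℝ}
    (hD : AEMeasurable (fun p : (ℝ × ℝ) × Ω => X p.1 p.2 - X' p.1 p.2)
      ((volume.restrict (rect z)).prod Q))
    {ℓ : ℝ × ℝ → ℝ≥0∞} (hℓm : AEMeasurable ℓ (volume.restrict (rect z)))
    (hℓ : ∀ ζ ∈ rect z, ‖law P (X ζ) - law P (X' ζ)‖ₑ ≤ ℓ ζ) {G : Ω → ℝ}
    (hi : ∀ᵐ ω ∂Q, IntegrableOn (fun ζ => α ζ (X ζ ω) (law P (X ζ))) (rect z))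
    (hi' : ∀ᵐ ω ∂Q, IntegrableOn (fun ζ => α ζ (X' ζ ω) (law P (X' ζ))) (rect z))
    (hG : ∀ᵐ ω ∂Q, G ω = (∫ ζ in rect z, α ζ (X ζ ω) (law P (X ζ)))
      - ∫ ζ in rect z, α ζ (X' ζ ω) (law P (X' ζ))) :
    ∫⁻ ω, ‖G ω‖ₑ ^ 2 ∂Q ≤ volume (rect (T, T)) * (4 * ENNReal.ofReal C ^ 2 *
      ∫⁻ ζ in rect z, (∫⁻ ω, ‖X ζ ω - X' ζ ω‖ₑ ^ 2 ∂Q + ℓ ζ ^ 2)) := by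
  have hfm : AEMeasurable (fun p : (ℝ × ℝ) × Ω =>
      ENNReal.ofReal C * (‖X p.1 p.2 - X' p.1 p.2‖ₑ + ℓ p.1)) ((volume.restrict (rect z)).prod Q) :=
    (hD.enorm.add (hℓm.comp_quasiMeasurePreserving Measure.quasiMeasurePreserving_fst)).const_mul _
  have hDζ : ∀ᵐ ζ ∂(volume.restrict (rect z)), AEMeasurable (fun ω => X ζ ω - X' ζ ω) Q := by
    filter_upwards [hD.aestronglyMeasurable.prodMk_left] with ζ hζ
    exact hζ.aemeasurable
  calc ∫⁻ ω, ‖G ω‖ₑ ^ 2 ∂Q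
      ≤ ∫⁻ ω, (∫⁻ ζ in rect z, ENNReal.ofReal C * (‖X ζ ω - X' ζ ω‖ₑ + ℓ ζ)) ^ 2 ∂Q := by
        refine lintegral_mono_ae ?_
        filter_upwards [hi, hi', hG] with ω h h' hω
        rw [hω, ← integral_sub h h']
        refine pow_le_pow_left' ((enorm_integral_le_lintegral_enorm _).trans ?_) 2
        refine setLIntegral_mono' (measurableSet_rect z) fun ζ hζ => ?_
        refine (hL.enorm_sub_le (rect_subset hz hζ) _ _ _ _).trans ?_
        gcongr
        exact hℓ ζ hζ
    _ ≤ volume (rect z) * ∫⁻ ζ in rect z,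
          (∫⁻ ω, (ENNReal.ofReal C * (‖X ζ ω - X' ζ ω‖ₑ + ℓ ζ)) ^ 2 ∂Q) :=
        lintegral_sq_lintegral_le hfm
    _ ≤ volume (rect (T, T)) * ∫⁻ ζ in rect z,
          4 * ENNReal.ofReal C ^ 2 * (∫⁻ ω, ‖X ζ ω - X' ζ ω‖ₑ ^ 2 ∂Q + ℓ ζ ^ 2) := by
        refine mul_le_mul' (measure_mono (rect_subset hz)) (lintegral_mono_ae ?_)
        filter_upwards [hDζ] with ζ hζ
        exact lintegral_add_sq_le hQ _ _ hζ _
    _ = _ := by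
        rw [lintegral_const_mul' _ _ (by finiteness)]

/-- The constant of the Picard estimate. -/
noncomputable def picardConst (T C : ℝ) : ℝ≥0∞ :=
  4 * ((volume (rect (T, T)) + 1) * (4 * ENNReal.ofReal C ^ 2 * (1 + lawConst ^ 2)))

theorem picardConst_ne_top (T C : ℝ) : picardConst T C ≠ ∞ := by
  have h1 := lawConst_ne_top
  have h2 := (volume_rect_lt_top (T, T)).ne
  unfold picardConst
  finiteness

variable [P.IsComplete]

/-- The Picard estimate: the distance of two outputs of the integral equation at `z` is controlled
by the distances of the inputs on `R_z`. -/
theorem sq_eLpNorm_output_sub_le (hB : IsBrownianSheet B P) {T C : ℝ}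
    {α β : ℝ × ℝ → ℝ → MSpace P → ℝ} (hα : IsLip P T C α) (hβ : IsLip P T C β) {z : ℝ × ℝ}
    (hz : z ∈ rect (T, T)) {X X' : ℝ × ℝ → Ω → ℝ}
    (hX : AEMeasurable (fun p : (ℝ × ℝ) × Ω => X p.1 p.2) ((volume.restrict (rect z)).prod P))
    (hX' : AEMeasurable (fun p : (ℝ × ℝ) × Ω => X' p.1 p.2) ((volume.restrict (rect z)).prod P))
    (hXζ : ∀ ζ ∈ rect z, AEMeasurable (X ζ) P) (hXζ' : ∀ ζ ∈ rect z, AEMeasurable (X' ζ) P)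
    (hi : ∀ᵐ ω ∂P, IntegrableOn (fun ζ => α ζ (X ζ ω) (law P (X ζ))) (rect z))
    (hi' : ∀ᵐ ω ∂P, IntegrableOn (fun ζ => α ζ (X' ζ ω) (law P (X' ζ))) (rect z))
    {y : ℝ} {Y Y' I I' : Ω → ℝ} (hYm : AEStronglyMeasurable Y P)
    (hYm' : AEStronglyMeasurable Y' P)
    (hI : IsItoIntegral B P (fun ζ ω => β ζ (X ζ ω) (law P (X ζ))) z I)
    (hI' : IsItoIntegral B P (fun ζ ω => β ζ (X' ζ ω) (law P (X' ζ))) z I')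
    (hY : ∀ᵐ ω ∂P, Y ω = y + (∫ ζ in rect z, α ζ (X ζ ω) (law P (X ζ))) + I ω)
    (hY' : ∀ᵐ ω ∂P, Y' ω = y + (∫ ζ in rect z, α ζ (X' ζ ω) (law P (X' ζ))) + I' ω) :
    eLpNorm (fun ω => Y ω - Y' ω) 2 P ^ 2 ≤ picardConst T C *
      ∫⁻ ζ in rect z, eLpNorm (fun ω => X ζ ω - X' ζ ω) 2 P ^ 2 := by
  have hD := hX.sub hX'
  let e : ℝ × ℝ → ℝ≥0∞ := fun ζ => eLpNorm (fun ω => X ζ ω - X' ζ ω) 2 P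
  have heq (ζ : ℝ × ℝ) : e ζ ^ 2 = ∫⁻ ω, ‖X ζ ω - X' ζ ω‖ₑ ^ 2 ∂P := eLpNorm_two_sq _
  have hem : AEMeasurable e (volume.restrict (rect z)) := by
    have h2 : AEMeasurable (fun ζ => ∫⁻ ω, ‖X ζ ω - X' ζ ω‖ₑ ^ 2 ∂P)
        (volume.restrict (rect z)) := (hD.enorm.pow_const 2).lintegral_prod_right'
    have h3 : e = fun ζ => (∫⁻ ω, ‖X ζ ω - X' ζ ω‖ₑ ^ 2 ∂P) ^ (1 / 2 : ℝ) := by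
      funext ζ
      rw [← heq, ← ENNReal.rpow_natCast, ← ENNReal.rpow_mul]
      norm_num
    rw [h3]
    exact h2.pow_const _
  have hlaw : ∀ ζ ∈ rect z, ‖law P (X ζ) - law P (X' ζ)‖ₑ ≤ lawConst * e ζ :=
    fun ζ hζ => enorm_law_sub_le (hXζ ζ hζ) (hXζ' ζ hζ)
  have hsum (ζ : ℝ × ℝ) : ∫⁻ ω, ‖X ζ ω - X' ζ ω‖ₑ ^ 2 ∂P + (lawConst * e ζ) ^ 2
      = (1 + lawConst ^ 2) * e ζ ^ 2 := by
    rw [← heq, mul_pow]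
    ring
  have hconst : (1 + lawConst ^ 2) ≠ ∞ := by
    have := lawConst_ne_top
    finiteness
  -- The difference of the drifts, up to a null set.
  let G : Ω → ℝ := fun ω => (Y ω - Y' ω) - (I ω - I' ω)
  have hGm : AEStronglyMeasurable G P := (hYm.sub hYm').sub (hI.2.1.1.sub hI'.2.1.1)
  have hG : eLpNorm G 2 P ^ 2 ≤ volume (rect (T, T)) * (4 * ENNReal.ofReal C ^ 2 *
      ((1 + lawConst ^ 2) * ∫⁻ ζ in rect z, e ζ ^ 2)) := by
    rw [eLpNorm_two_sq]
    refine (lintegral_drift_sub_le hα (by simp) hz hD (hem.const_mul lawConst) hlaw hi hi'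
      (G := G) ?_).trans (le_of_eq ?_)
    · filter_upwards [hY, hY'] with ω h h'
      simp only [G, h, h']
      ring
    · simp only [hsum]
      rw [lintegral_const_mul' _ _ hconst]
  have hII : eLpNorm (fun ω => I ω - I' ω) 2 P ^ 2 ≤ 4 * ENNReal.ofReal C ^ 2 *
      ((1 + lawConst ^ 2) * ∫⁻ ζ in rect z, e ζ ^ 2) := by
    refine (pow_le_pow_left' (hI.eLpNorm_sub_le hB hz.1 hI') 2).trans ?_
    rw [sq_eLpNorm_prod (φ := fun p => β p.1 (X p.1 p.2) (law P (X p.1))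
      - β p.1 (X' p.1 p.2) (law P (X' p.1))) (hI.1.1.sub hI'.1.1),
      ← lintegral_const_mul' _ _ hconst, ← lintegral_const_mul' _ _ (by finiteness)]
    refine setLIntegral_mono' (measurableSet_rect z) fun ζ hζ => ?_
    rw [eLpNorm_two_sq, ← hsum]
    refine le_trans (lintegral_mono fun ω => pow_le_pow_left'
      ((hβ.enorm_sub_le (rect_subset hz hζ) _ _ _ _).trans ?_) 2)
      (lintegral_add_sq_le (by simp) _ _ ((hXζ ζ hζ).sub (hXζ' ζ hζ)) _)
    exact mul_le_mul_right (add_le_add le_rfl (hlaw ζ hζ)) _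
  have hsplit : (fun ω => Y ω - Y' ω) = G + fun ω => I ω - I' ω := by
    funext ω
    simp [G]
  rw [hsplit]
  refine (pow_le_pow_left' (eLpNorm_add_le hGm (hI.2.1.1.sub hI'.2.1.1) (by norm_num)) 2).trans
    ((add_sq_le_four _ _).trans ?_)
  refine (mul_le_mul_right (add_le_add hG hII) _).trans (le_of_eq ?_)
  unfold picardConst
  ring

end Estimate

/-! ### Adapted curves in `L²(Ω)` -/

section Existence

variable {Ω : Type*} [MeasurableSpace Ω] {B : ℝ × ℝ → Ω → ℝ} {P : Measure Ω}
  [IsProbabilityMeasure P]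

instance compactSpace_rect (z : ℝ × ℝ) : CompactSpace (rect z) :=
  isCompact_iff_compactSpace.1 isCompact_Icc

variable (B P) in
/-- The continuous curves in `L²(Ω)`, indexed by `R_z`, that are adapted to the sheet. -/
def adaptedCurves (z : ℝ × ℝ) : Set C(rect z, Lp ℝ 2 P) :=
  {V | ∀ w : rect z, AEStronglyMeasurable[sheetFiltration B P w] (V w) P}

omit [IsProbabilityMeasure P] in
theorem edist_Lp_eq (f g : Lp ℝ 2 P) : edist f g = eLpNorm (fun ω => f ω - g ω) 2 P :=
  Lp.edist_def f g

variable (B P) in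
/-- `Z` solves the integral equation with input `X` at every point of `R_z`. -/
def IsOutput (α β : ℝ × ℝ → ℝ → MSpace P → ℝ) (y : ℝ) (z : ℝ × ℝ) (X Z : ℝ × ℝ → Ω → ℝ) : Prop :=
  ∀ w ∈ rect z, ∃ I : Ω → ℝ,
    IsItoIntegral B P (fun ζ ω => β ζ (X ζ ω) (law P (X ζ))) w I ∧
    ∀ᵐ ω ∂P, Z w ω = y + (∫ ζ in rect w, α ζ (X ζ ω) (law P (X ζ))) + I ω

variable [P.IsComplete]

omit [IsProbabilityMeasure P] in
theorem isComplete_adaptedCurves (hB : IsBrownianSheet B P) (z : ℝ × ℝ) :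
    IsComplete (adaptedCurves B P z) := by
  refine IsClosed.isComplete ?_
  have : adaptedCurves B P z = ⋂ w : rect z,
      (fun V : C(rect z, Lp ℝ 2 P) => V w) ⁻¹'
        {f | AEStronglyMeasurable[sheetFiltration B P w] f P} := by
    ext V
    simp [adaptedCurves]
  rw [this]
  exact isClosed_iInter fun w =>
    (isClosed_aestronglyMeasurable (sheetFiltration_le hB w)).preimage (by fun_prop)

/-- An adapted curve in `L²(Ω)` is represented by a regular process. -/
theorem exists_isRegular (hB : IsBrownianSheet B P) {z : ℝ × ℝ} {V : C(rect z, Lp ℝ 2 P)}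
    (hV : V ∈ adaptedCurves B P z) :
    ∃ X : ℝ × ℝ → Ω → ℝ, IsRegular B P z X ∧ ∀ w : rect z, X w =ᵐ[P] V w := by
  classical
  let Y : ℝ × ℝ → Ω → ℝ := fun w => if h : w ∈ rect z then V ⟨w, h⟩ else 0
  have hY (w : rect z) : Y w = V w := by simp [Y, w.2]
  have hYs {w v : ℝ × ℝ} (hw : w ∈ rect z) (hv : v ∈ rect z) :
      eLpNorm (fun ω => Y w ω - Y v ω) 2 P = edist (V ⟨w, hw⟩) (V ⟨v, hv⟩) := by
    rw [edist_Lp_eq, hY ⟨w, hw⟩, hY ⟨v, hv⟩]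
  have hYm : ∀ w ∈ rect z, AEStronglyMeasurable[sheetFiltration B P w] (Y w) P := by
    intro w hw
    rw [hY ⟨w, hw⟩]
    exact hV ⟨w, hw⟩
  have hYc : ∀ ε : ℝ≥0∞, 0 < ε → ∃ δ > (0 : ℝ), ∀ w ∈ rect z, ∀ v ∈ rect z, dist w v < δ →
      eLpNorm (fun ω => Y w ω - Y v ω) 2 P ≤ ε := by
    intro ε hε
    obtain ⟨e, he, heε⟩ := ENNReal.lt_iff_exists_nnreal_btwn.1 hε
    obtain ⟨δ, hδ, h⟩ := Metric.uniformContinuous_iff.1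
      (CompactSpace.uniformContinuous_of_continuous V.continuous) e (by exact_mod_cast he)
    refine ⟨δ, hδ, fun w hw v hv hd => ?_⟩
    rw [hYs hw hv]
    refine le_trans ?_ heε.le
    rw [edist_nndist, ENNReal.coe_le_coe]
    exact (h (a := ⟨w, hw⟩) (b := ⟨v, hv⟩) hd).le
  obtain ⟨X, hXm, hXa, hXY, hXp⟩ := exists_version hB hYm hYc
  have hXV (w : rect z) : X w =ᵐ[P] V w := by
    rw [← hY w]
    exact hXY w w.2
  have hXs {w v : ℝ × ℝ} (hw : w ∈ rect z) (hv : v ∈ rect z) :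
      eLpNorm (fun ω => X w ω - X v ω) 2 P = eLpNorm (fun ω => Y w ω - Y v ω) 2 P :=
    eLpNorm_congr_ae ((hXY w hw).sub (hXY v hv))
  refine ⟨X, ⟨hXm, hXa, hXp, ⟨‖V‖ₑ, by simp, fun w hw => ?_⟩, fun v hv => ?_⟩, hXV⟩
  · rw [eLpNorm_congr_ae (hXV ⟨w, hw⟩), ← Lp.enorm_def, enorm_le_iff_norm_le]
    exact V.norm_coe_le_norm ⟨w, hw⟩
  · rw [ENNReal.tendsto_nhds_zero]
    intro ε hε
    obtain ⟨δ, hδ, h⟩ := hYc ε hε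
    filter_upwards [self_mem_nhdsWithin, mem_nhdsWithin_of_mem_nhds (Metric.ball_mem_nhds v hδ)]
      with w hw hwv
    rw [hXs hw hv]
    exact h w hw v hv hwv

/-- The right-hand side of the integral equation along a regular process is an adapted curve in
`L²(Ω)`. -/
theorem exists_output (hB : IsBrownianSheet B P) {T C : ℝ}
    {α β : ℝ × ℝ → ℝ → MSpace P → ℝ} (hα : IsAdmissible T α) (hβ : IsAdmissible T β)
    (hLα : IsLip P T C α) (hLβ : IsLip P T C β)
    (h0α : IntegrableOn (fun ζ => α ζ 0 (toMSpace P (Measure.dirac 0)) ^ 2) (rect (T, T)))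
    (h0β : IntegrableOn (fun ζ => β ζ 0 (toMSpace P (Measure.dirac 0)) ^ 2) (rect (T, T)))
    (y : ℝ) {X : ℝ × ℝ → Ω → ℝ} (hX : IsRegular B P (T, T) X) :
    ∃ Z : ℝ × ℝ → Ω → ℝ, IsOutput B P α β y (T, T) X Z ∧
      ∃ V ∈ adaptedCurves B P (T, T), ∀ w : rect (T, T), Z w =ᵐ[P] V w := by
  set φ : (ℝ × ℝ) × Ω → ℝ := fun p => α p.1 (X p.1 p.2) (law P (X p.1)) with hφdef
  set ψ : ℝ × ℝ → Ω → ℝ := fun ζ ω => β ζ (X ζ ω) (law P (X ζ)) with hψdef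
  have hφ : MemLp φ 2 ((volume.restrict (rect (T, T))).prod P) := memLp_comp hα hLα h0α hX
  have hφI := isItoIntegrable_comp hB hα hLα h0α hX
  have hψI := isItoIntegrable_comp hB hβ hLβ h0β hX
  obtain ⟨I, hI, hIc⟩ := hψI.exists_integral hB
  let A : ℝ × ℝ → Ω → ℝ := fun w ω => ∫ ζ in rect w, φ (ζ, ω)
  let Z : ℝ × ℝ → Ω → ℝ := fun w ω => y + A w ω + I w ω
  have hA (w : rect (T, T)) : MemLp (A w) 2 P :=
    memLp_setIntegral (hφ.mono_measure (prod_restrict_mono (P := P) (rect_subset w.2)))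
  have hZ (w : rect (T, T)) : MemLp (Z w) 2 P :=
    ((memLp_const y).add (hA w)).add (hI w w.2).1.2.1
  let V₀ : rect (T, T) → Lp ℝ 2 P := fun w => (hZ w).toLp
  let S : ℝ × ℝ → ℝ × ℝ → Set (ℝ × ℝ) := fun w v => symmDiff (rect w) (rect v)
  -- The modulus of continuity of the curve, through the `L²`-mass of the coefficients on the
  -- symmetric difference of the rectangles.
  have hmod (w v : rect (T, T)) : edist (V₀ w) (V₀ v) ≤
      volume (rect (T, T)) ^ (1 / 2 : ℝ) * eLpNorm φ 2 ((volume.restrict (S w v)).prod P)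
        + eLpNorm (fun p : (ℝ × ℝ) × Ω => ψ p.1 p.2) 2 ((volume.restrict (S w v)).prod P) := by
    have hsub := symmDiff_rect_subset w.2 v.2
    have hAd : eLpNorm (A w - A v) 2 P ≤ volume (S w v) ^ (1 / 2 : ℝ) *
        eLpNorm φ 2 ((volume.restrict (S w v)).prod P) := by
      refine eLpNorm_lintegral_le (hφ.mono_measure (prod_restrict_mono (P := P) hsub)).1 ?_
      filter_upwards [ae_integrableOn_rect hφ] with ω hω
      exact enorm_integral_rect_sub_le hω w.2 v.2
    have he : Z w - Z v = (A w - A v) + (I w - I v) := by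
      funext ω
      simp only [Z, Pi.sub_apply, Pi.add_apply]
      ring
    rw [Lp.edist_toLp_toLp, he]
    refine (eLpNorm_add_le ((hA w).1.sub (hA v).1) ((hI w w.2).1.2.1.1.sub (hI v v.2).1.2.1.1)
      (by norm_num)).trans (add_le_add (hAd.trans ?_) (hIc w w.2 v v.2))
    exact mul_le_mul_left (ENNReal.rpow_le_rpow (measure_mono hsub) (by norm_num)) _
  have hcont {f : (ℝ × ℝ) × Ω → ℝ} (hf : MemLp f 2 ((volume.restrict (rect (T, T))).prod P))
      (v : rect (T, T)) : Tendsto (fun w : rect (T, T) =>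
        eLpNorm f 2 ((volume.restrict (S w v)).prod P)) (𝓝 v) (𝓝 0) := by
    have h1 : ∫⁻ ζ in rect (T, T), eLpNorm (fun ω => f (ζ, ω)) 2 P ^ 2 ≠ ∞ := by
      rw [← sq_eLpNorm_prod hf.1]
      exact ENNReal.pow_ne_top hf.2.ne
    have hs : Tendsto (fun w : rect (T, T) => (w : ℝ × ℝ)) (𝓝 v) (𝓝[rect (T, T)] v) :=
      tendsto_nhdsWithin_iff.2 ⟨continuous_subtype_val.tendsto v, .of_forall fun w => w.2⟩
    have h2 := (tendsto_lintegral_symmDiff_rect v.2 h1).comp hs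
    have h3 := (ENNReal.continuous_rpow_const (y := (1 / 2 : ℝ))).tendsto 0 |>.comp h2
    rw [ENNReal.zero_rpow_of_pos (by norm_num)] at h3
    refine h3.congr fun w => ?_
    simp only [Function.comp]
    rw [← sq_eLpNorm_prod (hf.1.mono_measure (prod_restrict_mono (P := P)
      (symmDiff_rect_subset w.2 v.2))), ← ENNReal.rpow_natCast, ← ENNReal.rpow_mul]
    norm_num [S]
  have hV₀ : Continuous V₀ := by
    refine continuous_iff_continuousAt.2 fun v => ?_
    rw [ContinuousAt, tendsto_iff_edist_tendsto_0]
    have hlim := (ENNReal.Tendsto.const_mul (a := volume (rect (T, T)) ^ (1 / 2 : ℝ))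
      (hcont hφ v) (.inr (ENNReal.rpow_lt_top_of_nonneg (by norm_num)
        (volume_rect_lt_top _).ne).ne)).add (hcont hψI.1 v)
    rw [mul_zero, add_zero] at hlim
    exact tendsto_of_tendsto_of_tendsto_of_le_of_le tendsto_const_nhds hlim
      (fun _ => zero_le) fun w => hmod w v
  refine ⟨Z, fun w hw => ⟨I w, (hI w hw).1, .of_forall fun ω => rfl⟩, ⟨V₀, hV₀⟩, fun w => ?_,
    fun w => (hZ w).coeFn_toLp.symm⟩
  refine AEStronglyMeasurable.congr ?_ (hZ w).coeFn_toLp.symm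
  exact (aestronglyMeasurable_const.add (hφI.aestronglyMeasurable_setIntegral hB w.2)).add
    (hI w w.2).2

end Existence

/-! ### Existence by the contraction principle -/

section FixedPoint

variable {Ω : Type*} [MeasurableSpace Ω] {B : ℝ × ℝ → Ω → ℝ} {P : Measure Ω}
  [IsProbabilityMeasure P]

theorem enorm_exp_half_sq (l : ℝ) (w : ℝ × ℝ) :
    ‖Real.exp (l * (w.1 + w.2) / 2)‖ₑ ^ 2 = expWeight l w := by
  rw [Real.enorm_eq_ofReal (Real.exp_pos _).le, ← ENNReal.ofReal_pow (Real.exp_pos _).le,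
    ← Real.exp_nat_mul, expWeight, ← ENNReal.ofReal_mul (Real.exp_pos _).le, ← Real.exp_add]
  congr 2
  push_cast
  ring

variable (B P) in
/-- The curve `V'` is the class in `L²(Ω)` of the right-hand side of the integral equation along a
regular process that represents the curve `V`. -/
def IsPicardStep (α β : ℝ × ℝ → ℝ → MSpace P → ℝ) (y : ℝ) (z : ℝ × ℝ)
    (V V' : C(rect z, Lp ℝ 2 P)) : Prop :=
  ∃ X Z : ℝ × ℝ → Ω → ℝ, IsRegular B P z X ∧ (∀ w : rect z, X w =ᵐ[P] V w) ∧
    IsOutput B P α β y z X Z ∧ ∀ w : rect z, Z w =ᵐ[P] V' w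

variable [P.IsComplete]

theorem IsPicardStep.edist_sq_le (hB : IsBrownianSheet B P) {T C : ℝ}
    {α β : ℝ × ℝ → ℝ → MSpace P → ℝ} (hα : IsAdmissible T α)
    (hLα : IsLip P T C α) (hLβ : IsLip P T C β)
    (h0α : IntegrableOn (fun ζ => α ζ 0 (toMSpace P (Measure.dirac 0)) ^ 2) (rect (T, T)))
    {y : ℝ} {V₁ V₁' V₂ V₂' : C(rect (T, T), Lp ℝ 2 P)}
    (h₁ : IsPicardStep B P α β y (T, T) V₁ V₁') (h₂ : IsPicardStep B P α β y (T, T) V₂ V₂')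
    {l : ℝ} (hl : 0 < l) (hlL : 4 * picardConst T C ≤ ENNReal.ofReal l ^ 2) {m : ℝ≥0∞}
    (hm : ∀ ζ : rect (T, T), edist (V₁ ζ) (V₂ ζ) ^ 2 ≤ m * expWeight l ζ) (w : rect (T, T)) :
    edist (V₁' w) (V₂' w) ^ 2 ≤ m / 4 * expWeight l w := by
  obtain ⟨X₁, Z₁, hX₁, hXV₁, hZ₁, hZV₁⟩ := h₁
  obtain ⟨X₂, Z₂, hX₂, hXV₂, hZ₂, hZV₂⟩ := h₂
  obtain ⟨I₁, hI₁, e₁⟩ := hZ₁ w w.2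
  obtain ⟨I₂, hI₂, e₂⟩ := hZ₂ w w.2
  have hsub : rect w ⊆ rect (T, T) := rect_subset w.2
  have hi {X : ℝ × ℝ → Ω → ℝ} (hX : IsRegular B P (T, T) X) :
      ∀ᵐ ω ∂P, IntegrableOn (fun ζ => α ζ (X ζ ω) (law P (X ζ))) (rect (w : ℝ × ℝ)) := by
    filter_upwards [ae_integrableOn_rect (memLp_comp hα hLα h0α hX)] with ω hω
    exact hω.mono_set hsub
  have hZV : edist (V₁' w) (V₂' w) = eLpNorm (fun ω => Z₁ w ω - Z₂ w ω) 2 P := by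
    rw [edist_Lp_eq]
    exact eLpNorm_congr_ae ((hZV₁ w).symm.sub (hZV₂ w).symm)
  rw [hZV]
  calc _ ≤ picardConst T C *
        ∫⁻ ζ in rect w, eLpNorm (fun ω => X₁ ζ ω - X₂ ζ ω) 2 P ^ 2 :=
        sq_eLpNorm_output_sub_le hB hLα hLβ w.2 hX₁.measurable.aemeasurable
          hX₂.measurable.aemeasurable (fun ζ _ => (hX₁.measurable_apply ζ).aemeasurable)
          (fun ζ _ => (hX₂.measurable_apply ζ).aemeasurable) (hi hX₁) (hi hX₂)
          ((Lp.aestronglyMeasurable _).congr (hZV₁ w).symm)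
          ((Lp.aestronglyMeasurable _).congr (hZV₂ w).symm) hI₁ hI₂ e₁ e₂
    _ ≤ picardConst T C * ∫⁻ ζ in rect w, m * expWeight l ζ := by
        refine mul_le_mul' le_rfl (setLIntegral_mono' (measurableSet_rect _) fun ζ hζ => ?_)
        refine le_trans (le_of_eq ?_) (hm ⟨ζ, hsub hζ⟩)
        rw [edist_Lp_eq]
        congr 1
        exact eLpNorm_congr_ae ((hXV₁ ⟨ζ, hsub hζ⟩).sub (hXV₂ ⟨ζ, hsub hζ⟩))
    _ ≤ picardConst T C * (m * (expWeight l w / ENNReal.ofReal l ^ 2)) := by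
        rw [lintegral_const_mul _ (measurable_expWeight l)]
        exact mul_le_mul' le_rfl (mul_le_mul' le_rfl (lintegral_expWeight_le hl w))
    _ ≤ _ := mul_div_rate_le hl hlL

/-- The strong solution is the fixed point of the Picard map; the map is a contraction once curves
are divided by the weight `e^{l (t + x) / 2}`. -/
theorem exists_isStrongSolution (hB : IsBrownianSheet B P) {T C : ℝ}
    {α β : ℝ × ℝ → ℝ → MSpace P → ℝ} (hα : IsAdmissible T α) (hβ : IsAdmissible T β)
    (hLα : IsLip P T C α) (hLβ : IsLip P T C β)
    (h0α : IntegrableOn (fun ζ => α ζ 0 (toMSpace P (Measure.dirac 0)) ^ 2) (rect (T, T)))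
    (h0β : IntegrableOn (fun ζ => β ζ 0 (toMSpace P (Measure.dirac 0)) ^ 2) (rect (T, T)))
    (y : ℝ) :
    ∃ Y : ℝ × ℝ → Ω → ℝ, IsRegular B P (T, T) Y ∧ IsStrongSolution B P α β y (T, T) Y := by
  classical
  obtain ⟨l, hl, hlL⟩ := exists_rate (picardConst_ne_top T C)
  let W : C(rect (T, T), ℝ) := ⟨fun w => Real.exp (l * (w.1.1 + w.1.2) / 2), by fun_prop⟩
  let W' : C(rect (T, T), ℝ) := ⟨fun w => (W w)⁻¹,
    W.continuous.inv₀ fun w => (Real.exp_pos _).ne'⟩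
  have hW0 (w : rect (T, T)) : W w ≠ 0 := (Real.exp_pos _).ne'
  have hWsq (w : rect (T, T)) : ‖W w‖ₑ ^ 2 = expWeight l w := enorm_exp_half_sq l w
  have hmem (U : C(rect (T, T), ℝ)) {V : C(rect (T, T), Lp ℝ 2 P)}
      (hV : V ∈ adaptedCurves B P (T, T)) : U • V ∈ adaptedCurves B P (T, T) := by
    intro w
    exact ((hV w).const_smul (U w)).congr (Lp.coeFn_smul (U w) (V w)).symm
  have hstep : ∀ V : C(rect (T, T), Lp ℝ 2 P), ∃ V' : C(rect (T, T), Lp ℝ 2 P),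
      V ∈ adaptedCurves B P (T, T) →
        V' ∈ adaptedCurves B P (T, T) ∧ IsPicardStep B P α β y (T, T) V V' := by
    intro V
    by_cases hV : V ∈ adaptedCurves B P (T, T)
    · obtain ⟨X, hX, hXV⟩ := exists_isRegular hB hV
      obtain ⟨Z, hZ, V', hV', hZV⟩ := exists_output hB hα hβ hLα hLβ h0α h0β y hX
      exact ⟨V', fun _ => ⟨hV', X, Z, hX, hXV, hZ, hZV⟩⟩
    · exact ⟨V, fun h => absurd h hV⟩
  choose Φ hΦ using hstep
  let Ψ : C(rect (T, T), Lp ℝ 2 P) → C(rect (T, T), Lp ℝ 2 P) := fun V => W' • Φ (W • V)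
  have hΨ : Set.MapsTo Ψ (adaptedCurves B P (T, T)) (adaptedCurves B P (T, T)) :=
    fun V hV => hmem W' (hΦ _ (hmem W hV)).1
  have hcontr : ContractingWith (1 / 2) (hΨ.restrict Ψ _ _) := by
    refine ⟨by norm_num, fun V₁ V₂ => ?_⟩
    have h₁ := (hΦ _ (hmem W V₁.2)).2
    have h₂ := (hΦ _ (hmem W V₂.2)).2
    have hin (ζ : rect (T, T)) : edist ((W • V₁.1) ζ) ((W • V₂.1) ζ) ^ 2
        ≤ edist V₁.1 V₂.1 ^ 2 * expWeight l ζ := by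
      rw [ContinuousMap.smul_apply', ContinuousMap.smul_apply', edist_smul₀, ENNReal.smul_def,
        smul_eq_mul, mul_pow, ← hWsq, mul_comm]
      refine mul_le_mul' (pow_le_pow_left' ?_ 2) le_rfl
      rw [edist_nndist, edist_nndist, ENNReal.coe_le_coe]
      exact ContinuousMap.dist_apply_le_dist ζ
    have hout := h₁.edist_sq_le hB hα hLα hLβ h0α h₂ hl hlL hin
    change edist (Ψ V₁.1) (Ψ V₂.1) ≤ _ * edist V₁.1 V₂.1
    rw [edist_nndist, edist_nndist, ← ENNReal.coe_mul, ENNReal.coe_le_coe, ← NNReal.coe_le_coe,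
      coe_nndist]
    refine (ContinuousMap.dist_le (NNReal.coe_nonneg _)).2 fun w => ?_
    rw [← coe_nndist, NNReal.coe_le_coe, ← ENNReal.coe_le_coe, ← edist_nndist, ENNReal.coe_mul,
      ← edist_nndist]
    have hw : edist (Φ (W • V₁.1) w) (Φ (W • V₂.1) w) ≤ edist V₁.1 V₂.1 / 2 * ‖W w‖ₑ := by
      rw [← ENNReal.rpow_le_rpow_iff (z := (2 : ℕ)) (by norm_num), ENNReal.rpow_natCast,
        ENNReal.rpow_natCast, mul_pow, hWsq]
      refine (hout w).trans (le_of_eq ?_)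
      rw [div_eq_mul_inv, div_eq_mul_inv, mul_pow, ← ENNReal.inv_pow]
      norm_num
    have hinv : ‖W' w‖ₑ * ‖W w‖ₑ = 1 := by
      rw [← enorm_mul, show W' w * W w = 1 from inv_mul_cancel₀ (hW0 w), enorm_one]
    calc edist (Ψ V₁.1 w) (Ψ V₂.1 w) = ‖W' w‖ₑ * edist (Φ (W • V₁.1) w) (Φ (W • V₂.1) w) := by
          simp only [Ψ]
          rw [ContinuousMap.smul_apply', ContinuousMap.smul_apply', edist_smul₀,
            ENNReal.smul_def, smul_eq_mul]
          rfl
      _ ≤ ‖W' w‖ₑ * (edist V₁.1 V₂.1 / 2 * ‖W w‖ₑ) := mul_le_mul' le_rfl hw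
      _ = edist V₁.1 V₂.1 / 2 * (‖W' w‖ₑ * ‖W w‖ₑ) := by ring
      _ = _ := by
          rw [hinv, mul_one, div_eq_mul_inv, mul_comm]
          congr 1
          simp
  obtain ⟨V, hV, hfix, -⟩ := hcontr.exists_fixedPoint' (isComplete_adaptedCurves hB _) hΨ
    (x := 0) (fun w => by
      refine AEStronglyMeasurable.congr (f := fun _ => (0 : ℝ)) aestronglyMeasurable_const ?_
      exact (Lp.coeFn_zero ℝ 2 P).symm) (edist_ne_top _ _)
  have hfix' : Φ (W • V) = W • V := by
    have : W' • Φ (W • V) = V := hfix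
    ext1 w
    rw [ContinuousMap.smul_apply']
    conv_rhs => rw [← this]
    rw [ContinuousMap.smul_apply', smul_smul]
    simp [W', hW0 w]
  obtain ⟨X, Z, hX, hXV, hZ, hZV⟩ := (hΦ _ (hmem W hV)).2
  rw [hfix'] at hZV
  refine ⟨X, hX, ?_, hX.adapted, ae_integrableOn_rect (memLp_comp hα hLα h0α hX), fun w hw => ?_⟩
  · exact hX.measurable.comp ((measurable_subtype_coe.comp measurable_fst).prodMk measurable_snd)
  · obtain ⟨I, hI, hZI⟩ := hZ w hw
    refine ⟨I, hI, ?_⟩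
    filter_upwards [hZI, hZV ⟨w, hw⟩, hXV ⟨w, hw⟩] with ω h1 h2 h3
    rw [h3, ← h2, h1]

end FixedPoint

/-! ### Uniqueness -/

section Uniqueness

variable {Ω : Type*} [MeasurableSpace Ω] {B : ℝ × ℝ → Ω → ℝ} {P : Measure Ω}
  [IsProbabilityMeasure P]

omit [IsProbabilityMeasure P] in
theorem aemeasurable_prod_of_measurable {z : ℝ × ℝ} {Y : ℝ × ℝ → Ω → ℝ}
    (hY : Measurable (fun p : rect z × Ω => Y p.1 p.2)) :
    AEMeasurable (fun p : (ℝ × ℝ) × Ω => Y p.1 p.2) ((volume.restrict (rect z)).prod P) := by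
  classical
  have hs : MeasurableSet {p : (ℝ × ℝ) × Ω | p.1 ∈ rect z} := measurable_fst (measurableSet_rect _)
  have h : Measurable (fun p : (ℝ × ℝ) × Ω => if p.1 ∈ rect z then Y p.1 p.2 else 0) := by
    refine measurable_of_restrict_of_restrict_compl hs ?_ ?_
    · have h1 : Measurable (fun p : {p : (ℝ × ℝ) × Ω | p.1 ∈ rect z} =>
          ((⟨p.1.1, p.2⟩, p.1.2) : rect z × Ω)) :=
        (Measurable.subtype_mk (measurable_fst.comp measurable_subtype_coe)).prodMk
          (measurable_snd.comp measurable_subtype_coe)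
      convert hY.comp h1 using 1
      funext p
      have hp : p.1.1 ∈ rect z := p.2
      simp [hp]
    · convert measurable_const (a := (0 : ℝ)) using 1
      funext p
      have hp : p.1.1 ∉ rect z := p.2
      simp [hp]
  refine h.aemeasurable.congr ?_
  filter_upwards [ae_mem_rect (P := P) z] with p hp
  simp [hp]

omit [IsProbabilityMeasure P] in
/-- A family of random variables whose paths are the continuous functions `w ↦ ∫_{R_w} f` is
bounded on each of a sequence of events that exhaust `Ω`. As `f` need not be jointly measurable, the
events are defined by the supremum of the integrals over a countable dense set of `w`. -/
theorem exists_exhaustion {z : ℝ × ℝ} (hz : 0 ≤ z) {f : ℝ × ℝ → Ω → ℝ}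
    (hf : ∀ᵐ ω ∂P, IntegrableOn (fun ζ => f ζ ω) (rect z))
    (hm : ∀ w ∈ rect z, AEMeasurable (fun ω => ∫ ζ in rect w, f ζ ω) P) :
    ∃ F : ℕ → Set Ω, (∀ k, MeasurableSet (F k)) ∧ Monotone F ∧ (∀ᵐ ω ∂P, ω ∈ ⋃ k, F k) ∧
      ∀ k : ℕ, ∀ w ∈ rect z, ∀ᵐ ω ∂P.restrict (F k), ‖∫ ζ in rect w, f ζ ω‖ₑ ≤ k := by
  have : Nonempty (rect z) := ⟨⟨0, le_rfl, hz⟩⟩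
  let d : ℕ → rect z := TopologicalSpace.denseSeq (rect z)
  let g : Ω → ℝ≥0∞ := fun ω => ⨆ n, ‖∫ ζ in rect (d n : ℝ × ℝ), f ζ ω‖ₑ
  have hg : AEMeasurable g P := AEMeasurable.iSup fun n => (hm _ (d n).2).enorm
  have hgtop : ∀ᵐ ω ∂P, g ω < ∞ := by
    filter_upwards [hf] with ω hω
    refine lt_of_le_of_lt (iSup_le fun n => ?_) hω.2
    exact (enorm_integral_le_lintegral_enorm _).trans (lintegral_mono_set (rect_subset (d n).2))
  have hle : ∀ᵐ ω ∂P, ∀ w ∈ rect z, ‖∫ ζ in rect w, f ζ ω‖ₑ ≤ g ω := by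
    filter_upwards [hf] with ω hω w hw
    have hc : Continuous (fun w : rect z => ∫ ζ in rect (w : ℝ × ℝ), f ζ ω) :=
      continuousOn_iff_continuous_domRestrict.1 (continuousOn_integral_rect hω)
    refine (TopologicalSpace.denseRange_denseSeq (rect z)).induction_on
      (p := fun w : rect z => ‖∫ ζ in rect (w : ℝ × ℝ), f ζ ω‖ₑ ≤ g ω) ⟨w, hw⟩
      (isClosed_le hc.enorm continuous_const) fun n => ?_
    exact le_iSup (fun n => ‖∫ ζ in rect (d n : ℝ × ℝ), f ζ ω‖ₑ) n
  refine ⟨fun k => {ω | hg.mk g ω ≤ k}, fun k => measurableSet_le hg.measurable_mk measurable_const,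
    fun k j hkj ω (hω : hg.mk g ω ≤ k) =>
      show hg.mk g ω ≤ j from hω.trans (by exact_mod_cast hkj), ?_, fun k w hw => ?_⟩
  · filter_upwards [hgtop, hg.ae_eq_mk] with ω h1 h2
    rw [h2] at h1
    obtain ⟨k, hk⟩ := ENNReal.exists_nat_gt h1.ne
    exact Set.mem_iUnion.2 ⟨k, hk.le⟩
  · filter_upwards [ae_restrict_of_ae hle, ae_restrict_of_ae hg.ae_eq_mk,
      ae_restrict_mem (measurableSet_le hg.measurable_mk measurable_const)] with ω h1 h2 h3
    exact (h1 w hw).trans (h2 ▸ h3)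

/-- A strong solution restricts to a smaller rectangle. -/
theorem IsStrongSolution.restrict {α β : ℝ × ℝ → ℝ → MSpace P → ℝ} {y : ℝ} {z z₀ : ℝ × ℝ}
    {Y : ℝ × ℝ → Ω → ℝ} (hY : IsStrongSolution B P α β y z Y) (hz : z₀ ∈ rect z) :
    IsStrongSolution B P α β y z₀ Y where
  measurable := hY.measurable.comp (g := fun p : rect z × Ω => Y p.1 p.2)
    (f := fun p : rect z₀ × Ω => (Set.inclusion (rect_subset hz) p.1, p.2))
    (((measurable_subtype_coe.comp measurable_fst).subtype_mk).prodMk measurable_snd)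
  adapted w hw := hY.adapted w (rect_subset hz hw)
  integrable_drift := hY.integrable_drift.mono fun _ h => h.mono_set (rect_subset hz)
  equation w hw := hY.equation w (rect_subset hz hw)

variable [P.IsComplete]

/-- Two strong solutions are at a bounded distance in `L²(Ω)`. Their second moments are not assumed
to be finite: Grönwall's inequality is applied on the events of `exists_exhaustion`, where the
difference of the drifts is bounded, with a constant that does not depend on the event. The laws
are estimated by the diameter of the set of probability laws in `𝕄`. -/
theorem IsStrongSolution.exists_lintegral_sub_le (hB : IsBrownianSheet B P) {T C : ℝ}
    {α β : ℝ × ℝ → ℝ → MSpace P → ℝ} (hLα : IsLip P T C α) {y : ℝ} {z : ℝ × ℝ}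
    (hz : z ∈ rect (T, T)) {Y Y' : ℝ × ℝ → Ω → ℝ} (hY : IsStrongSolution B P α β y z Y)
    (hY' : IsStrongSolution B P α β y z Y') :
    ∃ M : ℝ≥0∞, M ≠ ∞ ∧ ∀ w ∈ rect z, ∫⁻ ω, ‖Y w ω - Y' w ω‖ₑ ^ 2 ∂P ≤ M := by
  obtain ⟨N, hN, hlaw⟩ := exists_enorm_toMSpace_sub_le (P := P)
  have hz0 : 0 ≤ z := hz.1
  have hzz : z ∈ rect z := ⟨hz0, le_rfl⟩
  have hYw {Y : ℝ × ℝ → Ω → ℝ} (hY : IsStrongSolution B P α β y z Y) :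
      ∀ w ∈ rect z, Measurable (Y w) :=
    fun w hw => (hY.adapted w hw).mono (sheetFiltration_le hB w) le_rfl
  have hD : AEMeasurable (fun p : (ℝ × ℝ) × Ω => Y p.1 p.2 - Y' p.1 p.2)
      ((volume.restrict (rect z)).prod P) :=
    (aemeasurable_prod_of_measurable hY.measurable).sub
      (aemeasurable_prod_of_measurable hY'.measurable)
  choose! I hI eI using hY.equation
  choose! I' hI' eI' using hY'.equation
  let a : ℝ × ℝ → Ω → ℝ := fun ζ ω => α ζ (Y ζ ω) (law P (Y ζ)) - α ζ (Y' ζ ω) (law P (Y' ζ))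
  have ha : ∀ᵐ ω ∂P, IntegrableOn (fun ζ => a ζ ω) (rect z) := by
    filter_upwards [hY.integrable_drift, hY'.integrable_drift] with ω h h'
    exact h.sub h'
  have haw : ∀ w ∈ rect z, ∀ᵐ ω ∂P, ∫ ζ in rect w, a ζ ω
      = (∫ ζ in rect w, α ζ (Y ζ ω) (law P (Y ζ)))
        - ∫ ζ in rect w, α ζ (Y' ζ ω) (law P (Y' ζ)) := by
    intro w hw
    filter_upwards [hY.integrable_drift, hY'.integrable_drift] with ω h h'
    exact integral_sub (h.mono_set (rect_subset hw)) (h'.mono_set (rect_subset hw))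
  have hdec : ∀ w ∈ rect z, ∀ᵐ ω ∂P,
      Y w ω - Y' w ω = (∫ ζ in rect w, a ζ ω) + (I w ω - I' w ω) := by
    intro w hw
    filter_upwards [haw w hw, eI w hw, eI' w hw] with ω h h1 h2
    rw [h, h1, h2]
    ring
  have hJm : ∀ w ∈ rect z, AEMeasurable (fun ω => I w ω - I' w ω) P := fun w hw =>
    ((hI w hw).2.1.1.sub (hI' w hw).2.1.1).aemeasurable
  have ham : ∀ w ∈ rect z, AEMeasurable (fun ω => ∫ ζ in rect w, a ζ ω) P := by
    intro w hw
    refine (((hYw hY w hw).sub (hYw hY' w hw)).aemeasurable.sub (hJm w hw)).congr ?_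
    filter_upwards [hdec w hw] with ω h
    simp only [Pi.sub_apply, h]
    ring
  obtain ⟨F, hFm, hFmono, hFU, hFb⟩ := exists_exhaustion hz0 ha ham
  -- The stochastic integrals are square integrable by definition.
  let κ : ℝ≥0∞ := eLpNorm (fun p : (ℝ × ℝ) × Ω => β p.1 (Y p.1 p.2) (law P (Y p.1))
    - β p.1 (Y' p.1 p.2) (law P (Y' p.1))) 2 ((volume.restrict (rect z)).prod P)
  have hκ : κ ≠ ∞ := ((hI z hzz).1.sub (hI' z hzz).1).2.ne
  have hJ : ∀ w ∈ rect z, ∫⁻ ω, ‖I w ω - I' w ω‖ₑ ^ 2 ∂P ≤ κ ^ 2 := by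
    intro w hw
    rw [← eLpNorm_two_sq (fun ω => I w ω - I' w ω)]
    refine pow_le_pow_left' (((hI w hw).eLpNorm_sub_le hB hw.1 (hI' w hw)).trans ?_) 2
    exact eLpNorm_mono_measure _ (prod_restrict_mono (P := P) (rect_subset hw))
  let V : ℝ≥0∞ := volume (rect (T, T))
  have hV : V ≠ ∞ := (volume_rect_lt_top _).ne
  let L : ℝ≥0∞ := 4 * (V * (4 * ENNReal.ofReal C ^ 2))
  let c : ℝ≥0∞ := L * (N ^ 2 * V) + 4 * κ ^ 2
  obtain ⟨Γ, hΓ, hgron⟩ := exists_gronwall (L := L) (by simp only [L]; finiteness) z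
  let u : ℕ → ℝ × ℝ → ℝ≥0∞ := fun k w => ∫⁻ ω in F k, ‖Y w ω - Y' w ω‖ₑ ^ 2 ∂P
  have hu1 : ∀ k, ∀ w ∈ rect z, u k w ≤
      4 * (∫⁻ ω in F k, ‖∫ ζ in rect w, a ζ ω‖ₑ ^ 2 ∂P + κ ^ 2) := by
    intro k w hw
    calc u k w ≤ ∫⁻ ω in F k, 4 * (‖∫ ζ in rect w, a ζ ω‖ₑ ^ 2 + ‖I w ω - I' w ω‖ₑ ^ 2) ∂P := by
          refine lintegral_mono_ae ?_
          filter_upwards [ae_restrict_of_ae (hdec w hw)] with ω h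
          rw [h]
          exact (pow_le_pow_left' (enorm_add_le _ _) 2).trans (add_sq_le_four _ _)
      _ = 4 * (∫⁻ ω in F k, ‖∫ ζ in rect w, a ζ ω‖ₑ ^ 2 ∂P
            + ∫⁻ ω in F k, ‖I w ω - I' w ω‖ₑ ^ 2 ∂P) := by
          rw [lintegral_const_mul' _ _ (by norm_num),
            lintegral_add_right' _ ((hJm w hw).restrict.enorm.pow_const 2)]
      _ ≤ _ := mul_le_mul' le_rfl (add_le_add le_rfl
          ((lintegral_mono' Measure.restrict_le_self le_rfl).trans (hJ w hw)))
  have hub : ∀ k, ∀ w ∈ rect z, u k w ≤ 4 * ((k : ℝ≥0∞) ^ 2 + κ ^ 2) := by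
    intro k w hw
    refine (hu1 k w hw).trans (mul_le_mul' le_rfl (add_le_add ?_ le_rfl))
    calc _ ≤ ∫⁻ ω in F k, (k : ℝ≥0∞) ^ 2 ∂P := by
          refine lintegral_mono_ae ?_
          filter_upwards [hFb k w hw] with ω h
          exact pow_le_pow_left' h 2
      _ ≤ (k : ℝ≥0∞) ^ 2 := by
          rw [lintegral_const]
          exact mul_le_of_le_one_right' (by simpa using prob_le_one)
  have hur : ∀ k, ∀ w ∈ rect z, u k w ≤ c + L * ∫⁻ ζ in rect w, u k ζ := by
    intro k w hw
    have hwz := rect_subset hw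
    have hdr := lintegral_drift_sub_le (P := P) hLα (Q := P.restrict (F k))
      (by simpa using prob_le_one) (rect_subset hz hw) (X := Y) (X' := Y')
      (hD.mono_measure (Measure.prod_mono (Measure.restrict_mono hwz le_rfl)
        Measure.restrict_le_self)) (ℓ := fun _ => N) aemeasurable_const
      (fun ζ hζ => by
        have := Measure.isProbabilityMeasure_map (μ := P) (hYw hY ζ (hwz hζ)).aemeasurable
        have := Measure.isProbabilityMeasure_map (μ := P) (hYw hY' ζ (hwz hζ)).aemeasurable
        exact hlaw _ _) (G := fun ω => ∫ ζ in rect w, a ζ ω)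
      (ae_restrict_of_ae (hY.integrable_drift.mono fun _ h => h.mono_set hwz))
      (ae_restrict_of_ae (hY'.integrable_drift.mono fun _ h => h.mono_set hwz))
      (ae_restrict_of_ae (haw w hw))
    rw [lintegral_add_right _ measurable_const, setLIntegral_const] at hdr
    calc u k w ≤ 4 * (V * (4 * ENNReal.ofReal C ^ 2 *
            ((∫⁻ ζ in rect w, u k ζ) + N ^ 2 * volume (rect w))) + κ ^ 2) :=
          (hu1 k w hw).trans (mul_le_mul' le_rfl (add_le_add hdr le_rfl))
      _ ≤ 4 * (V * (4 * ENNReal.ofReal C ^ 2 * ((∫⁻ ζ in rect w, u k ζ) + N ^ 2 * V)) + κ ^ 2) := by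
          have : volume (rect w) ≤ V := measure_mono (rect_subset (rect_subset hz hw))
          gcongr
      _ = _ := by
          simp only [c, L]
          ring
  refine ⟨Γ * c, by simp only [c, L]; finiteness, fun w hw => ?_⟩
  rw [← Measure.restrict_eq_self_of_ae_mem hFU,
    setLIntegral_iUnion_of_directed _ hFmono.directed_le]
  exact iSup_le fun k => hgron (u k) _ c (by finiteness) (hub k) (hur k) w hw

/-- Two strong solutions on the same rectangle are modifications of each other. -/
theorem IsStrongSolution.ae_eq (hB : IsBrownianSheet B P) {T C : ℝ}
    {α β : ℝ × ℝ → ℝ → MSpace P → ℝ} (hLα : IsLip P T C α) (hLβ : IsLip P T C β) {y : ℝ}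
    {z : ℝ × ℝ} (hz : z ∈ rect (T, T)) {Y Y' : ℝ × ℝ → Ω → ℝ}
    (hY : IsStrongSolution B P α β y z Y) (hY' : IsStrongSolution B P α β y z Y') {w : ℝ × ℝ}
    (hw : w ∈ rect z) : Y w =ᵐ[P] Y' w := by
  obtain ⟨M, hM, hYM⟩ := hY.exists_lintegral_sub_le hB hLα hz hY'
  obtain ⟨Γ, -, hgron⟩ := exists_gronwall (picardConst_ne_top T C) z
  have hYw {Y : ℝ × ℝ → Ω → ℝ} (hY : IsStrongSolution B P α β y z Y) :
      ∀ w ∈ rect z, Measurable (Y w) :=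
    fun w hw => (hY.adapted w hw).mono (sheetFiltration_le hB w) le_rfl
  have h := hgron (fun w => eLpNorm (fun ω => Y w ω - Y' w ω) 2 P ^ 2) M 0 hM
    (fun w hw => by
      rw [eLpNorm_two_sq]
      exact hYM w hw)
    (fun w hw => by
      rw [zero_add]
      obtain ⟨I, hI, e⟩ := hY.equation w hw
      obtain ⟨I', hI', e'⟩ := hY'.equation w hw
      have hwz := rect_subset hw
      exact sq_eLpNorm_output_sub_le hB hLα hLβ (rect_subset hz hw)
        ((aemeasurable_prod_of_measurable hY.measurable).mono_measure (prod_restrict_mono hwz))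
        ((aemeasurable_prod_of_measurable hY'.measurable).mono_measure (prod_restrict_mono hwz))
        (fun ζ hζ => (hYw hY ζ (hwz hζ)).aemeasurable)
        (fun ζ hζ => (hYw hY' ζ (hwz hζ)).aemeasurable)
        (hY.integrable_drift.mono fun _ h => h.mono_set hwz)
        (hY'.integrable_drift.mono fun _ h => h.mono_set hwz)
        (hYw hY w hw).aestronglyMeasurable (hYw hY' w hw).aestronglyMeasurable hI hI' e e') w hw
  have h0 : eLpNorm (fun ω => Y w ω - Y' w ω) 2 P = 0 := by simpa using h
  rw [eLpNorm_eq_zero_iff (f := fun ω => Y w ω - Y' w ω)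
    ((hYw hY w hw).sub (hYw hY' w hw)).aestronglyMeasurable (by norm_num)] at h0
  filter_upwards [h0] with ω hω
  exact sub_eq_zero.1 hω

end Uniqueness

end MVSheet

theorem mainTheorem2 {Ω : Type*} [MeasurableSpace Ω] (P : Measure Ω) [IsProbabilityMeasure P]
    [P.IsComplete] (B : ℝ × ℝ → Ω → ℝ) (hB : MVSheet.IsBrownianSheet B P)
    (T : ℝ) (hT : 0 < T) (α β : ℝ × ℝ → ℝ → MVSheet.MSpace P → ℝ)
    (hα : MVSheet.IsAdmissible T α) (hβ : MVSheet.IsAdmissible T β)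
    (C : ℝ)
    (hLip : ∀ z ∈ MVSheet.rect (T, T), ∀ (u u' : ℝ) (μ μ' : MVSheet.MSpace P),
      |α z u μ - α z u' μ'| + |β z u μ - β z u' μ'| ≤ C * (|u - u'| + ‖μ - μ'‖))
    (hzero : ∀ z ∈ MVSheet.rect (T, T), IntegrableOn
      (fun ζ => |α ζ 0 (MVSheet.toMSpace P (Measure.dirac 0))| ^ 2
        + |β ζ 0 (MVSheet.toMSpace P (Measure.dirac 0))| ^ 2) (MVSheet.rect z))
    (y : ℝ) :
    ∃ Y : ℝ × ℝ → Ω → ℝ, MVSheet.IsStrongSolution B P α β y (T, T) Y ∧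
      ∀ z₀ ∈ MVSheet.rect (T, T), ∀ Y' : ℝ × ℝ → Ω → ℝ,
        MVSheet.IsStrongSolution B P α β y z₀ Y' →
          ∀ z ∈ MVSheet.rect z₀, ∀ᵐ ω ∂P, Y' z ω = Y z ω := by
  have hLα : MVSheet.IsLip P T C α := fun z hz u u' μ μ' =>
    (le_add_of_nonneg_right (abs_nonneg _)).trans (hLip z hz u u' μ μ')
  have hLβ : MVSheet.IsLip P T C β := fun z hz u u' μ μ' =>
    (le_add_of_nonneg_left (abs_nonneg _)).trans (hLip z hz u u' μ μ')
  have h0 := hzero (T, T) ⟨⟨hT.le, hT.le⟩, le_rfl⟩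
  simp only [sq_abs] at h0
  have h0α := hα.integrableOn_sq h0 fun ζ => le_add_of_nonneg_right (sq_nonneg _)
  have h0β := hβ.integrableOn_sq h0 fun ζ => le_add_of_nonneg_left (sq_nonneg _)
  obtain ⟨Y, -, hY⟩ := MVSheet.exists_isStrongSolution hB hα hβ hLα hLβ h0α h0β y
  exact ⟨Y, hY, fun z₀ hz₀ Y' hY' z hz => hY'.ae_eq hB hLα hLβ hz₀ (hY.restrict hz₀) hz⟩
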